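/- Let $G$ be a compact Lie group of dimension $n$ with unit $e$, normalised Haar measure and a bi-invariant Riemannian metric; let $\mathcal L$ be its Laplacian. For a continuous irreducible unitary representation $\xi:G\to U(d_\xi)$ let $-\lambda_\xi^2$ be the eigenvalue of $\mathcal L$ on the matrix coefficients of $\xi$, and $\langle\xi\rangle=(1+\lambda_\xi^2)^{1/2}$. For a distribution $T\in\mathcal D'(G)$ put $\widehat T(\xi)=T(\xi^*)$ (for a function, $\widehat T(\xi)=\int_G T(x)\,\xi(x)^*\,dx$). A smooth function $q$ on $G$ vanishes of order $\ell$ at $e$ if $(Pq)(e)=0$ for all left-invariant differential operators $P$ of order at most $\ell-1$; the corresponding difference operator of order $\ell$ is $Q_\xi\widehat T(\xi)=\widehat{qT}(\xi)$. A finite family $\triangle_1,\dots,\triangle_r$ of first order difference operators with functions $q_1,\dots,q_r$ is admissible if $dq_j(e)\neq0$ for all $j$ and $dq_1(e),\dots,dq_r(e)$ have (complex) rank $n$, and strongly admissible if moreover $e$ is the only common zero of the $q_j$; $\triangle_\xi^\alpha=\triangle_1^{\alpha_1}\cdots\triangle_r^{\alpha_r}$. Fix a basis $\partial_{x_1},\dots,\partial_{x_n}$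 of the left-invariant vector fields and put $\partial_x^\beta=\partial_{x_1}^{\beta_1}\cdots\partial_{x_n}^{\beta_n}$. Let $m\in\mathbb R$, and let $A:C^\infty(G)\to\mathcal D'(G)$ be linear and continuous with symbol $\sigma_A(x,\xi)=\xi(x)^*(A\xi)(x)$, smooth in $x$. The right-convolution kernel $R_A(x,\cdot)$ is the distribution with Fourier transform $\sigma_A(x,\cdot)$. Consider the following conditions; the estimates are uniform in $x\in G$ and $\xi$, and include that the families of matrices to which difference operators are applied are, for each $x$, Fourier transforms of distributions. (B) For all $k,\ell\ge0$, every left-invariant differential operator $P_x$ of order $k$ and every difference operator $Q_\xi$ of order $\ell$: $\|Q_\xi P_x\sigma_A(x,\xi)\|_{op}\le C_{Q_\xi P_x}\langle\xi\rangle^{m-\ell}$. (C) For every admissible family and all multi-indices $\alpha\in\mathbb N_0^r$, $\beta\in\mathbb N_0^n$: $\|\triangle_\xi^\alpha\partial_x^\beta\sigma_A(x,\xi)\|_{op}\le C_{\alpha\beta}\langle\xi\rangle^{m-|\alpha|}$; moreover $\operatorname{sing\,supp}R_A(x,\cdot)\subseteq\{e\}$ for every $x\in G$. (D) For a given strongly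 admissible family and all $\alpha\in\mathbb N_0^r$, $\beta\in\mathbb N_0^n$: $\|\triangle_\xi^\alpha\partial_x^\beta\sigma_A(x,\xi)\|_{op}\le C_{\alpha\beta}\langle\xi\rangle^{m-|\alpha|}$. For $u\in G$ let $A_uf=A(f\circ\phi)\circ\phi^{-1}$ with $\phi(x)=xu$. Then for every $u\in G$ the symbol of $A_u$ is $$\sigma_{A_u}(x,\xi)=\xi(u)^*\,\sigma_A(xu^{-1},\xi)\,\xi(u),$$ and $\sigma_{A_u}$ satisfies the same estimates as $\sigma_A$: if $\sigma_A$ satisfies (B), then so does $\sigma_{A_u}$; if $\sigma_A$ satisfies (C), then so does $\sigma_{A_u}$; and if $\sigma_A$ satisfies (D) for a strongly admissible family, then $\sigma_{A_u}$ satisfies (D) for the same family. -/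

import Mathlib

open scoped Manifold ContDiff
open MeasureTheory Set

noncomputable section

namespace LieSymbol

section SmoothFunctions

/-- Multiplication of complex numbers is smooth over the reals. -/
instance : ContMDiffRing 𝓘(ℝ, ℂ) ∞ ℂ where
  contMDiff_mul := by
    exact (contDiff_mul (𝕜 := ℝ) (𝔸 := ℂ) (n := ∞)).contMDiff.comp
      (contMDiff_fst.prodMk_space contMDiff_snd)

/-- `C^∞(G)`: the smooth complex valued functions on `G`, a manifold modelled on `E`. -/
abbrev SmoothFn (E G : Type*) [NormedAddCommGroup E] [NormedSpace ℝ E]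
    [TopologicalSpace G] [ChartedSpace E G] : Type _ :=
  C^∞⟮𝓘(ℝ, E), G; 𝓘(ℝ, ℂ), ℂ⟯

variable {E G : Type*} [NormedAddCommGroup E] [NormedSpace ℝ E]
  [TopologicalSpace G] [ChartedSpace E G]

/-- `C^∞(G)` is a complex vector space. -/
instance : SMul ℂ (SmoothFn E G) where
  smul c f := ⟨fun x => c * f x, (contMDiff_const (c := c)).mul f.contMDiff⟩

@[simp] theorem smul_apply (c : ℂ) (f : SmoothFn E G) (x : G) : (c • f) x = c * f x := rfl

instance : Module ℂ (SmoothFn E G) where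
  one_smul f := by ext x; simp
  mul_smul c d f := by ext x; simp [mul_assoc]
  smul_zero c := by ext x; simp
  smul_add c f g := by ext x; simp [mul_add]
  add_smul c d f := by ext x; simp [add_mul]
  zero_smul f := by ext x; simp

/-- Differentiation under the integral sign. -/
theorem contDiffOn_integral [FiniteDimensional ℝ E] [IsManifold 𝓘(ℝ, E) ∞ G] [CompactSpace G]
    [MeasurableSpace G] [OpensMeasurableSpace G] (μ : Measure G) [IsFiniteMeasure μ]
    {U : Set E} (hU : IsOpen U) {f : G → ℂ} (hf : Continuous f) (n : ℕ) :
    ∀ Ψ : E → G → ℂ,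
    ContMDiffOn (𝓘(ℝ, E).prod 𝓘(ℝ, E)) 𝓘(ℝ, ℂ) ∞ (Function.uncurry Ψ) (U ×ˢ univ) →
    ContDiffOn ℝ n (fun t => ∫ y, Ψ t y * f y ∂μ) U := by
  induction n with
  | zero =>
    intro Ψ hΨ
    refine contDiffOn_zero.2 (continuousOn_integral_of_compact_support isCompact_univ ?_ (by simp))
    exact hΨ.continuousOn.mul (hf.comp continuous_snd).continuousOn
  | succ n ih =>
    intro Ψ hΨ
    have : IsManifold 𝓘(ℝ, E) 1 G := IsManifold.of_le (n := ∞) (by simp)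
    let D : E × G → E →L[ℝ] ℂ := fun p => fderiv ℝ (fun s => Ψ s p.2) p.1
    have hD : ContMDiffOn (𝓘(ℝ, E).prod 𝓘(ℝ, E)) 𝓘(ℝ, E →L[ℝ] ℂ) ∞ D (U ×ˢ univ) := by
      rintro ⟨t, y⟩ ⟨ht, -⟩
      have h1 : ContMDiffAt (𝓘(ℝ, E).prod 𝓘(ℝ, E)) 𝓘(ℝ, ℂ) ∞ (Function.uncurry Ψ) (t, y) :=
        (hΨ (t, y) ⟨ht, trivial⟩).contMDiffAt ((hU.prod isOpen_univ).mem_nhds ⟨ht, trivial⟩)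
      have h2 : ContMDiffAt ((𝓘(ℝ, E).prod 𝓘(ℝ, E)).prod 𝓘(ℝ, E)) 𝓘(ℝ, ℂ) ∞
          (Function.uncurry fun (p : E × G) (s : E) => Ψ s p.2) ((t, y), t) :=
        ContMDiffAt.comp (g := Function.uncurry Ψ)
          (f := fun q : (E × G) × E => (q.2, q.1.2)) ((t, y), t) h1
          (contMDiffAt_snd.prodMk (contMDiffAt_snd.comp _ contMDiffAt_fst))
      have h3 := ContMDiffAt.mfderiv (m := ∞) (fun (p : E × G) (s : E) => Ψ s p.2) Prod.fst h2
        contMDiffAt_fst (by simp)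
      have h4 := inTangentCoordinates_model_space (I := 𝓘(ℝ, E)) (I' := 𝓘(ℝ, ℂ))
        (Prod.fst : E × G → E) (fun p => Ψ p.1 p.2) D (t, y)
      have h5 : D = fun p : E × G => mfderiv 𝓘(ℝ, E) 𝓘(ℝ, ℂ) (fun s => Ψ s p.2) p.1 := by
        funext p
        exact mfderiv_eq_fderiv.symm
      rw [h5] at h4
      refine ContMDiffAt.contMDiffWithinAt (h3.congr_of_eventuallyEq
        (Filter.Eventually.of_forall fun p => ?_))
      exact (congrFun h5 p).trans (congrFun h4.symm p)
    have hdiff : ∀ t ∈ U, ∀ y, HasFDerivAt (fun s => Ψ s y) (D (t, y)) t := by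
      intro t ht y
      have h1 : ContMDiffAt 𝓘(ℝ, E) 𝓘(ℝ, ℂ) ∞ (fun s => Ψ s y) t :=
        ContMDiffAt.comp (g := Function.uncurry Ψ) (f := fun s : E => (s, y)) t
          ((hΨ (t, y) ⟨ht, trivial⟩).contMDiffAt ((hU.prod isOpen_univ).mem_nhds ⟨ht, trivial⟩))
          (contMDiffAt_id.prodMk contMDiffAt_const)
      exact (h1.contDiffAt.differentiableAt (by simp)).hasFDerivAt
    have hcont : ∀ s ∈ U, Continuous fun y => Ψ s y := fun s hs => by
      have := hΨ.continuousOn.comp (f := fun y : G => (s, y)) (s := univ) (by fun_prop)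
        (fun y _ => ⟨hs, trivial⟩)
      exact continuousOn_univ.1 this
    have hcontD : ∀ s ∈ U, Continuous fun y => f y • D (s, y) := fun s hs => by
      have := hD.continuousOn.comp (f := fun y : G => (s, y)) (s := univ) (by fun_prop)
        (fun y _ => ⟨hs, trivial⟩)
      exact hf.smul (continuousOn_univ.1 this)
    have hder : ∀ t ∈ U, HasFDerivAt (fun t => ∫ y, Ψ t y * f y ∂μ)
        (∫ y, f y • D (t, y) ∂μ) t := by
      intro t ht
      obtain ⟨K, hK, hKU, hKc⟩ := local_compact_nhds (hU.mem_nhds ht)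
      have hD' : ContinuousOn (fun p : E × G => f p.2 • D p) (U ×ˢ univ) :=
        (hf.comp continuous_snd).continuousOn.smul hD.continuousOn
      obtain ⟨C, hC⟩ := (hKc.prod isCompact_univ).exists_bound_of_continuousOn
        (hD'.mono (prod_mono hKU (subset_refl (univ : Set G))))
      refine hasFDerivAt_integral_of_dominated_of_fderiv_le (s := K) (bound := fun _ => C)
        (F' := fun t y => f y • D (t, y)) hK ?_ ?_ ?_ ?_ (integrable_const _) ?_
      · filter_upwards [hU.mem_nhds ht] with s hs
        exact ((hcont s hs).mul hf).stronglyMeasurable_of_hasCompactSupport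
          (HasCompactSupport.of_compactSpace _) |>.aestronglyMeasurable
      · refine Continuous.integrable_of_hasCompactSupport
          ((hcont t ht).mul hf) (HasCompactSupport.of_compactSpace _)
      · exact (hcontD t ht).stronglyMeasurable_of_hasCompactSupport
          (HasCompactSupport.of_compactSpace _) |>.aestronglyMeasurable
      · exact Filter.Eventually.of_forall fun y s hs => hC (s, y) ⟨hs, trivial⟩
      · refine Filter.Eventually.of_forall fun y s hs => ?_
        have := (hdiff s (hKU hs) y).mul_const (f y)
        exact this
    have hint : ∀ t ∈ U, Integrable (fun y => f y • D (t, y)) μ := fun t ht =>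
      Continuous.integrable_of_hasCompactSupport
        (hcontD t ht) (HasCompactSupport.of_compactSpace _)
    push_cast
    rw [contDiffOn_succ_iff_fderiv_of_isOpen hU]
    refine ⟨fun t ht => (hder t ht).differentiableAt.differentiableWithinAt, by simp, ?_⟩
    rw [contDiffOn_clm_apply]
    intro v
    refine (ih (fun t y => D (t, y) v) (hD.clm_apply contMDiffOn_const)).congr fun t ht => ?_
    rw [(hder t ht).fderiv, ContinuousLinearMap.integral_apply (hint t ht)]
    refine integral_congr_ae (Filter.Eventually.of_forall fun y => ?_)
    simp [mul_comm]

/-- Convolving a continuous function with a smooth function gives a smooth function. -/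
theorem contMDiff_integral [FiniteDimensional ℝ E] [Group G] [LieGroup 𝓘(ℝ, E) ∞ G]
    [CompactSpace G] [MeasurableSpace G] [OpensMeasurableSpace G] (μ : Measure G)
    [IsFiniteMeasure μ] {f φ : G → ℂ} (hf : Continuous f)
    (hφ : ContMDiff 𝓘(ℝ, E) 𝓘(ℝ, ℂ) ∞ φ) :
    ContMDiff 𝓘(ℝ, E) 𝓘(ℝ, ℂ) ∞ (fun x => ∫ y, φ (x⁻¹ * y) * f y ∂μ) := by
  intro x₀
  have hx₀ : x₀ ∈ (chartAt E x₀).source := mem_chart_source _ _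
  have hU : IsOpen (chartAt E x₀).target := (chartAt E x₀).open_target
  have h1 : ContDiffOn ℝ ∞ (fun t => ∫ y, φ (((chartAt E x₀).symm t)⁻¹ * y) * f y ∂μ)
      (chartAt E x₀).target := by
    rw [contDiffOn_infty]
    intro n
    refine contDiffOn_integral μ hU hf n (fun t y => φ (((chartAt E x₀).symm t)⁻¹ * y)) ?_
    have h2 : ContMDiffOn (𝓘(ℝ, E).prod 𝓘(ℝ, E)) 𝓘(ℝ, E) ∞
        (fun p : E × G => (chartAt E x₀).symm p.1) ((chartAt E x₀).target ×ˢ univ) :=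
      (contMDiffOn_chart_symm (I := 𝓘(ℝ, E)) (x := x₀)).comp contMDiffOn_fst
        (fun p hp => hp.1)
    exact hφ.comp_contMDiffOn (h2.inv.mul contMDiffOn_snd)
  have h3 : ContMDiffOn 𝓘(ℝ, E) 𝓘(ℝ, ℂ) ∞ (fun x => ∫ y, φ (x⁻¹ * y) * f y ∂μ)
      (chartAt E x₀).source := by
    refine (h1.contMDiffOn.comp (contMDiffOn_chart (I := 𝓘(ℝ, E)) (x := x₀))
      (fun x hx => (chartAt E x₀).map_source hx)).congr fun x hx => ?_
    simp [(chartAt E x₀).left_inv hx]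
  exact h3.contMDiffAt ((chartAt E x₀).open_source.mem_nhds hx₀)

/-- A continuous unitary matrix representation of a compact Lie group is smooth. -/
theorem contMDiff_rep [FiniteDimensional ℝ E] [Group G] [LieGroup 𝓘(ℝ, E) ∞ G]
    [CompactSpace G] [T2Space G] {d : ℕ} (ρ : G →* Matrix.unitaryGroup (Fin d) ℂ)
    (hρ : Continuous ρ) (i j : Fin d) :
    ContMDiff 𝓘(ℝ, E) 𝓘(ℝ, ℂ) ∞ (fun x => (ρ x : Matrix (Fin d) (Fin d) ℂ) i j) := by
  have : IsTopologicalGroup G := topologicalGroup_of_lieGroup 𝓘(ℝ, E) ∞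
  borelize G
  let μ : Measure G := Measure.haar
  have hρc : ∀ i j, Continuous fun x => (ρ x : Matrix (Fin d) (Fin d) ℂ) i j := fun i j =>
    (continuous_subtype_val.comp hρ).matrix_elem i j
  -- a bump function concentrated where `ρ` is close to the identity
  let V : Set G := {x | ∀ i j, ‖(ρ x : Matrix (Fin d) (Fin d) ℂ) i j
    - (1 : Matrix (Fin d) (Fin d) ℂ) i j‖ < 1 / (d + 1)}
  have hVo : IsOpen V := by
    simp only [V, ofPred_forall]
    exact isOpen_iInter_of_finite fun i => isOpen_iInter_of_finite fun j =>
      isOpen_lt ((hρc i j).sub continuous_const).norm continuous_const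
  have hV : V ∈ nhds (1 : G) := hVo.mem_nhds (by
    change ∀ i j, _
    intro i j
    have : (0 : ℝ) < 1 / (d + 1) := by positivity
    simpa using this)
  obtain ⟨b, -, hb⟩ := ((SmoothBumpFunction.nhds_basis_support (I := 𝓘(ℝ, E)) hV).mem_iff).1 hV
  have hbc : Continuous b := b.continuous
  have hbi : ∀ F : G → ℂ, Continuous F → Integrable F μ := fun F hF =>
    hF.integrable_of_hasCompactSupport (HasCompactSupport.of_compactSpace _)
  let φ : G → ℂ := fun x => (b x : ℂ)
  have hφ : ContMDiff 𝓘(ℝ, E) 𝓘(ℝ, ℂ) ∞ φ :=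
    (Complex.ofRealCLM.contDiff (n := ∞)).contMDiff.comp b.contMDiff
  have hφc : Continuous φ := hφ.continuous
  let M : Matrix (Fin d) (Fin d) ℂ := fun k l => ∫ y, φ y * (ρ y : Matrix (Fin d) (Fin d) ℂ) k l ∂μ
  let c : ℝ := ∫ y, b y ∂μ
  have hc : 0 < c := by
    refine (integral_pos_iff_support_of_nonneg (fun y => b.nonneg) ?_).2 ?_
    · exact hbc.integrable_of_hasCompactSupport (HasCompactSupport.of_compactSpace _)
    · exact b.isOpen_support.measure_pos μ ⟨1, b.c_mem_support⟩
  have hM : ∀ k l, ‖M k l - c * (1 : Matrix (Fin d) (Fin d) ℂ) k l‖ ≤ c * (1 / (d + 1)) := by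
    intro k l
    have h1 : M k l - c * (1 : Matrix (Fin d) (Fin d) ℂ) k l =
        ∫ y, φ y * ((ρ y : Matrix (Fin d) (Fin d) ℂ) k l - (1 : Matrix (Fin d) (Fin d) ℂ) k l) ∂μ := by
      simp only [mul_sub]
      rw [integral_sub (hbi (fun y => φ y * (ρ y : Matrix (Fin d) (Fin d) ℂ) k l) (hφc.mul (hρc k l)))
        (hbi (fun y => φ y * (1 : Matrix (Fin d) (Fin d) ℂ) k l) (hφc.mul continuous_const)),
        integral_mul_const]
      congr 2
      exact integral_ofReal.symm
    rw [h1, ← integral_mul_const]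
    refine norm_integral_le_of_norm_le ?_ (Filter.Eventually.of_forall fun y => ?_)
    · exact (hbc.mul continuous_const).integrable_of_hasCompactSupport
        (HasCompactSupport.of_compactSpace _)
    · rw [norm_mul]
      by_cases hy : y ∈ Function.support b
      · have : ‖φ y‖ = b y := by simp [φ, abs_of_nonneg b.nonneg]
        rw [this]
        exact mul_le_mul_of_nonneg_left (hb hy k l).le b.nonneg
      · have : b y = 0 := by simpa using hy
        simp [φ, this]
  have hdet : IsUnit M.det := by
    rw [isUnit_iff_ne_zero]
    refine det_ne_zero_of_sum_row_lt_diag fun k => ?_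
    have hd : (0 : ℝ) < d + 1 := by positivity
    have h1 : c - c * (1 / (d + 1)) ≤ ‖M k k‖ := by
      have h2 := hM k k
      rw [Matrix.one_apply_eq, mul_one] at h2
      have h3 := norm_sub_norm_le (c : ℂ) (c - M k k)
      rw [sub_sub_cancel, norm_sub_rev, Complex.norm_real, Real.norm_of_nonneg hc.le] at h3
      linarith
    have h2 : ∑ l ∈ Finset.univ.erase k, ‖M k l‖ ≤ ∑ l ∈ Finset.univ.erase k, c * (1 / (d + 1)) := by
      refine Finset.sum_le_sum fun l hl => ?_
      have := hM k l
      rwa [Matrix.one_apply_ne (Finset.ne_of_mem_erase hl).symm, mul_zero, sub_zero] at this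
    have h4 : (1 : ℝ) ≤ d := by exact_mod_cast k.pos
    rw [Finset.sum_const, Finset.card_erase_of_mem (Finset.mem_univ k), Finset.card_univ,
      Fintype.card_fin, nsmul_eq_mul, Nat.cast_sub k.pos, Nat.cast_one] at h2
    refine h2.trans_lt (lt_of_lt_of_le ?_ h1)
    have : c - c * (1 / (d + 1)) - (d - 1) * (c * (1 / (d + 1))) = c * (1 / (d + 1)) := by
      field_simp
      ring
    have : 0 < c * (1 / ((d : ℝ) + 1)) := by positivity
    linarith
  have hconv : ∀ x k l, ∫ y, φ (x⁻¹ * y) * (ρ y : Matrix (Fin d) (Fin d) ℂ) k l ∂μ =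
      ((ρ x : Matrix (Fin d) (Fin d) ℂ) * M) k l := by
    intro x k l
    rw [← integral_mul_left_eq_self _ x, Matrix.mul_apply]
    simp only [inv_mul_cancel_left, map_mul, Submonoid.coe_mul, Matrix.mul_apply, Finset.mul_sum, M]
    rw [integral_finsetSum _ fun r _ => hbi (fun y => φ y * ((ρ x : Matrix (Fin d) (Fin d) ℂ) k r *
      (ρ y : Matrix (Fin d) (Fin d) ℂ) r l)) (hφc.mul (continuous_const.mul (hρc r l)))]
    refine Finset.sum_congr rfl fun r _ => ?_
    rw [← integral_const_mul]
    refine integral_congr_ae (Filter.Eventually.of_forall fun y => ?_)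
    simp only
    ring
  have hfin : (fun x => (ρ x : Matrix (Fin d) (Fin d) ℂ) i j) = fun x =>
      ∑ k, (∫ y, φ (x⁻¹ * y) * (ρ y : Matrix (Fin d) (Fin d) ℂ) i k ∂μ) * M⁻¹ k j := by
    funext x
    simp only [hconv]
    rw [← Matrix.mul_apply, Matrix.mul_assoc, Matrix.mul_nonsing_inv _ hdet, Matrix.mul_one]
  rw [hfin]
  refine contMDiff_finsetSum fun k _ => ?_
  exact ((ContinuousLinearMap.mul ℝ ℂ).flip (M⁻¹ k j)).contDiff.contMDiff.comp
    (contMDiff_integral μ (hρc i k) hφ)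

/-- Complex conjugation on `C^∞(G)`. -/
def conjFn (f : SmoothFn E G) : SmoothFn E G :=
  ⟨fun x => star (f x), (Complex.conjCLE.contDiff (n := ∞)).contMDiff.comp f.contMDiff⟩

variable [Group G] [LieGroup 𝓘(ℝ, E) ∞ G]

theorem lieDeriv_eq (X : GroupLieAlgebra 𝓘(ℝ, E) G) (f : SmoothFn E G) (x : G) :
    (mfderiv 𝓘(ℝ, E) 𝓘(ℝ, ℂ) f x (mulInvariantVectorField X x) : ℂ) =
      mfderiv 𝓘(ℝ, E) 𝓘(ℝ, ℂ) (fun y => f (x * y)) 1 X := by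
  have := mfderiv_comp_apply_of_eq (I := 𝓘(ℝ, E)) (I' := 𝓘(ℝ, E)) (I'' := 𝓘(ℝ, ℂ)) (f := fun y => x * y)
      (g := (f : G → ℂ)) (x := (1 : G)) (y := x) f.mdifferentiableAt
      ((contMDiff_mul_left (n := ∞)).contMDiffAt.mdifferentiableAt (by simp)) (mul_one x) X
  exact this.symm

theorem contMDiff_lieDeriv (X : GroupLieAlgebra 𝓘(ℝ, E) G) (f : SmoothFn E G) :
    ContMDiff 𝓘(ℝ, E) 𝓘(ℝ, ℂ) ∞
      (fun x => (mfderiv 𝓘(ℝ, E) 𝓘(ℝ, ℂ) f x (mulInvariantVectorField X x) : ℂ)) := by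
  intro x₀
  have : IsManifold 𝓘(ℝ, E) 1 G := IsManifold.of_le (n := ∞) (by simp)
  have h2 := ContMDiffAt.mfderiv_apply (I := 𝓘(ℝ, E)) (I' := 𝓘(ℝ, ℂ)) (J := 𝓘(ℝ, E)) (J' := 𝓘(ℝ, E)) (m := ∞) (n := ∞) (x₀ := x₀)
    (fun x y : G => f (x * y)) (fun _ => (1 : G)) id (fun _ => X)
    (by exact (f.contMDiff.comp (contMDiff_mul 𝓘(ℝ, E) ∞)).contMDiffAt)
    contMDiffAt_const contMDiffAt_id contMDiffAt_const (by simp)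
  refine h2.congr_of_eventuallyEq (Filter.Eventually.of_forall fun x => ?_)
  have h3 := inTangentCoordinates_eq (I := 𝓘(ℝ, E)) (I' := 𝓘(ℝ, ℂ)) (fun _ : G => (1 : G))
    (fun x => f (x * 1)) (fun x => (mfderiv 𝓘(ℝ, E) 𝓘(ℝ, ℂ) (fun y => f (x * y)) 1 : E →L[ℝ] ℂ))
    (x₀ := x₀) (x := x) (by simp) (Set.mem_univ _)
  refine (lieDeriv_eq X f x).trans (Eq.trans ?_ (congrArg (fun L => L X) h3).symm)
  have h4 : (tangentBundleCore 𝓘(ℝ, E) G).coordChange (achart E (1:G)) (achart E (1:G)) 1 X = X :=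
      (tangentBundleCore 𝓘(ℝ, E) G).coordChange_self _ _ (by simp) _
  have h5 : ∀ v : ℂ, (tangentBundleCore 𝓘(ℝ, ℂ) ℂ).coordChange (achart ℂ (f (x * 1)))
     (achart ℂ (f (x₀ * 1))) (f (x * 1)) v = v := fun v => 
     (tangentBundleCore 𝓘(ℝ, ℂ) ℂ).coordChange_self (achart ℂ (f (x * 1))) _ (by simp) _
  refine Eq.trans ?_ (h5 _).symm
  exact congrArg (mfderiv 𝓘(ℝ, E) 𝓘(ℝ, ℂ) (fun y => f (x * y)) 1) h4.symm

/-- The left-invariant vector field with value `X` at the identity, as a first order differential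
operator on `C^∞(G)`. -/
def lieDeriv (X : GroupLieAlgebra 𝓘(ℝ, E) G) : SmoothFn E G →ₗ[ℂ] SmoothFn E G where
  toFun f := ⟨_, contMDiff_lieDeriv X f⟩
  map_add' f g := by
    ext x
    have := mfderiv_add (f.mdifferentiableAt (x := x)) (g.mdifferentiableAt (x := x))
    exact congrArg (fun L => L (mulInvariantVectorField X x)) this
  map_smul' c f := by
    ext x
    have h1 := ((ContinuousLinearMap.mul ℝ ℂ c).hasMFDerivAt (x := f x)).comp x
      (f.mdifferentiableAt (x := x)).hasMFDerivAt
    exact congrArg (fun L => L (mulInvariantVectorField X x)) h1.mfderiv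


theorem lieDeriv_apply (X : GroupLieAlgebra 𝓘(ℝ, E) G) (f : SmoothFn E G) (x : G) :
    lieDeriv X f x = mfderiv 𝓘(ℝ, E) 𝓘(ℝ, ℂ) f x (mulInvariantVectorField X x) := rfl

theorem lieDeriv_mul (X : GroupLieAlgebra 𝓘(ℝ, E) G) (f g : SmoothFn E G) :
    lieDeriv X (f * g) = lieDeriv X f * g + f * lieDeriv X g := by
  ext x
  have h := (f.mdifferentiableAt (x := x)).hasMFDerivAt.mul
    (g.mdifferentiableAt (x := x)).hasMFDerivAt
  have h1 := congrArg (fun L => L (mulInvariantVectorField X x)) h.mfderiv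
  refine h1.trans ?_
  change f x * lieDeriv X g x + g x * lieDeriv X f x = lieDeriv X f x * g x + f x * lieDeriv X g x
  ring

/-- The composition `X₁ ⋯ X_k` of left-invariant vector fields. -/
def lieWord (l : List (GroupLieAlgebra 𝓘(ℝ, E) G)) : Module.End ℂ (SmoothFn E G) :=
  (l.map lieDeriv).prod

variable (E G) in
/-- The left-invariant differential operators on `G` of order at most `k` (complex coefficients):
the span of the compositions of at most `k` left-invariant vector fields. -/
def leftInvDiffOp (k : ℕ) : Submodule ℂ (Module.End ℂ (SmoothFn E G)) :=
  Submodule.span ℂ {P | ∃ l : List (GroupLieAlgebra 𝓘(ℝ, E) G), l.length ≤ k ∧ P = lieWord l}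

/-- The underlying continuous function. -/
def toCont : SmoothFn E G →ₗ[ℂ] C(G, ℂ) where
  toFun f := ⟨f, f.contMDiff.continuous⟩
  map_add' _ _ := rfl
  map_smul' _ _ := rfl

/-- The Fréchet topology of `C^∞(G)`: all left-invariant derivatives converge uniformly (on compact
sets, hence on `G` when `G` is compact). -/
instance : TopologicalSpace (SmoothFn E G) :=
  ⨅ l : List (GroupLieAlgebra 𝓘(ℝ, E) G),
    TopologicalSpace.induced (toCont ∘ₗ lieWord l : SmoothFn E G →ₗ[ℂ] C(G, ℂ)) inferInstance

instance : IsTopologicalAddGroup (SmoothFn E G) :=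
  topologicalAddGroup_iInf fun l =>
    topologicalAddGroup_induced (toCont ∘ₗ lieWord l : SmoothFn E G →ₗ[ℂ] C(G, ℂ))

instance : ContinuousSMul ℂ (SmoothFn E G) :=
  continuousSMul_iInf fun l =>
    continuousSMul_induced (toCont ∘ₗ lieWord l : SmoothFn E G →ₗ[ℂ] C(G, ℂ))

theorem continuous_lieWord (l : List (GroupLieAlgebra 𝓘(ℝ, E) G)) :
    Continuous fun f : SmoothFn E G => toCont (lieWord l f) :=
  continuous_iff_le_induced.2 (iInf_le _ l)

theorem continuous_iff_lieWord {Z : Type*} [TopologicalSpace Z] {T : Z → SmoothFn E G} :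
    Continuous T ↔ ∀ l : List (GroupLieAlgebra 𝓘(ℝ, E) G),
      Continuous fun z => toCont (lieWord l (T z)) := by
  refine ⟨fun h l => (continuous_lieWord l).comp h, fun h => ?_⟩
  exact continuous_iInf_rng.2 fun l => continuous_induced_rng.2 (h l)

theorem continuous_lieDeriv (X : GroupLieAlgebra 𝓘(ℝ, E) G) :
    Continuous (lieDeriv X : SmoothFn E G → SmoothFn E G) := by
  refine continuous_iff_lieWord.2 fun l => ?_
  have := continuous_lieWord (l ++ [X])
  simpa [lieWord] using this

theorem continuous_mulFn [FiniteDimensional ℝ E] (q : SmoothFn E G) : Continuous fun f : SmoothFn E G => q * f := by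
  have : LocallyCompactSpace G := Manifold.locallyCompact_of_finiteDimensional 𝓘(ℝ, E)
  refine continuous_iff_lieWord.2 fun l => ?_
  induction l using List.reverseRecOn generalizing q with
  | nil =>
    have h := continuous_lieWord (E := E) (G := G) []
    have h2 : (fun f : SmoothFn E G => toCont (lieWord [] (q * f))) =
        fun f => toCont q * toCont (lieWord [] f) := rfl
    rw [h2]
    exact continuous_const.mul h
  | append_singleton l X ih =>
    have h : (fun f : SmoothFn E G => toCont (lieWord (l ++ [X]) (q * f))) =
        fun f => toCont (lieWord l (lieDeriv X q * f)) +
          toCont (lieWord l (q * lieDeriv X f)) := by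
      funext f
      have h1 : ∀ g : SmoothFn E G, lieWord (l ++ [X]) g = lieWord l (lieDeriv X g) := fun g => by
        simp [lieWord]
      rw [h1, lieDeriv_mul, map_add, map_add]
    rw [h]
    exact (ih _).add ((ih q).comp (continuous_lieDeriv X))

/-- Multiplication by a smooth function, as a continuous operator on `C^∞(G)`. -/
def mulCLM [FiniteDimensional ℝ E] (q : SmoothFn E G) : SmoothFn E G →L[ℂ] SmoothFn E G where
  toFun f := q * f
  map_add' f g := mul_add q f g
  map_smul' c f := by
    ext x
    change q x * (c * f x) = c * (q x * f x)
    ring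
  cont := continuous_mulFn q

/-- Right translation `f ↦ f(· u)` on `C^∞(G)`. -/
def rightTransl (u : G) : SmoothFn E G →ₗ[ℂ] SmoothFn E G where
  toFun f := ⟨fun x => f (x * u), f.contMDiff.comp contMDiff_mul_right⟩
  map_add' _ _ := rfl
  map_smul' _ _ := rfl

/-- The adjoint representation `Ad g` on the Lie algebra: the derivative at the identity of
`x ↦ g x g⁻¹`. -/
def adjointRep (g : G) (X : GroupLieAlgebra 𝓘(ℝ, E) G) : GroupLieAlgebra 𝓘(ℝ, E) G :=
  mfderiv 𝓘(ℝ, E) 𝓘(ℝ, E) (fun x : G => g * x * g⁻¹) 1 X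

theorem lieDeriv_rightTransl (u : G) (X : GroupLieAlgebra 𝓘(ℝ, E) G) (f : SmoothFn E G) :
    lieDeriv X (rightTransl u f) = rightTransl u (lieDeriv (adjointRep u⁻¹ X) f) := by
  ext x
  rw [lieDeriv_apply, lieDeriv_eq]
  change _ = lieDeriv (adjointRep u⁻¹ X) f (x * u)
  rw [lieDeriv_apply, lieDeriv_eq]
  have h1 : MDifferentiableAt 𝓘(ℝ, E) 𝓘(ℝ, E) (fun y : G => u⁻¹ * y * u⁻¹⁻¹) 1 :=
    ((contMDiff_mul_right (n := ∞)).comp (contMDiff_mul_left (n := ∞))).contMDiffAt.mdifferentiableAt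
      (by simp)
  have h2 : MDifferentiableAt 𝓘(ℝ, E) 𝓘(ℝ, ℂ) (fun y : G => f (x * u * y)) 1 :=
    (f.contMDiff.comp (contMDiff_mul_left (n := ∞))).contMDiffAt.mdifferentiableAt (by simp)
  have h3 := mfderiv_comp_apply_of_eq (x := (1 : G)) (y := (1 : G)) h2 h1 (by simp) X
  refine Eq.trans ?_ h3
  have h4 : (fun y : G => rightTransl u f (x * y)) =
      (fun y => f (x * u * y)) ∘ fun y => u⁻¹ * y * u⁻¹⁻¹ := by
    funext y
    change f (x * y * u) = f (x * u * (u⁻¹ * y * u⁻¹⁻¹))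
    congr 1
    group
  rw [h4]
  rfl

theorem lieWord_rightTransl (u : G) (l : List (GroupLieAlgebra 𝓘(ℝ, E) G)) (f : SmoothFn E G) :
    lieWord l (rightTransl u f) = rightTransl u (lieWord (l.map (adjointRep u⁻¹)) f) := by
  induction l with
  | nil => rfl
  | cons X l ih =>
    change lieDeriv X (lieWord l (rightTransl u f)) = rightTransl u
      (lieDeriv (adjointRep u⁻¹ X) (lieWord (l.map (adjointRep u⁻¹)) f))
    rw [ih, lieDeriv_rightTransl]

/-- Right translation `f ↦ f(· u)`, as a continuous operator on `C^∞(G)`. -/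
def rightTranslCLM (u : G) : SmoothFn E G →L[ℂ] SmoothFn E G where
  toLinearMap := rightTransl u
  cont := by
    refine continuous_iff_lieWord.2 fun l => ?_
    have h : (fun f : SmoothFn E G => toCont (lieWord l (rightTransl u f))) = fun f =>
        (toCont (lieWord (l.map (adjointRep u⁻¹)) f)).comp ⟨fun x => x * u, by
          have := topologicalGroup_of_lieGroup 𝓘(ℝ, E) ∞ (G := G)
          fun_prop⟩ := by
      funext f
      rw [lieWord_rightTransl]
      rfl
    exact (congrArg Continuous h).mpr
      ((ContinuousMap.continuous_precomp _).comp (continuous_lieWord _))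

end SmoothFunctions

section Distributions

variable (E G : Type*) [NormedAddCommGroup E] [NormedSpace ℝ E]
  [TopologicalSpace G] [ChartedSpace E G] [Group G] [LieGroup 𝓘(ℝ, E) ∞ G]

/-- `𝓓'(G)`, the topological dual of `C^∞(G)`, with the strong topology. (The group is meant to be
compact.) A function `f` is the distribution `h ↦ ∫ f h` for the normalised Haar measure. -/
abbrev Distrib : Type _ := SmoothFn E G →L[ℂ] ℂ

variable {E G}

/-- The product `q T` of a smooth function and a distribution, `(q T)(h) = T (q h)`. -/
def mulDistrib [FiniteDimensional ℝ E] (q : SmoothFn E G) (T : Distrib E G) : Distrib E G := T.comp (mulCLM q)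

/-- The singular support: `y` is outside if and only if `T` is a smooth function near `y`. -/
def singSupp [MeasurableSpace G] (μ : Measure G) (T : Distrib E G) : Set G :=
  {y | ¬ ∃ U : Set G, IsOpen U ∧ y ∈ U ∧ ∃ f : SmoothFn E G, ∀ h : SmoothFn E G,
    tsupport h ⊆ U → T h = ∫ x, f x * h x ∂μ}

/-- For `A : C^∞(G) → 𝓓'(G)` and `φ(x) = x u`, the operator `A_u f = A (f ∘ φ) ∘ φ⁻¹`. Here
`T ∘ φ⁻¹` is the distribution `h ↦ T (h ∘ φ)`, as the Haar measure is invariant. -/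
def conjOp (u : G) (A : SmoothFn E G →L[ℂ] Distrib E G) : SmoothFn E G →L[ℂ] Distrib E G :=
  (ContinuousLinearMap.precomp ℂ (rightTranslCLM u)) ∘L A ∘L (rightTranslCLM u)

theorem conjOp_apply (u : G) (A : SmoothFn E G →L[ℂ] Distrib E G) (f h : SmoothFn E G) :
    conjOp u A f h = A (rightTranslCLM u f) (rightTranslCLM u h) := rfl

end Distributions

section Representations

open Matrix

/-- The continuous irreducible unitary matrix representations `ξ : G → U(d_ξ)`. Every class in the
unitary dual of `G` is represented by such `ξ`; all notions below that are used in estimates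
(operator norm of symbols, `⟨ξ⟩`) take the same value on equivalent representations. -/
structure UIrrep (G : Type*) [TopologicalSpace G] [Group G] where
  /-- the dimension `d_ξ` -/
  dim : ℕ
  dim_pos : 0 < dim
  /-- the homomorphism -/
  toHom : G →* Matrix.unitaryGroup (Fin dim) ℂ
  continuous_toHom : Continuous toHom
  irreducible : ∀ v : Fin dim → ℂ, v ≠ 0 →
    Submodule.span ℂ (Set.range fun x : G =>
      (toHom x : Matrix (Fin dim) (Fin dim) ℂ) *ᵥ v) = ⊤

variable {E G : Type*} [NormedAddCommGroup E] [NormedSpace ℝ E] [FiniteDimensional ℝ E]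
  [TopologicalSpace G] [ChartedSpace E G] [Group G] [LieGroup 𝓘(ℝ, E) ∞ G] [CompactSpace G]
  [T2Space G]

/-- The matrix `ξ(x)`. -/
def UIrrep.mat (ξ : UIrrep G) (x : G) : Matrix (Fin ξ.dim) (Fin ξ.dim) ℂ := ξ.toHom x

variable (E) in
/-- The matrix coefficient `ξ_{ij} ∈ C^∞(G)`. -/
def UIrrep.coeff (ξ : UIrrep G) (i j : Fin ξ.dim) : SmoothFn E G :=
  ⟨fun x => ξ.mat x i j, contMDiff_rep ξ.toHom ξ.continuous_toHom i j⟩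

/-- Families of matrices `ξ ↦ a(ξ) ∈ ℂ^{d_ξ × d_ξ}`. -/
abbrev MatField (G : Type*) [TopologicalSpace G] [Group G] : Type _ :=
  ∀ ξ : UIrrep G, Matrix (Fin ξ.dim) (Fin ξ.dim) ℂ

/-- The operator norm of a matrix acting on the Hermitian space `ℂ^d`. -/
def opNorm {d : ℕ} (M : Matrix (Fin d) (Fin d) ℂ) : ℝ :=
  ‖Matrix.toEuclideanCLM (𝕜 := ℂ) (n := Fin d) M‖

/-- The Fourier transform of a distribution, `T̂(ξ)_{ij} = T((ξ^*)_{ij})`; for a function it is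
`∫ f(x) ξ(x)^* dx`. -/
def fourier (T : Distrib E G) : MatField G :=
  fun ξ => Matrix.of fun i j => T (conjFn (ξ.coeff E j i))

variable (E) in
/-- The difference operator with the function `q` sends `a` to `b`: `a` is the Fourier
transform of a distribution `T` (unique, by the Peter-Weyl theorem), and `b` is that of `q T`. -/
def IsDifference (q : SmoothFn E G) (a b : MatField G) : Prop :=
  ∃ T : Distrib E G, fourier T = a ∧ fourier (mulDistrib q T) = b

variable (E G) in
/-- Matrix symbols `σ(x, ξ)` that are smooth in `x`: the entries of `σ ξ` are smooth functions. -/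
abbrev Symb : Type _ :=
  ∀ ξ : UIrrep G, Matrix (Fin ξ.dim) (Fin ξ.dim) (SmoothFn E G)

/-- The matrices `(P_x σ)(x, ξ)`, for an operator `P` on `C^∞(G)`. -/
def Symb.deriv (P : Module.End ℂ (SmoothFn E G)) (σ : Symb E G) (x : G) : MatField G :=
  fun ξ => (σ ξ).map fun f => P f x

/-- The matrices `σ(x, ξ)`. -/
def Symb.eval (σ : Symb E G) (x : G) : MatField G := σ.deriv 1 x

/-- `σ` is the symbol of `A`: the distributions `(ξ^* (A ξ))_{ij} = ∑ k, conj ξ_{ki} (A ξ_{kj})`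
are the functions `σ(·, ξ)_{ij}`. -/
def IsSymbolOf [MeasurableSpace G] (μ : Measure G) (σ : Symb E G)
    (A : SmoothFn E G →L[ℂ] Distrib E G) : Prop :=
  ∀ (ξ : UIrrep G) (i j : Fin ξ.dim) (h : SmoothFn E G),
    (∑ k, mulDistrib (conjFn (ξ.coeff E k i)) (A (ξ.coeff E k j))) h = ∫ x, σ ξ i j x * h x ∂μ

/-- A basis of the Lie algebra that is orthonormal for some `Ad`-invariant inner product, that is:
an orthonormal frame of left-invariant vector fields for a bi-invariant Riemannian metric. -/
def IsBiinvariantFrame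
    (b : Module.Basis (Fin (Module.finrank ℝ E)) ℝ (GroupLieAlgebra 𝓘(ℝ, E) G)) : Prop :=
  ∀ (g : G) (X Y : GroupLieAlgebra 𝓘(ℝ, E) G),
    ∑ k, b.repr (adjointRep g X) k * b.repr (adjointRep g Y) k = ∑ k, b.repr X k * b.repr Y k

/-- The Laplacian `∑ X_k²` of the bi-invariant metric with orthonormal frame `b`. -/
def laplacian (b : Module.Basis (Fin (Module.finrank ℝ E)) ℝ (GroupLieAlgebra 𝓘(ℝ, E) G)) :
    Module.End ℂ (SmoothFn E G) :=
  ∑ k, (lieDeriv (b k) : Module.End ℂ (SmoothFn E G)) ^ 2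

/-- The number `λ_ξ²`: the matrix coefficients of `ξ` are eigenfunctions of the Laplacian with
eigenvalue `-λ_ξ²`. (There is exactly one such number.) -/
def lambdaSq (b : Module.Basis (Fin (Module.finrank ℝ E)) ℝ (GroupLieAlgebra 𝓘(ℝ, E) G))
    (ξ : UIrrep G) : ℝ :=
  sInf {c : ℝ | ∀ i j, laplacian b (ξ.coeff E i j) = -(c : ℂ) • ξ.coeff E i j}

/-- `⟨ξ⟩ = (1 + λ_ξ²)^{1/2}`. -/
def japanese (b : Module.Basis (Fin (Module.finrank ℝ E)) ℝ (GroupLieAlgebra 𝓘(ℝ, E) G))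
    (ξ : UIrrep G) : ℝ :=
  √(1 + lambdaSq b ξ)

end Representations

section Conditions

variable {E G : Type*} [NormedAddCommGroup E] [NormedSpace ℝ E] [FiniteDimensional ℝ E]
  [TopologicalSpace G] [ChartedSpace E G] [Group G] [LieGroup 𝓘(ℝ, E) ∞ G]

/-- `q` vanishes of order `k` at the identity: `(P q)(e) = 0` for every left-invariant differential
operator `P` of order at most `k - 1` (no condition if `k = 0`). The difference operators of order
`k` are those with such a function `q`. -/
def VanishesToOrder (k : ℕ) (q : SmoothFn E G) : Prop :=
  ∀ j < k, ∀ P ∈ leftInvDiffOp E G j, P q 1 = 0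

/-- The differential `dq(e)`, a complex valued real-linear form on the Lie algebra. -/
def diffAtOne (q : SmoothFn E G) : E →L[ℝ] ℂ :=
  mfderiv 𝓘(ℝ, E) 𝓘(ℝ, ℂ) q (1 : G)

/-- A finite family of first order difference operators, given by their functions `q_j`, is
admissible if `dq_j(e) ≠ 0` for all `j` and `rank (dq_1(e), …, dq_r(e)) = n`, the rank over `ℂ` of
complex covectors. (In particular `r ≥ n`.) -/
def Admissible {r : ℕ} (q : Fin r → SmoothFn E G) : Prop :=
  (∀ j, VanishesToOrder 1 (q j)) ∧ (∀ j, diffAtOne (q j) ≠ 0) ∧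
    Module.finrank ℂ (Submodule.span ℂ (Set.range fun j => diffAtOne (q j))) =
      Module.finrank ℝ E

/-- Strongly admissible: moreover the identity is the only common zero of the `q_j`. -/
def StronglyAdmissible {r : ℕ} (q : Fin r → SmoothFn E G) : Prop :=
  Admissible q ∧ ⋂ j, {x : G | q j x = 0} = {1}

/-- `∂_x^β = ∂_{x_1}^{β_1} ⋯ ∂_{x_n}^{β_n}` for a basis of left-invariant vector fields. -/
def partialPow (Y : Module.Basis (Fin (Module.finrank ℝ E)) ℝ (GroupLieAlgebra 𝓘(ℝ, E) G))
    (β : Fin (Module.finrank ℝ E) → ℕ) : Module.End ℂ (SmoothFn E G) :=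
  (List.ofFn fun j => (lieDeriv (Y j) : Module.End ℂ (SmoothFn E G)) ^ β j).prod

variable [CompactSpace G] [T2Space G]

/-- The symbol estimate `‖Q_ξ P_x σ(x, ξ)‖ ≤ C ⟨ξ⟩^s`, uniformly in `x` and `ξ`, for the difference
operator `Q_ξ` with the function `q`. -/
def SymbolEstimate (b : Module.Basis (Fin (Module.finrank ℝ E)) ℝ (GroupLieAlgebra 𝓘(ℝ, E) G))
    (q : SmoothFn E G) (P : Module.End ℂ (SmoothFn E G)) (s : ℝ) (σ : Symb E G) : Prop :=
  ∃ C : ℝ, ∀ x : G, ∃ a : MatField G, IsDifference E q (σ.deriv P x) a ∧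
    ∀ ξ : UIrrep G, opNorm (a ξ) ≤ C * japanese b ξ ^ s

/-- Condition (B) of order `m`: estimates for all left-invariant differential operators and all
difference operators. -/
def CondB (b : Module.Basis (Fin (Module.finrank ℝ E)) ℝ (GroupLieAlgebra 𝓘(ℝ, E) G))
    (m : ℝ) (σ : Symb E G) : Prop :=
  ∀ k : ℕ, ∀ P ∈ leftInvDiffOp E G k, ∀ (l : ℕ) (q : SmoothFn E G), VanishesToOrder l q →
    SymbolEstimate b q P (m - l) σ

/-- The estimates `‖△_ξ^α ∂_x^β σ(x, ξ)‖ ≤ C_{αβ} ⟨ξ⟩^{m - |α|}` for all multi-indices. The function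
of `△_ξ^α = △_1^{α_1} ⋯ △_r^{α_r}` is `q^α = q_1^{α_1} ⋯ q_r^{α_r}`. -/
def FamilyEstimates
    (b Y : Module.Basis (Fin (Module.finrank ℝ E)) ℝ (GroupLieAlgebra 𝓘(ℝ, E) G))
    (m : ℝ) {r : ℕ} (q : Fin r → SmoothFn E G) (σ : Symb E G) : Prop :=
  ∀ (α : Fin r → ℕ) (β : Fin (Module.finrank ℝ E) → ℕ),
    SymbolEstimate b (∏ j, q j ^ α j) (partialPow Y β) (m - (∑ j, α j : ℕ)) σ

/-- The right-convolution kernel `R(x, ·)`, the distribution with Fourier transform `σ(x, ·)`,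
exists and its singular support is contained in `{e}`, for every `x`. -/
def KernelSmoothOffOne [MeasurableSpace G] (μ : Measure G) (σ : Symb E G) : Prop :=
  ∀ x : G, ∃ R : Distrib E G, fourier R = σ.eval x ∧ singSupp μ R ⊆ {1}

/-- Condition (C) of order `m`: the estimates for every admissible family of difference operators,
and the kernel is smooth off the identity. -/
def CondC [MeasurableSpace G] (μ : Measure G)
    (b Y : Module.Basis (Fin (Module.finrank ℝ E)) ℝ (GroupLieAlgebra 𝓘(ℝ, E) G))
    (m : ℝ) (σ : Symb E G) : Prop :=
  (∀ (r : ℕ) (q : Fin r → SmoothFn E G), Admissible q → FamilyEstimates b Y m q σ) ∧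
    KernelSmoothOffOne μ σ

/-- Condition (D) of order `m` for the strongly admissible family `q`. -/
def CondD (b Y : Module.Basis (Fin (Module.finrank ℝ E)) ℝ (GroupLieAlgebra 𝓘(ℝ, E) G))
    (m : ℝ) {r : ℕ} (q : Fin r → SmoothFn E G) (σ : Symb E G) : Prop :=
  StronglyAdmissible q ∧ FamilyEstimates b Y m q σ

end Conditions

end LieSymbol

end

/-! The formula for the symbol is $\xi(xu)=\xi(x)\xi(u)$ expanded inside the pairing that defines
the symbol, followed by the substitution $x\mapsto xu$ in the Haar integral (`isSymbolOf_conjSymb`).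
On the kernel side, the kernel of $A_u$ at $x$ is the image of the kernel of $A$ at $xu^{-1}$ under
$y\mapsto u^{-1}yu$. Multiplying it by $q$ therefore amounts to multiplying the original kernel by
$q(u^{-1}\cdot u)$ and then conjugating the Fourier transform by the unitary matrices $\xi(u)$,
which leaves operator norms alone (`SymbolEstimate.conjSymb`).

For (B) this is nearly enough: the order of vanishing at $e$ is invariant under conjugation, and
right translation carries left-invariant operators to left-invariant operators of the same order
through Ad. For (C), admissibility is invariant as well, and conjugation fixes $e$, so the singular
support stays in $\{e\}$. The transported $\partial_x^\beta$ is no longer an ordered monomial, but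
commutators of invariant fields are invariant fields, so the ordered monomials span all
left-invariant operators (`leftInvDiffOp_le_span_partialPow`).

(D) is the hard case, because the estimates are known for one family only and conjugation replaces
it by another one. Two facts repair this. First, a strongly admissible family generates the ideal of
smooth functions vanishing at $e$ (`StronglyAdmissible.mem_span`): Hadamard's lemma and the rank
condition give this near $e$, the absence of other common zeros gives it elsewhere. Hence a degree
$k$ monomial in the conjugated functions is a combination of degree $k$ monomials in the given ones,
with smooth coefficients.

Second, multiplying a distribution by a fixed smooth $p$ preserves bounds $\|\widehat T(\xi)\|\le
C\langle\xi\rangle^s$ up to a factor independent of $T$ (`exists_opNorm_fourier_mulDistrib_le`). If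
$p$ is a conjugated coefficient of $\eta$, the new Fourier coefficient is a block of the direct sum
of $\widehat T(\zeta)$ over the constituents $\zeta$ of $\eta\otimes\xi$, and these satisfy
$\langle\zeta\rangle^s\le(2\langle\eta\rangle)^{|s|}\langle\xi\rangle^s$, by Minkowski's inequality
for the Casimir operators. A general $p$ is summed over its Fourier series: its coefficients decay
rapidly, a crude Weyl law makes the weighted sum finite, and the Peter-Weyl theorem identifies the
limit. -/

set_option linter.unusedSectionVars false

noncomputable section

namespace LieSymbol

/-! ### Left translations and commutators of left-invariant vector fields -/

section LeftTranslation

variable {E G : Type*} [NormedAddCommGroup E] [NormedSpace ℝ E]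
  [TopologicalSpace G] [ChartedSpace E G] [Group G] [LieGroup 𝓘(ℝ, E) ∞ G]

/-- Left translation `f ↦ f(u ·)` on `C^∞(G)`. -/
def leftTransl (u : G) : SmoothFn E G →ₗ[ℂ] SmoothFn E G where
  toFun f := ⟨fun x => f (u * x), f.contMDiff.comp contMDiff_mul_left⟩
  map_add' _ _ := rfl
  map_smul' _ _ := rfl

@[simp] theorem leftTransl_apply (u : G) (f : SmoothFn E G) (x : G) :
    leftTransl u f x = f (u * x) := rfl

@[simp] theorem rightTransl_apply (u : G) (f : SmoothFn E G) (x : G) :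
    rightTransl u f x = f (x * u) := rfl

theorem lieDeriv_leftTransl (u : G) (X : GroupLieAlgebra 𝓘(ℝ, E) G) (f : SmoothFn E G) :
    lieDeriv X (leftTransl u f) = leftTransl u (lieDeriv X f) := by
  ext x
  refine (lieDeriv_eq X (leftTransl u f) x).trans (Eq.trans ?_ (lieDeriv_eq X f (u * x)).symm)
  have : (fun y => leftTransl u f (x * y)) = fun y => f (u * x * y) := by
    funext y; rw [leftTransl_apply, mul_assoc]
  rw [this]
  rfl

theorem lieWord_leftTransl (u : G) (l : List (GroupLieAlgebra 𝓘(ℝ, E) G)) (f : SmoothFn E G) :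
    lieWord l (leftTransl u f) = leftTransl u (lieWord l f) := by
  induction l with
  | nil => rfl
  | cons X l ih =>
    change lieDeriv X (lieWord l (leftTransl u f)) = leftTransl u (lieDeriv X (lieWord l f))
    rw [ih, lieDeriv_leftTransl]

theorem lieWord_cons (X : GroupLieAlgebra 𝓘(ℝ, E) G) (l : List (GroupLieAlgebra 𝓘(ℝ, E) G)) :
    lieWord (X :: l) = lieDeriv X * lieWord l := by
  simp [lieWord]

theorem lieDeriv_apply_one (X : GroupLieAlgebra 𝓘(ℝ, E) G) (f : SmoothFn E G) :
    lieDeriv X f 1 = mfderiv 𝓘(ℝ, E) 𝓘(ℝ, ℂ) f 1 X := by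
  refine (lieDeriv_eq X f 1).trans ?_
  have : (fun y => f (1 * y)) = f := by funext y; rw [one_mul]
  rw [this]
  rfl

/-- Left invariance moves every evaluation to the identity, so that one chart is enough for all
computations with derivatives. -/
theorem lieDeriv_apply_eq_one (X : GroupLieAlgebra 𝓘(ℝ, E) G) (f : SmoothFn E G) (x : G) :
    lieDeriv X f x = lieDeriv X (leftTransl x f) 1 := by
  rw [lieDeriv_leftTransl, leftTransl_apply, mul_one]

theorem lieDeriv_add_left (X Y : GroupLieAlgebra 𝓘(ℝ, E) G) :
    (lieDeriv (X + Y) : Module.End ℂ (SmoothFn E G)) = lieDeriv X + lieDeriv Y := by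
  ext f x
  rw [lieDeriv_apply_eq_one, lieDeriv_apply_one, LinearMap.add_apply]
  change _ = lieDeriv X f x + lieDeriv Y f x
  rw [lieDeriv_apply_eq_one X, lieDeriv_apply_one, lieDeriv_apply_eq_one Y, lieDeriv_apply_one]
  exact map_add (mfderiv 𝓘(ℝ, E) 𝓘(ℝ, ℂ) (leftTransl x f) 1) X Y

theorem lieDeriv_smul_left (c : ℝ) (X : GroupLieAlgebra 𝓘(ℝ, E) G) :
    (lieDeriv (c • X) : Module.End ℂ (SmoothFn E G)) = (c : ℂ) • lieDeriv X := by
  ext f x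
  rw [lieDeriv_apply_eq_one, lieDeriv_apply_one, LinearMap.smul_apply, smul_apply,
    lieDeriv_apply_eq_one X, lieDeriv_apply_one]
  exact map_smul (mfderiv 𝓘(ℝ, E) 𝓘(ℝ, ℂ) (leftTransl x f) 1) c X

theorem lieDeriv_sum_left {ι : Type*} (s : Finset ι) (c : ι → ℝ)
    (X : ι → GroupLieAlgebra 𝓘(ℝ, E) G) :
    (lieDeriv (∑ i ∈ s, c i • X i) : Module.End ℂ (SmoothFn E G)) =
      ∑ i ∈ s, (c i : ℂ) • lieDeriv (X i) := by
  classical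
  induction s using Finset.induction_on with
  | empty =>
    have := lieDeriv_smul_left (E := E) (G := G) 0 0
    simpa using this
  | insert i s hi ih =>
    rw [Finset.sum_insert hi, Finset.sum_insert hi, lieDeriv_add_left, lieDeriv_smul_left, ih]

variable (G) in
/-- A vector of the model space as an element of the Lie algebra. -/
def toLie (X : E) : GroupLieAlgebra 𝓘(ℝ, E) G := X

/-- The derivative at the identity in the chart at the identity. -/
theorem lieDeriv_one_eq_fderiv (X : E) (f : SmoothFn E G) :
    lieDeriv (toLie G X) f 1 =
      fderiv ℝ (fun a => f ((chartAt E (1 : G)).symm a)) (chartAt E (1 : G) 1) X := by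
  refine (lieDeriv_apply_one (toLie G X) f).trans ?_
  have h : mfderiv 𝓘(ℝ, E) 𝓘(ℝ, ℂ) f 1 =
      fderiv ℝ (fun a => f ((chartAt E (1 : G)).symm a)) (chartAt E (1 : G) 1) := by
    have h1 : mfderiv 𝓘(ℝ, E) 𝓘(ℝ, ℂ) f 1 = fderivWithin ℝ (writtenInExtChartAt 𝓘(ℝ, E) 𝓘(ℝ, ℂ)
        (1 : G) f) (range 𝓘(ℝ, E)) (extChartAt 𝓘(ℝ, E) (1 : G) 1) :=
      f.mdifferentiableAt.mfderiv
    refine h1.trans ?_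
    simp [writtenInExtChartAt, Function.comp_def]
    rfl
  exact congrArg (fun L => L X) h

theorem contDiffAt_comp_chart_symm (f : SmoothFn E G) {a : E}
    (ha : a ∈ (chartAt E (1 : G)).target) :
    ContDiffAt ℝ ∞ (fun a => f ((chartAt E (1 : G)).symm a)) a := by
  have h := (contMDiffOn_chart_symm (I := 𝓘(ℝ, E)) (n := ∞) (x := (1 : G)))
  exact (f.contMDiff.comp_contMDiffOn h).contDiffOn.contDiffAt
    ((chartAt E (1 : G)).open_target.mem_nhds ha)

/-- The second derivatives of a smooth function along left-invariant vector fields, in the chart. -/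
theorem exists_lieDeriv_comm_one (X Y : E) :
    ∃ Z : E, ∀ f : SmoothFn E G, lieDeriv (toLie G X) (lieDeriv (toLie G Y) f) 1 -
      lieDeriv (toLie G Y) (lieDeriv (toLie G X) f) 1 = lieDeriv (toLie G Z) f 1 := by
  let φ := chartAt E (1 : G)
  let o : E := φ 1
  let ψ : E → G := φ.symm
  have ho : o ∈ φ.target := φ.map_source (mem_chart_source E 1)
  have hψo : ψ o = 1 := φ.left_inv (mem_chart_source E 1)
  have hψ : ContMDiffAt 𝓘(ℝ, E) 𝓘(ℝ, E) ∞ ψ o :=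
    (contMDiffOn_chart_symm (I := 𝓘(ℝ, E)) (n := ∞) (x := (1 : G))).contMDiffAt
      (φ.open_target.mem_nhds ho)
  let pr : E × E → G := fun p => ψ p.1 * ψ p.2
  have hpr : ContMDiffAt (𝓘(ℝ, E).prod 𝓘(ℝ, E)) 𝓘(ℝ, E) ∞ pr (o, o) :=
    (ContMDiffAt.comp (o, o) (g := ψ) hψ contMDiffAt_fst).mul
      (ContMDiffAt.comp (o, o) (g := ψ) hψ contMDiffAt_snd)
  have hpro : pr (o, o) = 1 := by simp [pr, hψo]
  -- The group law in the chart. It restricts to the identity map on each axis through `o`, which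
  -- fixes its first derivative at `(o, o)`.
  let m : E × E → E := fun p => φ (pr p)
  have hmo : m (o, o) = o := by simp only [m, hpro]; rfl
  have hm : ContDiffAt ℝ ∞ m (o, o) := by
    have h : ContMDiffAt 𝓘(ℝ, E) 𝓘(ℝ, E) ∞ φ (pr (o, o)) := by
      rw [hpro]
      exact (contMDiffOn_chart (I := 𝓘(ℝ, E)) (n := ∞) (x := (1 : G))).contMDiffAt
        (chart_source_mem_nhds E 1)
    have h1 : ContMDiffAt (𝓘(ℝ, E).prod 𝓘(ℝ, E)) 𝓘(ℝ, E) ∞ m (o, o) := h.comp (o, o) hpr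
    rw [← modelWithCornersSelf_prod, chartedSpaceSelf_prod] at h1
    exact h1.contDiffAt
  have hmem : ∀ᶠ p in nhds (o, o), pr p ∈ φ.source := by
    refine hpr.continuousAt.eventually (φ.open_source.mem_nhds ?_)
    rw [hpro]; exact mem_chart_source E 1
  have hψc : ContinuousAt ψ o := hψ.continuousAt
  have hm1 : ∀ v : E, fderiv ℝ m (o, o) (v, 0) = v := by
    intro v
    have h1 : HasFDerivAt (fun a : E => m (a, o)) (fderiv ℝ m (o, o) ∘L
        ContinuousLinearMap.inl ℝ E E) o :=
      (hm.differentiableAt (by simp)).hasFDerivAt.comp (f := fun a : E => (a, o)) o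
        (hasFDerivAt_prodMk_left o o)
    have h2 : (fun a : E => m (a, o)) =ᶠ[nhds o] id := by
      filter_upwards [φ.open_target.mem_nhds ho] with a ha
      simp only [m, pr, hψo, mul_one, id]
      exact φ.right_inv ha
    have h3 := h1.unique ((hasFDerivAt_id o).congr_of_eventuallyEq h2)
    simpa using congrArg (fun L => L v) h3
  have hm2 : ∀ v : E, fderiv ℝ m (o, o) (0, v) = v := by
    intro v
    have h1 : HasFDerivAt (fun a : E => m (o, a)) (fderiv ℝ m (o, o) ∘L
        ContinuousLinearMap.inr ℝ E E) o :=
      (hm.differentiableAt (by simp)).hasFDerivAt.comp o (hasFDerivAt_prodMk_right o o)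
    have h2 : (fun a : E => m (o, a)) =ᶠ[nhds o] id := by
      filter_upwards [φ.open_target.mem_nhds ho] with a ha
      simp only [m, pr, hψo, one_mul, id]
      exact φ.right_inv ha
    have h3 := h1.unique ((hasFDerivAt_id o).congr_of_eventuallyEq h2)
    simpa using congrArg (fun L => L v) h3
  -- The second derivative of the group law. Its mixed part is what makes left-invariant fields fail
  -- to commute.
  let B : E × E → E × E → E := fun u v => fderiv ℝ (fderiv ℝ m) (o, o) u v
  have hdm : DifferentiableAt ℝ (fderiv ℝ m) (o, o) :=
    (hm.fderiv_right (m := 1) (by norm_cast)).differentiableAt (by simp)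
  -- With `g` the function in the chart, $XYf(e)=D^2g(X,Y)+Dg(B(X,Y))$. The first term is symmetric,
  -- so only the second one survives in the commutator and it is a first derivative of $f$.
  have key : ∀ (X Y : E) (f : SmoothFn E G),
      lieDeriv (toLie G X) (lieDeriv (toLie G Y) f) 1 =
        fderiv ℝ (fderiv ℝ (fun a => f (ψ a))) o X Y +
        fderiv ℝ (fun a => f (ψ a)) o (B (X, 0) (0, Y)) := by
    intro X Y f
    let g : E → ℂ := fun a => f (ψ a)
    have hg : ContDiffAt ℝ ∞ g o := contDiffAt_comp_chart_symm f ho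
    have hdg : DifferentiableAt ℝ (fderiv ℝ g) o :=
      (hg.fderiv_right (m := 1) (by norm_cast)).differentiableAt (by simp)
    rw [lieDeriv_one_eq_fderiv]
    have e1 : (fun a : E => lieDeriv (toLie G Y) f (ψ a)) =ᶠ[nhds o]
        fun a => fderiv ℝ g (m (a, o)) (fderiv ℝ m (a, o) (0, Y)) := by
      have hc : Filter.Tendsto (fun a : E => (a, o)) (nhds o) (nhds (o, o)) :=
        (continuous_id.prodMk continuous_const).tendsto' _ _ rfl
      have c1 : ∀ᶠ a in nhds o, ContDiffAt ℝ 1 m (a, o) :=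
        hc.eventually ((hm.of_le (by norm_cast)).eventually (by simp))
      have c2 : ∀ᶠ a in nhds o, ContDiffAt ℝ 1 g (m (a, o)) := by
        have : Filter.Tendsto (fun a => m (a, o)) (nhds o) (nhds o) := by
          have := hm.continuousAt.tendsto.comp hc
          rwa [hmo] at this
        exact this.eventually ((hg.of_le (by norm_cast)).eventually (by simp))
      have c3 : ∀ᶠ a in nhds o, ∀ᶠ b in nhds o, pr (a, b) ∈ φ.source := by
        exact (nhds_prod_eq (x := o) (y := o) ▸ hmem).curry
      filter_upwards [c1, c2, c3] with a h1 h2 h3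
      rw [lieDeriv_apply_eq_one, lieDeriv_one_eq_fderiv]
      have h4 : (fun b => leftTransl (ψ a) f (ψ b)) =ᶠ[nhds o] fun b => g (m (a, b)) := by
        filter_upwards [h3] with b hb
        simp only [leftTransl_apply, g, m, ψ]
        rw [φ.left_inv hb]
      have h5 : HasFDerivAt (fun b => g (m (a, b))) (fderiv ℝ g (m (a, o)) ∘L
          (fderiv ℝ m (a, o) ∘L ContinuousLinearMap.inr ℝ E E)) o :=
        HasFDerivAt.comp (g := g) (f := fun b => m (a, b)) o
          (h2.differentiableAt (by simp)).hasFDerivAt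
          ((h1.differentiableAt (by simp)).hasFDerivAt.comp o (hasFDerivAt_prodMk_right a o))
      have h6 := (h5.congr_of_eventuallyEq h4).fderiv
      change fderiv ℝ (fun b => leftTransl (ψ a) f (ψ b)) o Y = _
      rw [h6]
      simp
    change fderiv ℝ (fun a : E => lieDeriv (toLie G Y) f (ψ a)) o X = _
    rw [e1.fderiv_eq]
    have d1 : HasFDerivAt (fun a : E => fderiv ℝ g (m (a, o)))
        (fderiv ℝ (fderiv ℝ g) o ∘L (fderiv ℝ m (o, o) ∘L ContinuousLinearMap.inl ℝ E E)) o := by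
      refine HasFDerivAt.comp o (g := fderiv ℝ g) (f := fun a => m (a, o)) ?_
        ((hm.differentiableAt (by simp)).hasFDerivAt.comp (f := fun a : E => (a, o)) o
        (hasFDerivAt_prodMk_left o o))
      rw [hmo]; exact hdg.hasFDerivAt
    have d2 : HasFDerivAt (fun a : E => fderiv ℝ m (a, o) (0, Y))
        ((ContinuousLinearMap.apply ℝ E ((0, Y) : E × E)) ∘L
          (fderiv ℝ (fderiv ℝ m) (o, o) ∘L ContinuousLinearMap.inl ℝ E E)) o :=
      HasFDerivAt.comp (g := ContinuousLinearMap.apply ℝ E ((0, Y) : E × E))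
        (f := fun a => fderiv ℝ m (a, o)) o (ContinuousLinearMap.hasFDerivAt _)
        (hdm.hasFDerivAt.comp (f := fun a : E => (a, o)) o (hasFDerivAt_prodMk_left o o))
    have d3 := d1.clm_apply d2
    rw [d3.fderiv]
    simp [hmo, hm1, hm2, B, g]
    ring
  refine ⟨B (X, 0) (0, Y) - B (Y, 0) (0, X), fun f => ?_⟩
  have hg : ContDiffAt ℝ ∞ (fun a => f (ψ a)) o := contDiffAt_comp_chart_symm f ho
  have hsymm := (hg.isSymmSndFDerivAt (by simp; norm_cast)) X Y
  rw [key, key, lieDeriv_one_eq_fderiv]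
  change _ = fderiv ℝ (fun a => f (ψ a)) o (B (X, 0) (0, Y) - B (Y, 0) (0, X))
  rw [map_sub, hsymm]
  ring

/-- Left invariance spreads the identity at $e$ over the group. Only the existence of the field
matters for reordering; it need not be identified with the Lie bracket. -/
theorem exists_lieDeriv_comm (X Y : GroupLieAlgebra 𝓘(ℝ, E) G) :
    ∃ Z : GroupLieAlgebra 𝓘(ℝ, E) G, (lieDeriv X * lieDeriv Y - lieDeriv Y * lieDeriv X :
      Module.End ℂ (SmoothFn E G)) = lieDeriv Z := by
  obtain ⟨Z, hZ⟩ := exists_lieDeriv_comm_one (E := E) (G := G) X Y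
  refine ⟨toLie G Z, ?_⟩
  ext f x
  have := hZ (leftTransl x f)
  rw [lieDeriv_apply_eq_one (toLie G Z), ← this]
  simp only [lieDeriv_leftTransl, leftTransl_apply, mul_one]
  rfl

end LeftTranslation

end LieSymbol
end

noncomputable section

namespace LieSymbol

/-! ### Ordered monomials span the left-invariant differential operators -/

section Ordering

variable {E G : Type*} [NormedAddCommGroup E] [NormedSpace ℝ E]
  [TopologicalSpace G] [ChartedSpace E G] [Group G] [LieGroup 𝓘(ℝ, E) ∞ G]

theorem lieWord_mem_leftInvDiffOp {l : List (GroupLieAlgebra 𝓘(ℝ, E) G)} {k : ℕ}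
    (h : l.length ≤ k) : lieWord l ∈ leftInvDiffOp E G k :=
  Submodule.subset_span ⟨l, h, rfl⟩

theorem lieDeriv_mul_mem (X : GroupLieAlgebra 𝓘(ℝ, E) G) {k : ℕ}
    {P : Module.End ℂ (SmoothFn E G)} (hP : P ∈ leftInvDiffOp E G k) :
    lieDeriv X * P ∈ leftInvDiffOp E G (k + 1) := by
  induction hP using Submodule.span_induction with
  | mem P h =>
    obtain ⟨l, hl, rfl⟩ := h
    rw [← lieWord_cons]
    exact lieWord_mem_leftInvDiffOp (by simpa using hl)
  | zero => rw [mul_zero]; exact zero_mem _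
  | add P Q _ _ hP hQ => rw [mul_add]; exact add_mem hP hQ
  | smul c P _ hP => rw [mul_smul_comm]; exact Submodule.smul_mem _ c hP

/-- Reordering a composition of left-invariant vector fields changes it by an operator of lower
order. -/
theorem lieWord_sub_mem_of_perm {l l' : List (GroupLieAlgebra 𝓘(ℝ, E) G)} (h : l.Perm l') :
    lieWord l - lieWord l' ∈ leftInvDiffOp E G (l.length - 1) := by
  induction h with
  | nil => rw [sub_self]; exact zero_mem _
  | @cons X l l' h ih =>
    rw [lieWord_cons, lieWord_cons, ← mul_sub]
    -- Subtraction is truncated: for the empty tail the induction hypothesis only gives order 0,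
    -- which composition with `X` would raise to 1 instead of the required 0.
    rcases Nat.eq_zero_or_pos l.length with h0 | h0
    · obtain rfl := List.length_eq_zero_iff.1 h0
      obtain rfl := List.nil_perm.1 h
      rw [sub_self, mul_zero]
      exact zero_mem _
    · have := lieDeriv_mul_mem X ih
      rwa [Nat.sub_add_cancel h0] at this
  -- The commutator is a single field, so the difference of the two words is one word shorter than
  -- either.
  | swap X Y l =>
    obtain ⟨Z, hZ⟩ := exists_lieDeriv_comm Y X
    rw [lieWord_cons, lieWord_cons, lieWord_cons, lieWord_cons, ← mul_assoc, ← mul_assoc,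
      ← sub_mul, hZ, ← lieWord_cons]
    exact lieWord_mem_leftInvDiffOp (by simp)
  | trans h₁ _ ih₁ ih₂ =>
    rw [h₁.length_eq] at ih₁ ⊢
    have := add_mem ih₁ ih₂
    rwa [sub_add_sub_cancel] at this

/-- The right side is the sorted rearrangement of the word, which is the order of factors in
`partialPow`. -/
theorem perm_flatten_replicate_count {n : ℕ} (l : List (Fin n)) :
    l.Perm (List.ofFn fun j => List.replicate (l.count j) j).flatten := by
  rw [List.perm_iff_count]
  intro a
  rw [List.count_flatten, List.map_ofFn, List.sum_ofFn, Finset.sum_eq_single a]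
  · simp
  · intro b _ hb
    simp [List.count_replicate, hb]
  · simp

variable (Y : Module.Basis (Fin (Module.finrank ℝ E)) ℝ (GroupLieAlgebra 𝓘(ℝ, E) G))

theorem partialPow_eq_lieWord (β : Fin (Module.finrank ℝ E) → ℕ) :
    partialPow Y β = lieWord ((List.ofFn fun j => List.replicate (β j) j).flatten.map Y) := by
  rw [lieWord, List.map_map, List.map_flatten, List.prod_flatten, List.map_ofFn, List.map_ofFn,
    partialPow]
  congr 2
  funext j
  simp

/-- Expanding each field in the basis is multilinear and keeps the length, so the induction on the
order below is not disturbed. -/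
theorem lieWord_mem_span_basis (l : List (GroupLieAlgebra 𝓘(ℝ, E) G)) :
    lieWord l ∈ Submodule.span ℂ {P | ∃ w : List (Fin (Module.finrank ℝ E)),
      w.length = l.length ∧ P = lieWord (w.map Y)} := by
  induction l with
  | nil => exact Submodule.subset_span ⟨[], rfl, rfl⟩
  | cons X l ih =>
    rw [lieWord_cons, ← Y.sum_repr X, lieDeriv_sum_left, Finset.sum_mul]
    refine Submodule.sum_mem _ fun j _ => ?_
    rw [smul_mul_assoc]
    refine Submodule.smul_mem _ _ ?_
    rw [List.length_cons]
    have h : Submodule.span ℂ {P | ∃ w : List (Fin (Module.finrank ℝ E)),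
        w.length = l.length ∧ P = lieWord (w.map Y)} ≤
      Submodule.comap (LinearMap.mulLeft ℂ (lieDeriv (Y j) : Module.End ℂ (SmoothFn E G)))
        (Submodule.span ℂ {P | ∃ w : List (Fin (Module.finrank ℝ E)),
          w.length = l.length + 1 ∧ P = lieWord (w.map Y)}) := by
      refine Submodule.span_le.2 ?_
      rintro P ⟨w, hw, rfl⟩
      exact Submodule.subset_span ⟨j :: w, by simpa using hw, by
        rw [List.map_cons, lieWord_cons]; rfl⟩
    exact h ih

/-- The ordered monomials span the left-invariant differential operators. -/
theorem leftInvDiffOp_le_span_partialPow (k : ℕ) :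
    leftInvDiffOp E G k ≤ Submodule.span ℂ (Set.range (partialPow Y)) := by
  -- The degree of the monomials is not recorded, because the exponent in the symbol estimates does
  -- not depend on the number of derivatives in $x$.
  induction k using Nat.strong_induction_on with
  | _ k ih =>
    refine Submodule.span_le.2 ?_
    rintro P ⟨l, hl, rfl⟩
    refine (Submodule.span_le.2 ?_) (lieWord_mem_span_basis Y l)
    rintro P ⟨w, hw, rfl⟩
    have h1 := lieWord_sub_mem_of_perm ((perm_flatten_replicate_count w).map Y)
    rw [← partialPow_eq_lieWord] at h1
    have h3 : partialPow Y (fun j => w.count j) ∈ Submodule.span ℂ (Set.range (partialPow Y)) :=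
      Submodule.subset_span ⟨_, rfl⟩
    -- A word is its sorted form plus an operator of lower order. The empty word cannot go down in
    -- order and is the monomial with exponent zero.
    rcases Nat.eq_zero_or_pos w.length with h0 | h0
    · obtain rfl := List.length_eq_zero_iff.1 h0
      refine Submodule.subset_span ⟨fun _ => 0, ?_⟩
      simp [partialPow, lieWord]
    · have h2 := ih ((w.map Y).length - 1) (by rw [List.length_map]; omega) h1
      have := add_mem h2 h3
      rwa [sub_add_cancel] at this

theorem partialPow_mem_leftInvDiffOp (β : Fin (Module.finrank ℝ E) → ℕ) :
    ∃ k, partialPow Y β ∈ leftInvDiffOp E G k := by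
  rw [partialPow_eq_lieWord]
  exact ⟨_, lieWord_mem_leftInvDiffOp le_rfl⟩

end Ordering

end LieSymbol
end

noncomputable section

namespace LieSymbol

/-! ### Invariance of differential operators and admissible families under conjugation -/

section ConjTransl

variable {E G : Type*} [NormedAddCommGroup E] [NormedSpace ℝ E]
  [TopologicalSpace G] [ChartedSpace E G] [Group G] [LieGroup 𝓘(ℝ, E) ∞ G]

/-- Left translation `f ↦ f(u ·)`, as a continuous operator on `C^∞(G)`. -/
def leftTranslCLM (u : G) : SmoothFn E G →L[ℂ] SmoothFn E G where
  toLinearMap := leftTransl u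
  cont := by
    refine continuous_iff_lieWord.2 fun l => ?_
    have h : (fun f : SmoothFn E G => toCont (lieWord l (leftTransl u f))) = fun f =>
        (toCont (lieWord l f)).comp ⟨fun x => u * x, by
          have := topologicalGroup_of_lieGroup 𝓘(ℝ, E) ∞ (G := G)
          fun_prop⟩ := by
      funext f
      rw [lieWord_leftTransl]
      rfl
    exact (congrArg Continuous h).mpr
      ((ContinuousMap.continuous_precomp _).comp (continuous_lieWord _))

/-- The operator `f ↦ f(u⁻¹ · u)` on `C^∞(G)`. -/
def conjTransl (u : G) : SmoothFn E G →L[ℂ] SmoothFn E G :=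
  leftTranslCLM u⁻¹ ∘L rightTranslCLM u

@[simp] theorem conjTransl_apply (u : G) (f : SmoothFn E G) (x : G) :
    conjTransl u f x = f (u⁻¹ * x * u) := rfl

theorem conjTransl_mul (u : G) (f g : SmoothFn E G) :
    conjTransl u (f * g) = conjTransl u f * conjTransl u g := rfl

theorem conjTransl_one (u : G) : conjTransl u (1 : SmoothFn E G) = 1 := rfl

theorem conjTransl_pow (u : G) (f : SmoothFn E G) (n : ℕ) :
    conjTransl u (f ^ n) = conjTransl u f ^ n := by
  induction n with
  | zero => simp [conjTransl_one]
  | succ n ih => rw [pow_succ, conjTransl_mul, ih, pow_succ]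

theorem conjTransl_prod {ι : Type*} (u : G) (s : Finset ι) (f : ι → SmoothFn E G) :
    conjTransl u (∏ i ∈ s, f i) = ∏ i ∈ s, conjTransl u (f i) := by
  classical
  induction s using Finset.induction_on with
  | empty => simp [conjTransl_one]
  | insert i s hi ih => rw [Finset.prod_insert hi, Finset.prod_insert hi, conjTransl_mul, ih]

theorem conjTransl_conjTransl (u v : G) (f : SmoothFn E G) :
    conjTransl u (conjTransl v f) = conjTransl (u * v) f := by
  ext x
  simp only [conjTransl_apply, mul_inv_rev]
  congr 1
  group

theorem conjTransl_inv_conjTransl (u : G) (f : SmoothFn E G) :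
    conjTransl u⁻¹ (conjTransl u f) = f := by
  rw [conjTransl_conjTransl]
  ext x
  simp

/-- Left translation commutes with the invariant fields, so the twist by Ad comes from the right
translation alone. -/
theorem lieWord_conjTransl (u : G) (l : List (GroupLieAlgebra 𝓘(ℝ, E) G)) (f : SmoothFn E G) :
    lieWord l (conjTransl u f) = conjTransl u (lieWord (l.map (adjointRep u⁻¹)) f) := by
  change lieWord l (leftTransl u⁻¹ (rightTransl u f)) = leftTransl u⁻¹ (rightTransl u _)
  rw [lieWord_leftTransl, lieWord_rightTransl]

theorem exists_leftInvDiffOp_conjTransl (u : G) {k : ℕ} {P : Module.End ℂ (SmoothFn E G)}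
    (hP : P ∈ leftInvDiffOp E G k) :
    ∃ Q ∈ leftInvDiffOp E G k, ∀ f, P (conjTransl u f) = conjTransl u (Q f) := by
  induction hP using Submodule.span_induction with
  | mem P h =>
    obtain ⟨l, hl, rfl⟩ := h
    exact ⟨_, lieWord_mem_leftInvDiffOp (by simpa using hl), fun f => lieWord_conjTransl u l f⟩
  | zero => exact ⟨0, zero_mem _, fun f => by simp⟩
  | add P₁ P₂ _ _ h₁ h₂ =>
    obtain ⟨Q₁, hQ₁, e₁⟩ := h₁
    obtain ⟨Q₂, hQ₂, e₂⟩ := h₂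
    exact ⟨Q₁ + Q₂, add_mem hQ₁ hQ₂, fun f => by simp [e₁, e₂]⟩
  | smul c P _ h =>
    obtain ⟨Q, hQ, e⟩ := h
    exact ⟨c • Q, Submodule.smul_mem _ c hQ, fun f => by simp [e]⟩

/-- Right translation differs from conjugation by a left translation, which commutes with every
left-invariant operator. -/
theorem exists_leftInvDiffOp_rightTransl (u : G) {k : ℕ} {P : Module.End ℂ (SmoothFn E G)}
    (hP : P ∈ leftInvDiffOp E G k) :
    ∃ Q ∈ leftInvDiffOp E G k, ∀ f, P (rightTransl u f) = rightTransl u (Q f) := by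
  obtain ⟨Q, hQ, e⟩ := exists_leftInvDiffOp_conjTransl u hP
  refine ⟨Q, hQ, fun f => ?_⟩
  have h1 : rightTransl u f = conjTransl u (leftTransl u f) := by ext x; simp [mul_assoc]
  have h2 : ∀ k, ∀ R ∈ leftInvDiffOp E G k, ∀ f, R (leftTransl u f) = leftTransl u (R f) := by
    intro k R hR f
    induction hR using Submodule.span_induction with
    | mem P h => obtain ⟨l, hl, rfl⟩ := h; exact lieWord_leftTransl u l f
    | zero => simp
    | add P₁ P₂ _ _ h₁ h₂ => simp [h₁, h₂]
    | smul c P _ h => simp [h]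
  rw [h1, e, h2 k Q hQ]
  ext x
  simp [mul_assoc]

/-- Conjugation fixes the identity and carries invariant operators to invariant operators of the
same order. -/
theorem VanishesToOrder.conjTransl {k : ℕ} {q : SmoothFn E G} (hq : VanishesToOrder k q) (u : G) :
    VanishesToOrder k (conjTransl u q) := by
  intro j hj P hP
  obtain ⟨Q, hQ, e⟩ := exists_leftInvDiffOp_conjTransl u hP
  rw [e, conjTransl_apply, mul_one, inv_mul_cancel]
  exact hq j hj Q hQ

theorem diffAtOne_apply (q : SmoothFn E G) (X : E) :
    diffAtOne q X = lieDeriv (toLie G X) q 1 :=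
  (lieDeriv_apply_one (toLie G X) q).symm

/-- The adjoint representation as a linear operator on the model space. -/
def adCLM (E : Type*) {G : Type*} [NormedAddCommGroup E] [NormedSpace ℝ E] [TopologicalSpace G]
    [ChartedSpace E G] [Group G] (g : G) : E →L[ℝ] E :=
  mfderiv 𝓘(ℝ, E) 𝓘(ℝ, E) (fun x : G => g * x * g⁻¹) 1

theorem diffAtOne_conjTransl (u : G) (q : SmoothFn E G) :
    diffAtOne (conjTransl u q) = (diffAtOne q).comp (adCLM E u⁻¹) := by
  ext X
  rw [diffAtOne_apply, ContinuousLinearMap.comp_apply, diffAtOne_apply]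
  have := congrArg (fun f => f 1) (congrArg DFunLike.coe (lieWord_conjTransl u [toLie G X] q))
  simp only [lieWord, List.map_cons, List.map_nil, List.prod_cons, List.prod_nil, mul_one,
    conjTransl_apply, inv_mul_cancel] at this
  exact this

/-- Precomposition of covectors with the adjoint representation. -/
def adDual (u : G) : (E →L[ℝ] ℂ) →ₗ[ℂ] (E →L[ℝ] ℂ) where
  toFun L := L.comp (adCLM E u⁻¹)
  map_add' _ _ := rfl
  map_smul' _ _ := rfl

theorem adDual_diffAtOne (u : G) (q : SmoothFn E G) :
    adDual u (diffAtOne q) = diffAtOne (conjTransl u q) := (diffAtOne_conjTransl u q).symm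

/-- The new covectors span the image of the old span under the dual of Ad, and a linear image has no
larger dimension. Since this holds for every `u`, equality will follow without proving that Ad is
invertible. -/
theorem finrank_diffAtOne_conjTransl_le [FiniteDimensional ℝ E] (u : G) {r : ℕ}
    (q : Fin r → SmoothFn E G) :
    Module.finrank ℂ (Submodule.span ℂ (Set.range fun j => diffAtOne (conjTransl u (q j)))) ≤
      Module.finrank ℂ (Submodule.span ℂ (Set.range fun j => diffAtOne (q j))) := by
  have h : Submodule.span ℂ (Set.range fun j => diffAtOne (conjTransl u (q j))) =
      (Submodule.span ℂ (Set.range fun j => diffAtOne (q j))).map (adDual u) := by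
    rw [Submodule.map_span, ← Set.range_comp]
    congr 2
    funext j
    exact (adDual_diffAtOne u (q j)).symm
  rw [h]
  have : FiniteDimensional ℂ (Submodule.span ℂ (Set.range fun j => diffAtOne (q j))) :=
    FiniteDimensional.span_of_finite ℂ (Set.finite_range _)
  exact Submodule.finrank_map_le _ _

theorem Admissible.conjTransl [FiniteDimensional ℝ E] {r : ℕ} {q : Fin r → SmoothFn E G}
    (hq : Admissible q) (u : G) : Admissible fun j => conjTransl u (q j) := by
  refine ⟨fun j => (hq.1 j).conjTransl u, fun j h => hq.2.1 j ?_, le_antisymm ?_ ?_⟩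
  · have := adDual_diffAtOne u⁻¹ (LieSymbol.conjTransl u (q j))
    rw [h, map_zero, conjTransl_inv_conjTransl] at this
    exact this.symm
  · exact (finrank_diffAtOne_conjTransl_le u q).trans hq.2.2.le
  -- The reverse inequality is the same one for `u⁻¹`, applied to the conjugated family.
  · have := finrank_diffAtOne_conjTransl_le u⁻¹ fun j => LieSymbol.conjTransl u (q j)
    have h : (fun j => LieSymbol.conjTransl u⁻¹ (LieSymbol.conjTransl u (q j))) = q :=
      funext fun j => conjTransl_inv_conjTransl u (q j)
    refine hq.2.2.ge.trans (le_trans (le_of_eq ?_) this)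
    exact congrArg (fun p : Fin r → SmoothFn E G =>
      Module.finrank ℂ (Submodule.span ℂ (Set.range fun j => diffAtOne (p j)))) h.symm

end ConjTransl

/-! ### The conjugated symbol: formula, estimates and kernel -/

section Transport

open Matrix

variable {E G : Type*} [NormedAddCommGroup E] [NormedSpace ℝ E] [FiniteDimensional ℝ E]
  [TopologicalSpace G] [ChartedSpace E G] [Group G] [LieGroup 𝓘(ℝ, E) ∞ G] [CompactSpace G]
  [T2Space G]

theorem UIrrep.mat_mul (ξ : UIrrep G) (x y : G) : ξ.mat (x * y) = ξ.mat x * ξ.mat y := by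
  simp [UIrrep.mat]

theorem UIrrep.mat_one (ξ : UIrrep G) : ξ.mat 1 = 1 := by simp [UIrrep.mat]

theorem UIrrep.mat_inv (ξ : UIrrep G) (x : G) : ξ.mat x⁻¹ = (ξ.mat x)ᴴ := by
  rw [UIrrep.mat, map_inv]; rfl

theorem UIrrep.coeff_apply (ξ : UIrrep G) (i j : Fin ξ.dim) (x : G) :
    ξ.coeff E i j x = ξ.mat x i j := rfl

theorem conjFn_apply (f : SmoothFn E G) (x : G) : conjFn f x = star (f x) := rfl

theorem mulDistrib_apply (q : SmoothFn E G) (T : Distrib E G) (h : SmoothFn E G) :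
    mulDistrib q T h = T (q * h) := rfl

theorem fourier_apply (T : Distrib E G) (ξ : UIrrep G) (i j : Fin ξ.dim) :
    fourier T ξ i j = T (conjFn (ξ.coeff E j i)) := rfl

theorem smoothFn_sum_apply {ι : Type*} (s : Finset ι) (f : ι → SmoothFn E G) (x : G) :
    (∑ i ∈ s, f i) x = ∑ i ∈ s, f i x :=
  map_sum (⟨⟨fun f : SmoothFn E G => f x, rfl⟩, fun _ _ => rfl⟩ : SmoothFn E G →+ ℂ) f s

/-- The image of a distribution under `y ↦ u⁻¹ y u`. -/
def conjDistrib (u : G) (T : Distrib E G) : Distrib E G := T.comp (conjTransl u)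

/-- Expanding $\xi(u^{-1}xu)=\xi(u)^*\xi(x)\xi(u)$ turns conjugation on the group into unitary
conjugation of the Fourier coefficients. -/
theorem fourier_conjDistrib (u : G) (T : Distrib E G) (ξ : UIrrep G) :
    fourier (conjDistrib u T) ξ = (ξ.mat u)ᴴ * fourier T ξ * ξ.mat u := by
  ext i j
  have h : conjTransl u (conjFn (ξ.coeff E j i)) =
      ∑ k, ∑ l, (star (ξ.mat u l i) * ξ.mat u k j) • conjFn (ξ.coeff E k l) := by
    ext x
    simp only [smoothFn_sum_apply, smul_apply, conjFn_apply, conjTransl_apply, UIrrep.coeff_apply,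
      UIrrep.mat_mul, UIrrep.mat_inv, Matrix.mul_apply, Matrix.conjTranspose_apply, star_sum,
      star_mul', star_star, Finset.sum_mul]
    rw [Finset.sum_comm]
    refine Finset.sum_congr rfl fun k _ => Finset.sum_congr rfl fun l _ => ?_
    ring
  rw [fourier_apply]
  change T (conjTransl u (conjFn (ξ.coeff E j i))) = _
  rw [h]
  simp only [map_sum, map_smul, Matrix.mul_apply, Matrix.conjTranspose_apply, fourier_apply,
    Finset.sum_mul, smul_eq_mul]
  refine Finset.sum_congr rfl fun k _ => Finset.sum_congr rfl fun l _ => ?_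
  ring

theorem mulDistrib_conjDistrib (u : G) (q : SmoothFn E G) (T : Distrib E G) :
    mulDistrib q (conjDistrib u T) = conjDistrib u (mulDistrib (conjTransl u q) T) := rfl

/-- Multiplication by `q` after the conjugation of a distribution is multiplication by the
conjugated function before it. This is why difference operators are replaced by their conjugates. -/
theorem IsDifference.conj {q : SmoothFn E G} {a a' : MatField G} (u : G)
    (h : IsDifference E (conjTransl u q) a a') :
    IsDifference E q (fun ξ => (ξ.mat u)ᴴ * a ξ * ξ.mat u)
      (fun ξ => (ξ.mat u)ᴴ * a' ξ * ξ.mat u) := by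
  obtain ⟨T, rfl, rfl⟩ := h
  exact ⟨conjDistrib u T, funext fun ξ => fourier_conjDistrib u T ξ, by
    rw [mulDistrib_conjDistrib]; exact funext fun ξ => fourier_conjDistrib u _ ξ⟩

theorem opNorm_unitary_conj {d : ℕ} (U : Matrix.unitaryGroup (Fin d) ℂ)
    (M : Matrix (Fin d) (Fin d) ℂ) :
    opNorm ((U : Matrix (Fin d) (Fin d) ℂ)ᴴ * M * (U : Matrix (Fin d) (Fin d) ℂ)) ≤ opNorm M := by
  let e := Matrix.toEuclideanCLM (𝕜 := ℂ) (n := Fin d)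
  have h1 : ‖e (U : Matrix (Fin d) (Fin d) ℂ)‖ ≤ 1 := by
    refine ContinuousLinearMap.opNorm_le_bound _ zero_le_one fun v => ?_
    have h2 : star (e (U : Matrix (Fin d) (Fin d) ℂ)) * e (U : Matrix (Fin d) (Fin d) ℂ) = 1 := by
      rw [← map_star, ← map_mul, Matrix.UnitaryGroup.star_mul_self, map_one]
    have h3 : ‖e (U : Matrix (Fin d) (Fin d) ℂ) v‖ ^ 2 = ‖v‖ ^ 2 := by
      rw [← @inner_self_eq_norm_sq ℂ, ← @inner_self_eq_norm_sq ℂ,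
        ← ContinuousLinearMap.adjoint_inner_right]
      have := congrArg (fun L => L v) h2
      exact congrArg (fun w => RCLike.re (inner ℂ v w)) this
    rw [one_mul]
    exact (pow_le_pow_iff_left₀ (norm_nonneg _) (norm_nonneg _) two_ne_zero).1 h3.le
  have h2 : ‖e (U : Matrix (Fin d) (Fin d) ℂ)ᴴ‖ ≤ 1 := by
    rw [← Matrix.star_eq_conjTranspose, map_star, ContinuousLinearMap.star_eq_adjoint,
      LinearIsometryEquiv.norm_map]; exact h1
  change ‖e _‖ ≤ ‖e M‖
  rw [map_mul, map_mul]
  refine (norm_mul_le _ _).trans ?_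
  refine (mul_le_of_le_one_right (norm_nonneg _) h1).trans ?_
  refine (norm_mul_le _ _).trans ?_
  exact mul_le_of_le_one_left (norm_nonneg _) h2

/-- The symbol `ξ(u)^* σ(x u⁻¹, ξ) ξ(u)`. -/
def conjSymb (u : G) (σ : Symb E G) : Symb E G := fun ξ => Matrix.of fun i j =>
  ∑ k, ∑ l, (star (ξ.mat u k i) * ξ.mat u l j) • rightTransl u⁻¹ (σ ξ k l)

theorem conjSymb_deriv (u : G) (σ : Symb E G) {P Q : Module.End ℂ (SmoothFn E G)}
    (h : ∀ f, P (rightTransl u⁻¹ f) = rightTransl u⁻¹ (Q f)) (x : G) (ξ : UIrrep G) :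
    (conjSymb u σ).deriv P x ξ = (ξ.mat u)ᴴ * σ.deriv Q (x * u⁻¹) ξ * ξ.mat u := by
  ext i j
  simp only [Symb.deriv, conjSymb, Matrix.map_apply, Matrix.of_apply, map_sum, map_smul, h,
    smoothFn_sum_apply, smul_apply, rightTransl_apply, Matrix.mul_apply,
    Matrix.conjTranspose_apply, Finset.sum_mul]
  rw [Finset.sum_comm]
  refine Finset.sum_congr rfl fun k _ => Finset.sum_congr rfl fun l _ => ?_
  ring

theorem conjSymb_eval (u : G) (σ : Symb E G) (x : G) (ξ : UIrrep G) :
    (conjSymb u σ).eval x ξ = (ξ.mat u)ᴴ * σ.eval (x * u⁻¹) ξ * ξ.mat u :=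
  conjSymb_deriv u σ (P := 1) (Q := 1) (fun _ => rfl) x ξ

/-- The constant is unchanged: unitary conjugation does not increase the norm, and the estimate is
uniform in $x$, so it may be used at $xu^{-1}$. -/
theorem SymbolEstimate.conjSymb
    {b : Module.Basis (Fin (Module.finrank ℝ E)) ℝ (GroupLieAlgebra 𝓘(ℝ, E) G)}
    {q : SmoothFn E G} {P Q : Module.End ℂ (SmoothFn E G)} {s : ℝ} {σ : Symb E G} (u : G)
    (hPQ : ∀ f, P (rightTransl u⁻¹ f) = rightTransl u⁻¹ (Q f))
    (h : SymbolEstimate b (conjTransl u q) Q s σ) : SymbolEstimate b q P s (conjSymb u σ) := by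
  obtain ⟨C, hC⟩ := h
  refine ⟨C, fun x => ?_⟩
  obtain ⟨a, ha, hb⟩ := hC (x * u⁻¹)
  refine ⟨_, ?_, fun ξ => (opNorm_unitary_conj (ξ.toHom u) (a ξ)).trans (hb ξ)⟩
  have := ha.conj u
  rwa [← funext fun ξ => conjSymb_deriv u σ hPQ x ξ] at this

theorem IsDifference.add {q : SmoothFn E G} {a a' c c' : MatField G}
    (h : IsDifference E q a a') (h' : IsDifference E q c c') :
    IsDifference E q (a + c) (a' + c') := by
  obtain ⟨T, rfl, rfl⟩ := h
  obtain ⟨S, rfl, rfl⟩ := h'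
  exact ⟨T + S, rfl, rfl⟩

theorem IsDifference.smul {q : SmoothFn E G} {a a' : MatField G} (c : ℂ)
    (h : IsDifference E q a a') : IsDifference E q (c • a) (c • a') := by
  obtain ⟨T, rfl, rfl⟩ := h
  exact ⟨c • T, rfl, rfl⟩

theorem opNorm_add_le {d : ℕ} (M N : Matrix (Fin d) (Fin d) ℂ) :
    opNorm (M + N) ≤ opNorm M + opNorm N := by
  simp only [opNorm, map_add]
  exact norm_add_le _ _

theorem opNorm_smul {d : ℕ} (c : ℂ) (M : Matrix (Fin d) (Fin d) ℂ) :
    opNorm (c • M) = ‖c‖ * opNorm M := by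
  simp only [opNorm, map_smul, norm_smul]

theorem opNorm_nonneg {d : ℕ} (M : Matrix (Fin d) (Fin d) ℂ) : 0 ≤ opNorm M := norm_nonneg _

/-- For a fixed `q` the estimate is stable under linear combinations of operators, because the
distributions behind it are combined in the same way. -/
theorem SymbolEstimate.of_mem_span
    {b : Module.Basis (Fin (Module.finrank ℝ E)) ℝ (GroupLieAlgebra 𝓘(ℝ, E) G)}
    {q : SmoothFn E G} {s : ℝ} {σ : Symb E G} {S : Set (Module.End ℂ (SmoothFn E G))}
    (h : ∀ P ∈ S, SymbolEstimate b q P s σ) {P : Module.End ℂ (SmoothFn E G)}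
    (hP : P ∈ Submodule.span ℂ S) : SymbolEstimate b q P s σ := by
  induction hP using Submodule.span_induction with
  | mem P hP => exact h P hP
  | zero =>
    refine ⟨0, fun x => ⟨0, ⟨0, ?_, rfl⟩, fun ξ => ?_⟩⟩
    · rfl
    · simp [opNorm]
  | add P Q _ _ hP hQ =>
    obtain ⟨C, hC⟩ := hP
    obtain ⟨D, hD⟩ := hQ
    refine ⟨C + D, fun x => ?_⟩
    obtain ⟨a, ha, ha'⟩ := hC x
    obtain ⟨c, hc, hc'⟩ := hD x
    refine ⟨a + c, ha.add hc, fun ξ => (opNorm_add_le _ _).trans ?_⟩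
    rw [add_mul]
    exact add_le_add (ha' ξ) (hc' ξ)
  | smul z P _ hP =>
    obtain ⟨C, hC⟩ := hP
    refine ⟨‖z‖ * C, fun x => ?_⟩
    obtain ⟨a, ha, ha'⟩ := hC x
    refine ⟨z • a, ha.smul z, fun ξ => ?_⟩
    rw [Pi.smul_apply, opNorm_smul, mul_assoc]
    exact mul_le_mul_of_nonneg_left (ha' ξ) (norm_nonneg z)

/-- Both $\xi$ and $\xi^*$ are expanded by $\xi(xu)=\xi(x)\xi(u)$. What remains is the pairing for
$A$ tested against $h(\cdot\,u)$. -/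
theorem isSymbolOf_conjSymb [MeasurableSpace G] [BorelSpace G] (μ : Measure G)
    [μ.IsMulRightInvariant] [IsFiniteMeasure μ] {A : SmoothFn E G →L[ℂ] Distrib E G} {σ : Symb E G}
    (hσ : IsSymbolOf μ σ A) (u : G) : IsSymbolOf μ (conjSymb u σ) (conjOp u A) := by
  have := topologicalGroup_of_lieGroup 𝓘(ℝ, E) ∞ (G := G)
  intro ξ i j h
  have hr : ∀ a b, rightTransl u (ξ.coeff E a b) = ∑ c, ξ.mat u c b • ξ.coeff E a c := by
    intro a b
    ext x
    simp only [rightTransl_apply, UIrrep.coeff_apply, UIrrep.mat_mul, Matrix.mul_apply,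
      smoothFn_sum_apply, smul_apply, mul_comm]
  have hr' : ∀ a b, rightTransl u (conjFn (ξ.coeff E a b)) =
      ∑ c, star (ξ.mat u c b) • conjFn (ξ.coeff E a c) := by
    intro a b
    ext x
    simp only [rightTransl_apply, UIrrep.coeff_apply, UIrrep.mat_mul, Matrix.mul_apply,
      smoothFn_sum_apply, smul_apply, conjFn_apply, star_sum, star_mul']
    exact Finset.sum_congr rfl fun _ _ => mul_comm _ _
  have hint : ∀ f : SmoothFn E G, Integrable f μ := fun f =>
    f.contMDiff.continuous.integrable_of_hasCompactSupport (HasCompactSupport.of_compactSpace _)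
  have h1 : (∑ k, mulDistrib (conjFn (ξ.coeff E k i)) (conjOp u A (ξ.coeff E k j))) h =
      ∑ c, ∑ a, (star (ξ.mat u c i) * ξ.mat u a j) *
        (∑ k, mulDistrib (conjFn (ξ.coeff E k c)) (A (ξ.coeff E k a))) (rightTransl u h) := by
    simp only [_root_.sum_apply, mulDistrib_apply, conjOp_apply, Finset.mul_sum]
    have h2 : ∀ k, A (rightTranslCLM u (ξ.coeff E k j))
        (rightTranslCLM u (conjFn (ξ.coeff E k i) * h)) = ∑ c, ∑ a,
        star (ξ.mat u c i) * ξ.mat u a j *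
          A (ξ.coeff E k a) (conjFn (ξ.coeff E k c) * rightTransl u h) := by
      intro k
      change A (rightTransl u (ξ.coeff E k j))
        (rightTransl u (conjFn (ξ.coeff E k i)) * rightTransl u h) = _
      rw [hr, hr', Finset.sum_mul]
      simp only [map_sum, map_smul, _root_.sum_apply, _root_.smul_apply,
        smul_eq_mul]
      have h3 : ∀ (z : ℂ) (f g : SmoothFn E G), (z • f) * g = z • (f * g) := by
        intro z f g
        ext x
        exact mul_assoc z (f x) (g x)
      simp only [h3, map_smul, smul_eq_mul]
      refine Finset.sum_congr rfl fun c _ => Finset.sum_congr rfl fun a _ => ?_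
      ring
    rw [Finset.sum_congr rfl fun k _ => h2 k, Finset.sum_comm]
    refine Finset.sum_congr rfl fun c _ => ?_
    rw [Finset.sum_comm]
  rw [h1]
  -- Right invariance of the measure moves the translation from the test function to the symbol;
  -- this is the origin of $xu^{-1}$.
  have h4 : ∀ c a, (∑ k, mulDistrib (conjFn (ξ.coeff E k c)) (A (ξ.coeff E k a)))
      (rightTransl u h) = ∫ x, (rightTransl u⁻¹ (σ ξ c a) * h) x ∂μ := by
    intro c a
    rw [hσ ξ c a, ← integral_mul_right_eq_self (fun x => (rightTransl u⁻¹ (σ ξ c a) * h) x) u]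
    symm
    refine integral_congr_ae (Filter.Eventually.of_forall fun x => ?_)
    change rightTransl u⁻¹ (σ ξ c a) (x * u) * h (x * u) = _
    rw [rightTransl_apply, mul_inv_cancel_right]
    rfl
  have h5 : ∀ x, conjSymb u σ ξ i j x * h x = ∑ c, ∑ a, (star (ξ.mat u c i) * ξ.mat u a j) *
      (rightTransl u⁻¹ (σ ξ c a) * h) x := by
    intro x
    change conjSymb u σ ξ i j x * h x = ∑ c, ∑ a, (star (ξ.mat u c i) * ξ.mat u a j) *
      (rightTransl u⁻¹ (σ ξ c a) x * h x)
    simp only [conjSymb, Matrix.of_apply, smoothFn_sum_apply, smul_apply, Finset.sum_mul, mul_assoc]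
  simp only [h5, h4]
  rw [integral_finsetSum _ fun c _ => integrable_finsetSum _ fun a _ => (hint _).const_mul _]
  refine Finset.sum_congr rfl fun c _ => ?_
  rw [integral_finsetSum _ fun a _ => (hint _).const_mul _]
  exact Finset.sum_congr rfl fun a _ => (integral_const_mul _ _).symm

theorem KernelSmoothOffOne.conjSymb [MeasurableSpace G] [BorelSpace G] {μ : Measure G}
    [μ.IsMulRightInvariant] [μ.IsMulLeftInvariant] {σ : Symb E G}
    (h : KernelSmoothOffOne μ σ) (u : G) : KernelSmoothOffOne μ (conjSymb u σ) := by
  have := topologicalGroup_of_lieGroup 𝓘(ℝ, E) ∞ (G := G)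
  intro x
  obtain ⟨R, hR, hs⟩ := h (x * u⁻¹)
  refine ⟨conjDistrib u R, funext fun ξ => ?_, fun y hy => ?_⟩
  · rw [fourier_conjDistrib, hR, conjSymb_eval]
  · by_contra hy1
    have h1 : u⁻¹⁻¹ * (u⁻¹ * y * u) * u⁻¹ = y := by group
    -- Conjugation maps only $e$ to $e$, so the conjugate of $y\ne e$ is still a point where `R` is
    -- smooth. Conjugating the smooth density there gives one near $y$.
    have hy2 : u * y * u⁻¹ ∉ singSupp μ R := by
      intro h2
      have h3 : u * y * u⁻¹ = 1 := hs h2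
      exact hy1 (by rw [mem_singleton_iff]; simpa [mul_inv_eq_one] using h3)
    simp only [singSupp, mem_ofPred_eq, not_not] at hy2
    obtain ⟨U, hU, hyU, f, hf⟩ := hy2
    refine hy ⟨(fun z => u * z * u⁻¹) ⁻¹' U, hU.preimage (by fun_prop), hyU,
      conjTransl u⁻¹ f, fun g hg => ?_⟩
    change R (conjTransl u g) = _
    rw [hf]
    -- Conjugation preserves the measure, one translation from each side.
    · rw [← integral_mul_left_eq_self _ u, ← integral_mul_right_eq_self _ u⁻¹]
      refine integral_congr_ae (Filter.Eventually.of_forall fun z => ?_)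
      simp [mul_assoc]
    · have h2 : tsupport (conjTransl u g) = (fun z => u⁻¹ * z * u) ⁻¹' tsupport g :=
        (tsupport_comp_eq_preimage g
          ((Homeomorph.mulLeft u⁻¹).trans (Homeomorph.mulRight u)))
      rw [h2]
      intro z hz
      have := hg hz
      simpa [mul_assoc] using this

end Transport

end LieSymbol
end

noncomputable section

namespace LieSymbol

/-! ### Complete reducibility, Schur's lemma and equivalence of representations -/

section Decomposition

open Matrix

variable {G : Type*} [TopologicalSpace G] [Group G]

/-- The unitary representation on an invariant subspace, given by the matrix `V` of an orthonormal
basis. -/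
theorem exists_subrep {ι κ : Type*} [Fintype ι] [DecidableEq ι] [Fintype κ] [DecidableEq κ]
    (ρ : G →* Matrix.unitaryGroup ι ℂ) (hρ : Continuous ρ) (V : Matrix ι κ ℂ) (hV : Vᴴ * V = 1)
    (hinv : ∀ x, V * Vᴴ * ((ρ x : Matrix ι ι ℂ) * V) = (ρ x : Matrix ι ι ℂ) * V) :
    ∃ ρ' : G →* Matrix.unitaryGroup κ ℂ, Continuous ρ' ∧
      ∀ x, (ρ x : Matrix ι ι ℂ) * V = V * (ρ' x : Matrix κ κ ℂ) := by
  let M : G → Matrix κ κ ℂ := fun x => Vᴴ * ((ρ x : Matrix ι ι ℂ) * V)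
  have hM : ∀ x, (ρ x : Matrix ι ι ℂ) * V = V * M x := fun x => by
    rw [← hinv x, Matrix.mul_assoc V]
  have hone : M 1 = 1 := by simp [M, hV]
  have hmul : ∀ x y, M (x * y) = M x * M y := by
    intro x y
    calc M (x * y) = Vᴴ * ((ρ x : Matrix ι ι ℂ) * ((ρ y : Matrix ι ι ℂ) * V)) := by
          simp [M, Matrix.mul_assoc]
      _ = M x * M y := by rw [hM y]; simp only [M, Matrix.mul_assoc]
  have hstar : ∀ x, star (M x) = M x⁻¹ := by
    intro x
    have : ((ρ x⁻¹ : Matrix.unitaryGroup ι ℂ) : Matrix ι ι ℂ) = (ρ x : Matrix ι ι ℂ)ᴴ := by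
      rw [map_inv]; rfl
    simp only [M, this, Matrix.star_eq_conjTranspose, Matrix.conjTranspose_mul,
      Matrix.conjTranspose_conjTranspose, Matrix.mul_assoc]
  refine ⟨{ toFun := fun x => ⟨M x, ?_⟩, map_one' := Subtype.ext hone,
            map_mul' := fun x y => Subtype.ext (hmul x y) }, ?_, hM⟩
  · rw [Matrix.mem_unitaryGroup_iff, hstar, ← hmul, mul_inv_cancel, hone]
  · refine Continuous.subtype_mk ?_ _
    have : Continuous fun x => (ρ x : Matrix ι ι ℂ) := continuous_subtype_val.comp hρ
    exact continuous_const.matrix_mul (this.matrix_mul continuous_const)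

/-- The matrix of an orthonormal basis of a subspace. -/
def basisMatrix {ι : Type*} [Fintype ι] (W : Submodule ℂ (EuclideanSpace ℂ ι)) :
    Matrix ι (Fin (Module.finrank ℂ W)) ℂ :=
  Matrix.of fun i a => (stdOrthonormalBasis ℂ W a : EuclideanSpace ℂ ι) i

theorem basisMatrix_conjTranspose_mul {ι : Type*} [Fintype ι]
    (W : Submodule ℂ (EuclideanSpace ℂ ι)) : (basisMatrix W)ᴴ * basisMatrix W = 1 := by
  ext a c
  have h := orthonormal_iff_ite.1 (stdOrthonormalBasis ℂ W).orthonormal a c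
  rw [Submodule.coe_inner, PiLp.inner_apply] at h
  simp only [Matrix.mul_apply, Matrix.conjTranspose_apply, basisMatrix, Matrix.of_apply,
    Matrix.one_apply, ← h]
  refine Finset.sum_congr rfl fun i _ => ?_
  simp [mul_comm]

theorem basisMatrix_mul_conjTranspose_mulVec {ι : Type*} [Fintype ι]
    (W : Submodule ℂ (EuclideanSpace ℂ ι)) (v : EuclideanSpace ℂ ι) :
    WithLp.toLp 2 ((basisMatrix W * (basisMatrix W)ᴴ) *ᵥ v.ofLp) = W.starProjection v := by
  rw [Submodule.starProjection_apply, (stdOrthonormalBasis ℂ W).orthogonalProjectionOnto_apply_eq_sum]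
  ext i
  simp only [← Matrix.mulVec_mulVec]
  simp [Matrix.mulVec, dotProduct, basisMatrix, PiLp.inner_apply, mul_comm]

/-- Complete reducibility: a continuous unitary representation is a direct sum of irreducible
representations. -/
theorem exists_decomposition (n : ℕ) : ∀ {ι : Type} [Fintype ι] [DecidableEq ι]
    (ρ : G →* Matrix.unitaryGroup ι ℂ), Continuous ρ → Fintype.card ι = n →
    ∃ (κ : Type) (_ : Fintype κ) (ξ : κ → UIrrep G) (V : ∀ k, Matrix ι (Fin (ξ k).dim) ℂ),
      (∀ k x, (ρ x : Matrix ι ι ℂ) * V k = V k * (ξ k).mat x) ∧ ∑ k, V k * (V k)ᴴ = 1 := by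
  induction n using Nat.strong_induction_on with
  | _ n ih =>
  intro ι _ _ ρ hρ hn
  rcases Nat.eq_zero_or_pos n with h0 | h0
  · have : IsEmpty ι := Fintype.card_eq_zero_iff.1 (hn.trans h0)
    exact ⟨Empty, inferInstance, fun e => e.elim, fun e => e.elim, fun e => e.elim,
      Subsingleton.elim _ _⟩
  by_cases hirr : ∀ v : ι → ℂ, v ≠ 0 →
    Submodule.span ℂ (Set.range fun x : G => (ρ x : Matrix ι ι ℂ) *ᵥ v) = ⊤
  -- Irreducible case: the matrices are only reindexed, since `UIrrep` asks for the index type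
  -- `Fin`.
  · let e : ι ≃ Fin n := (Fintype.equivFin ι).trans (finCongr hn)
    let V : Matrix ι (Fin n) ℂ := (1 : Matrix ι ι ℂ).submatrix id e.symm
    have hV1 : V * Vᴴ = 1 := by
      simp only [V, Matrix.conjTranspose_submatrix, Matrix.conjTranspose_one]
      rw [Matrix.submatrix_mul_equiv]
      simp
    have hV2 : Vᴴ * V = 1 := by
      simp only [V, Matrix.conjTranspose_submatrix, Matrix.conjTranspose_one]
      rw [← Matrix.submatrix_mul _ _ _ _ _ Function.bijective_id]
      simp
    obtain ⟨ρ', hρ', hint⟩ := exists_subrep ρ hρ V hV2 (fun x => by rw [hV1, Matrix.one_mul])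
    let ξ : UIrrep G :=
      { dim := n
        dim_pos := h0
        toHom := ρ'
        continuous_toHom := hρ'
        irreducible := fun v hv => by
          have hv' : V *ᵥ v ≠ 0 := fun h => hv (by
            have := congrArg (fun w => Vᴴ *ᵥ w) h
            simpa [Matrix.mulVec_mulVec, hV2] using this)
          rw [eq_top_iff]
          intro w _
          have hw : V *ᵥ w ∈ Submodule.span ℂ (Set.range fun x : G =>
              (ρ x : Matrix ι ι ℂ) *ᵥ (V *ᵥ v)) := by rw [hirr _ hv']; trivial
          have hw2 := Submodule.mem_map_of_mem (f := (Vᴴ).mulVecLin) hw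
          rw [Submodule.map_span, ← Set.range_comp] at hw2
          convert hw2 using 1
          · congr 2
            funext x
            simp only [Function.comp_apply, Matrix.mulVecLin_apply]
            rw [Matrix.mulVec_mulVec v, hint, Matrix.mulVec_mulVec, ← Matrix.mul_assoc, hV2,
              Matrix.one_mul]
          · simp [Matrix.mulVec_mulVec, hV2] }
    exact ⟨Unit, inferInstance, fun _ => ξ, fun _ => V, fun _ x => hint x, by simpa using hV1⟩
  · push Not at hirr
    obtain ⟨v, hv, hspan⟩ := hirr
    let L := (WithLp.linearEquiv 2 ℂ (ι → ℂ)).symm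
    -- The cyclic subspace of a vector that violates irreducibility: invariant, nonzero since it
    -- contains `v`, and proper.
    let W : Submodule ℂ (EuclideanSpace ℂ ι) :=
      (Submodule.span ℂ (Set.range fun x : G => (ρ x : Matrix ι ι ℂ) *ᵥ v)).map L.toLinearMap
    have hW : W ≠ ⊤ := by
      intro h
      apply hspan
      have h' := congrArg (Submodule.comap L.toLinearMap) h
      rwa [Submodule.comap_map_eq_of_injective L.injective, Submodule.comap_top] at h'
    have hW' : W ≠ ⊥ := by
      intro h
      have : L v ∈ W := Submodule.mem_map_of_mem (Submodule.subset_span ⟨1, by simp⟩)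
      rw [h, Submodule.mem_bot] at this
      exact hv (L.map_eq_zero_iff.1 this)
    have hinv : ∀ x, ∀ w ∈ W, WithLp.toLp 2 ((ρ x : Matrix ι ι ℂ) *ᵥ w.ofLp) ∈ W := by
      rintro x _ ⟨w, hw, rfl⟩
      refine Submodule.mem_map_of_mem (f := L.toLinearMap) (r := (ρ x : Matrix ι ι ℂ) *ᵥ w) ?_
      have h2 := Submodule.mem_map_of_mem (f := (ρ x : Matrix ι ι ℂ).mulVecLin) hw
      rw [Submodule.map_span, ← Set.range_comp] at h2
      refine Submodule.span_mono ?_ h2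
      rintro _ ⟨y, rfl⟩
      exact ⟨x * y, by simp [Matrix.mulVec_mulVec]⟩
    have hinner : ∀ x, ∀ w z : EuclideanSpace ℂ ι,
        inner ℂ w (WithLp.toLp 2 ((ρ x : Matrix ι ι ℂ) *ᵥ z.ofLp)) =
        inner ℂ (WithLp.toLp 2 ((ρ x⁻¹ : Matrix ι ι ℂ) *ᵥ w.ofLp)) z := by
      intro x w z
      have : ((ρ x⁻¹ : Matrix.unitaryGroup ι ℂ) : Matrix ι ι ℂ) = (ρ x : Matrix ι ι ℂ)ᴴ := by
        rw [map_inv]; rfl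
      rw [EuclideanSpace.inner_eq_star_dotProduct, EuclideanSpace.inner_eq_star_dotProduct, this,
        Matrix.star_mulVec, Matrix.conjTranspose_conjTranspose, dotProduct_comm _ (star w.ofLp),
        dotProduct_comm _ (star w.ofLp ᵥ* _), Matrix.dotProduct_mulVec]
    -- Unitarity makes the orthogonal complement invariant, so the representation splits into two of
    -- smaller dimension.
    have hinv' : ∀ x, ∀ w ∈ Wᗮ, WithLp.toLp 2 ((ρ x : Matrix ι ι ℂ) *ᵥ w.ofLp) ∈ Wᗮ := by
      intro x w hw
      rw [Submodule.mem_orthogonal] at hw ⊢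
      intro z hz
      rw [hinner]
      exact hw _ (hinv _ _ hz)
    have hproj : ∀ W : Submodule ℂ (EuclideanSpace ℂ ι),
        (∀ x, ∀ w ∈ W, WithLp.toLp 2 ((ρ x : Matrix ι ι ℂ) *ᵥ w.ofLp) ∈ W) →
        ∀ x, basisMatrix W * (basisMatrix W)ᴴ * ((ρ x : Matrix ι ι ℂ) * basisMatrix W) =
          (ρ x : Matrix ι ι ℂ) * basisMatrix W := by
      intro W hW x
      ext i a
      have h1 := basisMatrix_mul_conjTranspose_mulVec W
        (WithLp.toLp 2 ((ρ x : Matrix ι ι ℂ) *ᵥ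
          (stdOrthonormalBasis ℂ W a : EuclideanSpace ℂ ι).ofLp))
      rw [Submodule.starProjection_eq_self_iff.2 (hW x _ (Subtype.coe_prop _))] at h1
      exact congrFun (congrArg WithLp.ofLp h1) i
    have hcard : Module.finrank ℂ (EuclideanSpace ℂ ι) = n := by simp [hn]
    have hlt : Module.finrank ℂ W < n := hcard ▸ Submodule.finrank_lt hW
    have hlt' : Module.finrank ℂ Wᗮ < n := by
      rw [← hcard]
      refine Submodule.finrank_lt fun h => hW' ?_
      rw [← Submodule.orthogonal_orthogonal W, h, Submodule.top_orthogonal_eq_bot]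
    obtain ⟨ρ₁, hρ₁, i₁⟩ := exists_subrep ρ hρ (basisMatrix W) (basisMatrix_conjTranspose_mul W)
      (hproj W hinv)
    obtain ⟨ρ₂, hρ₂, i₂⟩ := exists_subrep ρ hρ (basisMatrix Wᗮ)
      (basisMatrix_conjTranspose_mul Wᗮ) (hproj Wᗮ hinv')
    obtain ⟨κ₁, _, ξ₁, V₁, c₁, s₁⟩ := ih _ hlt ρ₁ hρ₁ (Fintype.card_fin _)
    obtain ⟨κ₂, _, ξ₂, V₂, c₂, s₂⟩ := ih _ hlt' ρ₂ hρ₂ (Fintype.card_fin _)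
    refine ⟨κ₁ ⊕ κ₂, inferInstance, Sum.elim ξ₁ ξ₂,
      fun k => Sum.rec (motive := fun k => Matrix ι (Fin (Sum.elim ξ₁ ξ₂ k).dim) ℂ)
        (fun k => basisMatrix W * V₁ k) (fun k => basisMatrix Wᗮ * V₂ k) k, ?_, ?_⟩
    · rintro (k | k) x
      · change (ρ x : Matrix ι ι ℂ) * (basisMatrix W * V₁ k) = basisMatrix W * V₁ k * (ξ₁ k).mat x
        rw [← Matrix.mul_assoc, i₁, Matrix.mul_assoc, c₁, Matrix.mul_assoc]
      · change (ρ x : Matrix ι ι ℂ) * (basisMatrix Wᗮ * V₂ k) =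
          basisMatrix Wᗮ * V₂ k * (ξ₂ k).mat x
        rw [← Matrix.mul_assoc, i₂, Matrix.mul_assoc, c₂, Matrix.mul_assoc]
    · rw [Fintype.sum_sum_type]
      change ∑ k, basisMatrix W * V₁ k * (basisMatrix W * V₁ k)ᴴ +
        ∑ k, basisMatrix Wᗮ * V₂ k * (basisMatrix Wᗮ * V₂ k)ᴴ = 1
      have h1 : ∀ k, basisMatrix W * V₁ k * (basisMatrix W * V₁ k)ᴴ =
          basisMatrix W * (V₁ k * (V₁ k)ᴴ) * (basisMatrix W)ᴴ := fun k => by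
        rw [Matrix.conjTranspose_mul]; simp only [Matrix.mul_assoc]
      have h2 : ∀ k, basisMatrix Wᗮ * V₂ k * (basisMatrix Wᗮ * V₂ k)ᴴ =
          basisMatrix Wᗮ * (V₂ k * (V₂ k)ᴴ) * (basisMatrix Wᗮ)ᴴ := fun k => by
        rw [Matrix.conjTranspose_mul]; simp only [Matrix.mul_assoc]
      rw [Finset.sum_congr rfl fun k _ => h1 k, Finset.sum_congr rfl fun k _ => h2 k,
        ← Matrix.sum_mul, ← Matrix.sum_mul, ← Matrix.mul_sum, ← Matrix.mul_sum, s₁, s₂,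
        Matrix.mul_one, Matrix.mul_one]
      -- The two blocks are now the orthogonal projections on the subspace and its complement, whose
      -- sum is the identity.
      refine Matrix.toLin'.injective (LinearMap.ext fun w => ?_)
      have h3 := basisMatrix_mul_conjTranspose_mulVec W (WithLp.toLp 2 w)
      have h4 := basisMatrix_mul_conjTranspose_mulVec Wᗮ (WithLp.toLp 2 w)
      have h5 := W.starProjection_add_starProjection_orthogonal (WithLp.toLp 2 w)
      rw [← h3, ← h4] at h5
      rw [Matrix.toLin'_apply, Matrix.add_mulVec, Matrix.toLin'_one]
      exact congrArg WithLp.ofLp h5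

/-- Schur's lemma: a matrix that commutes with an irreducible representation is scalar. -/
theorem UIrrep.exists_eq_smul_one (ξ : UIrrep G) (M : Matrix (Fin ξ.dim) (Fin ξ.dim) ℂ)
    (h : ∀ x, ξ.mat x * M = M * ξ.mat x) : ∃ z : ℂ, M = z • 1 := by
  have : Nonempty (Fin ξ.dim) := ⟨⟨0, ξ.dim_pos⟩⟩
  obtain ⟨z, hz⟩ := Module.End.exists_eigenvalue (Matrix.toLin' M)
  obtain ⟨v, hv⟩ := hz.exists_hasEigenvector
  refine ⟨z, Matrix.toLin'.injective (LinearMap.ext fun w => ?_)⟩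
  -- Every vector is a combination of translates of the eigenvector `v`, and a commuting `M` acts on
  -- each of these by the same scalar.
  have hw : w ∈ Submodule.span ℂ (Set.range fun x : G => ξ.mat x *ᵥ v) := by
    rw [show Submodule.span ℂ (Set.range fun x : G => ξ.mat x *ᵥ v) = ⊤ from
      ξ.irreducible v hv.2]; trivial
  induction hw using Submodule.span_induction with
  | mem w hw =>
    obtain ⟨x, rfl⟩ := hw
    have h1 : M *ᵥ v = z • v := hv.apply_eq_smul
    simp [Matrix.mulVec_mulVec, ← h]
    rw [← Matrix.mulVec_mulVec, h1, Matrix.mulVec_smul]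
  | zero => simp
  | add a c _ _ ha hc => rw [map_add, map_add, ha, hc]
  | smul r a _ ha => rw [map_smul, map_smul, ha]

/-- `V` intertwines two representations. -/
def Intertwines (η ζ : UIrrep G) (V : Matrix (Fin ζ.dim) (Fin η.dim) ℂ) : Prop :=
  ∀ x, ζ.mat x * V = V * η.mat x

theorem Intertwines.conjTranspose {η ζ : UIrrep G} {V : Matrix (Fin ζ.dim) (Fin η.dim) ℂ}
    (h : Intertwines η ζ V) : Intertwines ζ η Vᴴ := by
  have hinv : ∀ (ξ : UIrrep G) (x : G), (ξ.mat x⁻¹)ᴴ = ξ.mat x := by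
    intro ξ x
    rw [UIrrep.mat, map_inv]
    exact Matrix.conjTranspose_conjTranspose _
  intro x
  have := congrArg Matrix.conjTranspose (h x⁻¹)
  rw [Matrix.conjTranspose_mul, Matrix.conjTranspose_mul, hinv, hinv] at this
  exact this.symm

theorem Intertwines.mul {η ζ ξ : UIrrep G} {V : Matrix (Fin ζ.dim) (Fin η.dim) ℂ}
    {W : Matrix (Fin ξ.dim) (Fin ζ.dim) ℂ} (hW : Intertwines ζ ξ W) (hV : Intertwines η ζ V) :
    Intertwines η ξ (W * V) := fun x => by
  rw [← Matrix.mul_assoc, hW, Matrix.mul_assoc, hV, Matrix.mul_assoc]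

/-- $V^*V$ commutes with $\eta$, so Schur's lemma applies, and $V^*V=0$ would force $V=0$. A nonzero
intertwiner is thus a multiple of an isometry. -/
theorem Intertwines.exists_smul_one {η ζ : UIrrep G} {V : Matrix (Fin ζ.dim) (Fin η.dim) ℂ}
    (h : Intertwines η ζ V) (hV : V ≠ 0) : ∃ z : ℂ, z ≠ 0 ∧ Vᴴ * V = z • 1 := by
  obtain ⟨z, hz⟩ := η.exists_eq_smul_one _ (h.conjTranspose.mul h)
  refine ⟨z, fun h0 => hV ?_, hz⟩
  rw [h0, zero_smul] at hz
  open ComplexOrder in exact Matrix.conjTranspose_mul_self_eq_zero.1 hz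

/-- Equivalence of irreducible representations. -/
def uirrepSetoid (G : Type*) [TopologicalSpace G] [Group G] : Setoid (UIrrep G) where
  r η ζ := ∃ V : Matrix (Fin ζ.dim) (Fin η.dim) ℂ, Intertwines η ζ V ∧ V ≠ 0
  iseqv := by
    refine ⟨fun η => ⟨1, fun x => by simp, ?_⟩, ?_, ?_⟩
    · have : Nonempty (Fin η.dim) := ⟨⟨0, η.dim_pos⟩⟩
      exact one_ne_zero
    · rintro η ζ ⟨V, hV, h0⟩
      exact ⟨Vᴴ, hV.conjTranspose, fun h => h0 (Matrix.conjTranspose_eq_zero.1 h)⟩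
    · rintro η ζ ξ ⟨V, hV, h0⟩ ⟨W, hW, h1⟩
      -- Transitivity: since $W^*W$ is a nonzero scalar, $WV=0$ would give $V=0$.
      refine ⟨W * V, hW.mul hV, fun h => h0 ?_⟩
      obtain ⟨z, hz, hWW⟩ := hW.exists_smul_one h1
      have h2 : Wᴴ * (W * V) = z • V := by rw [← Matrix.mul_assoc, hWW, Matrix.smul_mul, Matrix.one_mul]
      rw [h, Matrix.mul_zero] at h2
      exact (smul_eq_zero.1 h2.symm).resolve_left hz

end Decomposition

end LieSymbol
end

noncomputable section

namespace LieSymbol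

/-! ### The Casimir operator and Peetre's inequality for tensor products -/

section Casimir

open Matrix Kronecker

variable {E G : Type*} [NormedAddCommGroup E] [NormedSpace ℝ E] [FiniteDimensional ℝ E]
  [TopologicalSpace G] [ChartedSpace E G] [Group G] [LieGroup 𝓘(ℝ, E) ∞ G] [CompactSpace G]
  [T2Space G]

theorem lieDeriv_conjFn (X : GroupLieAlgebra 𝓘(ℝ, E) G) (f : SmoothFn E G) :
    lieDeriv X (conjFn f) = conjFn (lieDeriv X f) := by
  ext x
  have h1 := (Complex.conjCLE.toContinuousLinearMap.hasMFDerivAt (x := f x)).comp x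
    (f.mdifferentiableAt (x := x)).hasMFDerivAt
  exact congrArg (fun L => L (mulInvariantVectorField X x)) h1.mfderiv

theorem lieDeriv_one (X : GroupLieAlgebra 𝓘(ℝ, E) G) : lieDeriv X (1 : SmoothFn E G) = 0 := by
  have h := lieDeriv_mul X (1 : SmoothFn E G) 1
  rw [mul_one, mul_one, one_mul] at h
  simpa using h

/-- The derived representation of the Lie algebra. -/
def UIrrep.diff (ξ : UIrrep G) (X : GroupLieAlgebra 𝓘(ℝ, E) G) :
    Matrix (Fin ξ.dim) (Fin ξ.dim) ℂ :=
  Matrix.of fun i j => lieDeriv X (ξ.coeff E i j) 1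

/-- Differentiating $\xi(xy)=\xi(x)\xi(y)$ in $y$ at the identity gives $X\xi=\xi\,d\xi(X)$. -/
theorem lieDeriv_coeff (ξ : UIrrep G) (X : GroupLieAlgebra 𝓘(ℝ, E) G) (i j : Fin ξ.dim) :
    lieDeriv X (ξ.coeff E i j) = ∑ k, ξ.diff X k j • ξ.coeff E i k := by
  ext x
  have h : leftTransl x (ξ.coeff E i j) = ∑ k, ξ.mat x i k • ξ.coeff E k j := by
    ext y
    simp only [leftTransl_apply, UIrrep.coeff_apply, UIrrep.mat_mul, Matrix.mul_apply,
      smoothFn_sum_apply, smul_apply]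
  rw [lieDeriv_apply_eq_one, h]
  simp only [map_sum, map_smul, smoothFn_sum_apply, smul_apply, UIrrep.diff, Matrix.of_apply,
    UIrrep.coeff_apply, mul_comm]

/-- Unitarity as an identity between smooth functions, in a form that can be differentiated. -/
theorem UIrrep.sum_coeff_mul_conj (ξ : UIrrep G) (i j : Fin ξ.dim) :
    ∑ k, ξ.coeff E i k * conjFn (ξ.coeff E j k) =
      ((1 : Matrix (Fin ξ.dim) (Fin ξ.dim) ℂ) i j) • (1 : SmoothFn E G) := by
  ext x
  have h : ξ.mat x * (ξ.mat x)ᴴ = 1 := by rw [← UIrrep.mat_inv, ← UIrrep.mat_mul, mul_inv_cancel,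
    UIrrep.mat_one]
  have h2 := congrFun (congrFun h i) j
  rw [Matrix.mul_apply] at h2
  rw [smoothFn_sum_apply, smul_apply, ← h2]
  change _ = _ * (1 : ℂ)
  rw [mul_one]
  rfl

/-- The derivative of $\xi\xi^*=1$ at the identity. -/
theorem UIrrep.diff_conjTranspose (ξ : UIrrep G) (X : GroupLieAlgebra 𝓘(ℝ, E) G) :
    (ξ.diff X)ᴴ = -ξ.diff X := by
  ext i j
  have h := congrArg (fun f => lieDeriv X f 1) (ξ.sum_coeff_mul_conj (E := E) j i)
  simp only [map_sum, map_smul, lieDeriv_mul, lieDeriv_conjFn, lieDeriv_one, smul_zero,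
    smoothFn_sum_apply] at h
  have h2 : ∀ k, (lieDeriv X (ξ.coeff E j k) * conjFn (ξ.coeff E i k) +
      ξ.coeff E j k * conjFn (lieDeriv X (ξ.coeff E i k))) 1 =
      ξ.diff X j k * (1 : Matrix (Fin ξ.dim) (Fin ξ.dim) ℂ) i k +
      (1 : Matrix (Fin ξ.dim) (Fin ξ.dim) ℂ) j k * star (ξ.diff X i k) := by
    intro k
    change ξ.diff X j k * star (ξ.mat 1 i k) + ξ.mat 1 j k * star (ξ.diff X i k) = _
    rw [UIrrep.mat_one]
    simp only [Matrix.one_apply]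
    split_ifs <;> simp
  simp only [h2, Finset.sum_add_distrib, Matrix.one_apply, mul_ite, mul_one, mul_zero, ite_mul,
    one_mul, zero_mul, Finset.sum_ite_eq, Finset.mem_univ, if_true] at h
  rw [Matrix.conjTranspose_apply, Matrix.neg_apply]
  have h' : ξ.diff X j i + star (ξ.diff X i j) = 0 := h
  have := congrArg star h'
  rw [star_add, star_star, star_zero] at this
  exact eq_neg_of_add_eq_zero_left this

theorem UIrrep.diff_adjointRep (ξ : UIrrep G) (u : G) (X : GroupLieAlgebra 𝓘(ℝ, E) G) :
    ξ.diff (adjointRep u⁻¹ X) = (ξ.mat u)ᴴ * ξ.diff X * ξ.mat u := by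
  ext i j
  have h := congrArg (fun f : SmoothFn E G => f 1) (lieWord_conjTransl u [X] (ξ.coeff E i j))
  simp only [lieWord, List.map_cons, List.map_nil, List.prod_cons, List.prod_nil, mul_one,
    conjTransl_apply, inv_mul_cancel] at h
  have h1 : conjTransl u (ξ.coeff E i j) =
      ∑ k, ∑ l, (star (ξ.mat u l i) * ξ.mat u k j) • ξ.coeff E l k := by
    ext x
    simp only [smoothFn_sum_apply, smul_apply, conjTransl_apply, UIrrep.coeff_apply,
      UIrrep.mat_mul, UIrrep.mat_inv, Matrix.mul_apply, Matrix.conjTranspose_apply, Finset.sum_mul]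
    refine Finset.sum_congr rfl fun k _ => Finset.sum_congr rfl fun l _ => ?_
    ring
  rw [h1] at h
  simp only [map_sum, map_smul, smoothFn_sum_apply, smul_apply] at h
  refine h.symm.trans ?_
  simp only [Matrix.mul_apply, Matrix.conjTranspose_apply, Finset.sum_mul]
  refine Finset.sum_congr rfl fun k _ => Finset.sum_congr rfl fun l _ => ?_
  change _ * ξ.diff X l k = _
  ring

theorem UIrrep.diff_sum (ξ : UIrrep G) {κ : Type*} (s : Finset κ) (c : κ → ℝ)
    (X : κ → GroupLieAlgebra 𝓘(ℝ, E) G) :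
    ξ.diff (∑ k ∈ s, c k • X k) = ∑ k ∈ s, (c k : ℂ) • ξ.diff (X k) := by
  ext i j
  have := lieDeriv_sum_left s c X
  simp only [UIrrep.diff, Matrix.of_apply, this, Matrix.sum_apply, Matrix.smul_apply,
    LinearMap.sum_apply, LinearMap.smul_apply, smoothFn_sum_apply, smul_apply, smul_eq_mul]

variable {b : Module.Basis (Fin (Module.finrank ℝ E)) ℝ (GroupLieAlgebra 𝓘(ℝ, E) G)}

/-- Invariance of the inner product makes Ad an orthogonal matrix in the frame, and $\sum_k X_k^2$
does not change under an orthogonal change of frame. -/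
theorem casimir_adjointRep (hb : IsBiinvariantFrame b) (ξ : UIrrep G) (u : G) :
    ∑ k, ξ.diff (adjointRep u (b k)) * ξ.diff (adjointRep u (b k)) =
      ∑ k, ξ.diff (b k) * ξ.diff (b k) := by
  let R : Matrix (Fin (Module.finrank ℝ E)) (Fin (Module.finrank ℝ E)) ℝ :=
    Matrix.of fun j k => b.repr (adjointRep u (b k)) j
  have hR : Rᵀ * R = 1 := by
    ext k l
    have := hb u (b k) (b l)
    simp only [Matrix.mul_apply, Matrix.transpose_apply, R, Matrix.of_apply, this,
      Module.Basis.repr_self, Matrix.one_apply, Finsupp.single_apply]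
    simp
  have hR' : R * Rᵀ = 1 := mul_eq_one_comm.1 hR
  have h1 : ∀ k, ξ.diff (adjointRep u (b k)) = ∑ j, (R j k : ℂ) • ξ.diff (b j) := fun k => by
    rw [← UIrrep.diff_sum]
    congr 1
    exact (b.sum_repr _).symm
  have h2 : ∀ k, ξ.diff (adjointRep u (b k)) * ξ.diff (adjointRep u (b k)) =
      ∑ i, ∑ j, ((R i k * R j k : ℝ) : ℂ) • (ξ.diff (b i) * ξ.diff (b j)) := fun k => by
    rw [h1, Finset.sum_mul]
    refine Finset.sum_congr rfl fun i _ => ?_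
    rw [Finset.mul_sum]
    refine Finset.sum_congr rfl fun j _ => ?_
    rw [smul_mul_smul_comm]
    push_cast
    rfl
  simp only [h2]
  rw [Finset.sum_comm]
  refine Finset.sum_congr rfl fun i _ => ?_
  rw [Finset.sum_comm]
  have h3 : ∀ j, ∑ k, R i k * R j k = (1 : Matrix _ _ ℝ) i j := fun j => by
    rw [← hR', Matrix.mul_apply]; rfl
  simp only [← Finset.sum_smul, ← Complex.ofReal_sum, h3, Matrix.one_apply]
  rw [Finset.sum_eq_single i]
  · simp
  · intro j _ hj
    simp [Ne.symm hj]
  · simp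

theorem laplacian_coeff (ξ : UIrrep G) (i j : Fin ξ.dim) :
    laplacian b (ξ.coeff E i j) =
      ∑ l, (∑ k, ξ.diff (b k) * ξ.diff (b k)) l j • ξ.coeff E i l := by
  have h : ∀ k, (lieDeriv (b k) * lieDeriv (b k) : Module.End ℂ (SmoothFn E G)) (ξ.coeff E i j) =
      ∑ l, (ξ.diff (b k) * ξ.diff (b k)) l j • ξ.coeff E i l := by
    intro k
    rw [Module.End.mul_apply, lieDeriv_coeff]
    simp only [map_sum, map_smul, lieDeriv_coeff, Matrix.mul_apply, Finset.smul_sum,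
      Finset.sum_smul, smul_smul]
    rw [Finset.sum_comm]
    exact Finset.sum_congr rfl fun _ _ => Finset.sum_congr rfl fun _ _ => by rw [mul_comm]
  simp only [laplacian, LinearMap.sum_apply, pow_two, h, Matrix.sum_apply, Finset.sum_smul]
  exact Finset.sum_comm

/-- The Casimir element acts by the scalar `-λ_ξ²`. -/
theorem casimir_eq (hb : IsBiinvariantFrame b) (ξ : UIrrep G) :
    0 ≤ lambdaSq b ξ ∧ ∑ k, ξ.diff (b k) * ξ.diff (b k) =
      (-(lambdaSq b ξ : ℂ)) • (1 : Matrix (Fin ξ.dim) (Fin ξ.dim) ℂ) := by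
  -- The Ad-invariance of the Casimir operator says that it commutes with $\xi(x)$, so it is a
  -- scalar by Schur's lemma.
  obtain ⟨z, hz⟩ := ξ.exists_eq_smul_one (∑ k, ξ.diff (b k) * ξ.diff (b k)) (fun x => by
    have h1 : (ξ.mat x)ᴴ * (∑ k, ξ.diff (b k) * ξ.diff (b k)) * ξ.mat x =
        ∑ k, ξ.diff (b k) * ξ.diff (b k) := by
      refine Eq.trans ?_ (casimir_adjointRep hb ξ x⁻¹)
      rw [Matrix.mul_sum, Matrix.sum_mul]
      refine Finset.sum_congr rfl fun k _ => ?_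
      rw [UIrrep.diff_adjointRep]
      have h2 : ξ.mat x * (ξ.mat x)ᴴ = 1 := by
        rw [← UIrrep.mat_inv, ← UIrrep.mat_mul, mul_inv_cancel, UIrrep.mat_one]
      calc _ = (ξ.mat x)ᴴ * ξ.diff (b k) * 1 * ξ.diff (b k) * ξ.mat x := by
            simp only [Matrix.mul_assoc, Matrix.one_mul]
        _ = _ := by rw [← h2]; simp only [Matrix.mul_assoc]
    have h2 : ξ.mat x * (ξ.mat x)ᴴ = 1 := by
      rw [← UIrrep.mat_inv, ← UIrrep.mat_mul, mul_inv_cancel, UIrrep.mat_one]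
    conv_lhs => rw [← h1]
    rw [← Matrix.mul_assoc, ← Matrix.mul_assoc, h2, Matrix.one_mul])
  let i₀ : Fin ξ.dim := ⟨0, ξ.dim_pos⟩
  -- The scalar is read off the first diagonal entry. As the derived matrices are skew-Hermitian it
  -- equals minus a sum of squares, hence is real and at most zero.
  let c : ℝ := ∑ k, ∑ j, Complex.normSq (ξ.diff (b k) i₀ j)
  have hc : 0 ≤ c := Finset.sum_nonneg fun k _ => Finset.sum_nonneg fun j _ => Complex.normSq_nonneg _
  have hzc : z = -(c : ℂ) := by
    have h1 := congrFun (congrFun hz i₀) i₀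
    rw [Matrix.smul_apply, Matrix.one_apply_eq, smul_eq_mul, mul_one] at h1
    rw [← h1, Matrix.sum_apply]
    simp only [c, Complex.ofReal_sum, Matrix.mul_apply, ← Finset.sum_neg_distrib]
    refine Finset.sum_congr rfl fun k _ => Finset.sum_congr rfl fun j _ => ?_
    have h2 := congrFun (congrFun (ξ.diff_conjTranspose (b k)) j) i₀
    rw [Matrix.conjTranspose_apply, Matrix.neg_apply] at h2
    have h3 : ξ.diff (b k) j i₀ = -star (ξ.diff (b k) i₀ j) := by rw [h2, neg_neg]
    rw [h3, mul_neg, Complex.normSq_eq_conj_mul_self, mul_comm]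
    rfl
  have hL : ∀ i j, laplacian b (ξ.coeff E i j) = -(c : ℂ) • ξ.coeff E i j := by
    intro i j
    rw [laplacian_coeff, hz, hzc]
    simp [Matrix.one_apply]
  -- The infimum in `lambdaSq` is over a single number: evaluating a diagonal coefficient at the
  -- identity, where it is 1, determines the eigenvalue.
  have hset : {c : ℝ | ∀ i j, laplacian b (ξ.coeff E i j) = -(c : ℂ) • ξ.coeff E i j} = {c} := by
    ext c'
    refine ⟨fun h => ?_, fun h => by rw [mem_singleton_iff.1 h]; exact hL⟩
    have h1 := congrArg (fun f : SmoothFn E G => f 1) ((h i₀ i₀).symm.trans (hL i₀ i₀))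
    simp only [smul_apply, UIrrep.coeff_apply, UIrrep.mat_one, Matrix.one_apply_eq, mul_one,
      neg_inj, Complex.ofReal_inj] at h1
    exact h1
  have hl : lambdaSq b ξ = c := by rw [lambdaSq, hset, csInf_singleton]
  rw [hl, hz, hzc]
  exact ⟨hc, rfl⟩

theorem one_le_japanese (hb : IsBiinvariantFrame b) (ξ : UIrrep G) : 1 ≤ japanese b ξ := by
  rw [japanese, Real.one_le_sqrt]
  linarith [(casimir_eq hb ξ).1]

theorem japanese_pos (hb : IsBiinvariantFrame b) (ξ : UIrrep G) : 0 < japanese b ξ :=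
  zero_lt_one.trans_le (one_le_japanese hb ξ)

/-- For a skew operator, $\|Aw\|^2=-\langle w,A^2w\rangle$. -/
theorem sum_norm_sq_of_skew {H κ : Type*} [NormedAddCommGroup H] [InnerProductSpace ℂ H]
    [CompleteSpace H] [Fintype κ] {A : κ → H →L[ℂ] H} (hA : ∀ k, star (A k) = -A k) {w : H} {c : ℝ}
    (h : ∑ k, A k (A k w) = (-(c : ℂ)) • w) : ∑ k, ‖A k w‖ ^ 2 = c * ‖w‖ ^ 2 := by
  have h1 : ∀ k, ((‖A k w‖ ^ 2 : ℝ) : ℂ) = -inner ℂ w (A k (A k w)) := by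
    intro k
    have h2 := ContinuousLinearMap.adjoint_inner_right (A k) w (A k w)
    rw [← ContinuousLinearMap.star_eq_adjoint, hA, _root_.neg_apply, inner_neg_right,
      inner_self_eq_norm_sq_to_K] at h2
    rw [h2]
    push_cast
    rfl
  have h3 : ((∑ k, ‖A k w‖ ^ 2 : ℝ) : ℂ) = ((c * ‖w‖ ^ 2 : ℝ) : ℂ) := by
    rw [Complex.ofReal_sum, Finset.sum_congr rfl fun k _ => h1 k, Finset.sum_neg_distrib,
      ← inner_sum, h, inner_smul_right, inner_self_eq_norm_sq_to_K]
    push_cast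
    simp
  exact_mod_cast h3

/-- Minkowski's inequality in the $\ell^2$ sum of copies of $H$, with the common factor $\|w\|$
cancelled. -/
theorem sqrt_le_add_of_skew {H κ : Type*} [NormedAddCommGroup H] [InnerProductSpace ℂ H]
    [Fintype κ] {x y z : κ → H} {w : H} (hw : w ≠ 0) {α β γ : ℝ} (hz : ∀ k, z k = x k + y k)
    (hx : ∑ k, ‖x k‖ ^ 2 = α * ‖w‖ ^ 2) (hy : ∑ k, ‖y k‖ ^ 2 = β * ‖w‖ ^ 2)
    (hzz : ∑ k, ‖z k‖ ^ 2 = γ * ‖w‖ ^ 2) : √γ ≤ √α + √β := by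
  have hn : ∀ (v : κ → H) (c : ℝ), ∑ k, ‖v k‖ ^ 2 = c * ‖w‖ ^ 2 →
      ‖(WithLp.toLp 2 v : PiLp 2 fun _ : κ => H)‖ = √c * ‖w‖ := by
    intro v c h
    rw [PiLp.norm_eq_of_L2]
    simp only [h]
    rw [Real.sqrt_mul' _ (sq_nonneg _), Real.sqrt_sq (norm_nonneg _)]
  have h1 : (WithLp.toLp 2 z : PiLp 2 fun _ : κ => H) = WithLp.toLp 2 x + WithLp.toLp 2 y := by
    ext k
    simp [hz]
  have h2 := norm_add_le (WithLp.toLp 2 x : PiLp 2 fun _ : κ => H) (WithLp.toLp 2 y)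
  rw [← h1, hn z γ hzz, hn x α hx, hn y β hy, ← add_mul] at h2
  exact le_of_mul_le_mul_right h2 (norm_pos_iff.2 hw)

/-- The operator norm bounds the derived representation by `λ_ξ`. -/
theorem sum_norm_diff_sq (hb : IsBiinvariantFrame b) (ξ : UIrrep G)
    (v : EuclideanSpace ℂ (Fin ξ.dim)) :
    ∑ k, ‖Matrix.toEuclideanCLM (𝕜 := ℂ) (ξ.diff (b k)) v‖ ^ 2 = lambdaSq b ξ * ‖v‖ ^ 2 := by
  refine sum_norm_sq_of_skew (A := fun k => Matrix.toEuclideanCLM (𝕜 := ℂ) (ξ.diff (b k)))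
    (fun k => ?_) ?_
  · rw [← map_star, Matrix.star_eq_conjTranspose, UIrrep.diff_conjTranspose, map_neg]
  · have h := congrArg (fun M => Matrix.toEuclideanCLM (𝕜 := ℂ) M v) (casimir_eq hb ξ).2
    simp only [map_sum, map_mul, map_smul, map_one, _root_.sum_apply] at h
    exact h

/-- The tensor product representation. -/
def tensorRep (η ξ : UIrrep G) :
    G →* Matrix.unitaryGroup (Fin η.dim × Fin ξ.dim) ℂ where
  toFun x := ⟨η.mat x ⊗ₖ ξ.mat x, Matrix.kronecker_mem_unitary (η.toHom x).2 (ξ.toHom x).2⟩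
  map_one' := Subtype.ext (by
    change η.mat 1 ⊗ₖ ξ.mat 1 = 1
    rw [UIrrep.mat_one, UIrrep.mat_one, Matrix.one_kronecker_one])
  map_mul' x y := Subtype.ext (by
    change η.mat (x * y) ⊗ₖ ξ.mat (x * y) = (η.mat x ⊗ₖ ξ.mat x) * (η.mat y ⊗ₖ ξ.mat y)
    rw [UIrrep.mat_mul, UIrrep.mat_mul, Matrix.mul_kronecker_mul])

theorem UIrrep.continuous_mat (ξ : UIrrep G) : Continuous ξ.mat :=
  continuous_subtype_val.comp ξ.continuous_toHom

theorem continuous_tensorRep (η ξ : UIrrep G) : Continuous (tensorRep η ξ) := by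
  refine Continuous.subtype_mk ?_ _
  refine continuous_matrix fun p q => ?_
  exact (η.continuous_mat.matrix_elem _ _).mul (ξ.continuous_mat.matrix_elem _ _)

/-- The intertwining relation differentiated at the identity; the Leibniz rule produces the two
terms. -/
theorem diff_tensor_intertwines (η ξ ζ : UIrrep G)
    {W : Matrix (Fin η.dim × Fin ξ.dim) (Fin ζ.dim) ℂ}
    (hW : ∀ x, (η.mat x ⊗ₖ ξ.mat x) * W = W * ζ.mat x) (X : GroupLieAlgebra 𝓘(ℝ, E) G) :
    (η.diff X ⊗ₖ 1 + 1 ⊗ₖ ξ.diff X) * W = W * ζ.diff X := by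
  ext ⟨a, i⟩ e
  have h : ∑ p : Fin η.dim × Fin ξ.dim, W p e • (η.coeff E a p.1 * ξ.coeff E i p.2) =
      ∑ c, W (a, i) c • ζ.coeff E c e := by
    ext x
    have h1 := congrFun (congrFun (hW x) (a, i)) e
    simp only [Matrix.mul_apply, Matrix.kroneckerMap_apply] at h1
    simp only [smoothFn_sum_apply, smul_apply]
    refine Eq.trans ?_ h1
    exact Finset.sum_congr rfl fun p _ => mul_comm _ _
  have h2 := congrArg (fun f => lieDeriv X f 1) h
  simp only [map_sum, map_smul, lieDeriv_mul, smoothFn_sum_apply, smul_apply] at h2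
  simp only [Matrix.mul_apply]
  refine Eq.trans (Finset.sum_congr rfl fun p _ => ?_) h2
  change _ = W p e * (η.diff X a p.1 * ξ.mat 1 i p.2 + η.mat 1 a p.1 * ξ.diff X i p.2)
  rw [UIrrep.mat_one, UIrrep.mat_one, Matrix.add_apply, Matrix.kroneckerMap_apply,
    Matrix.kroneckerMap_apply, mul_comm]

/-- A nonzero column $w$ of $W$ lies in a copy of $\zeta$ inside $\eta\otimes\xi$. The Casimir sums
of $d\eta\otimes1$, of $1\otimes d\xi$ and of their sum all act on $w$ by scalars, so each family
has a known $\ell^2$ norm at $w$ and Minkowski applies. Writing $B=(A+B)-A$ gives the second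
inequality, which negative orders require. -/
theorem sqrt_lambdaSq_triangle (hb : IsBiinvariantFrame b) (η ξ ζ : UIrrep G)
    {W : Matrix (Fin η.dim × Fin ξ.dim) (Fin ζ.dim) ℂ}
    (hW : ∀ x, (η.mat x ⊗ₖ ξ.mat x) * W = W * ζ.mat x) (h0 : W ≠ 0) :
    √(lambdaSq b ζ) ≤ √(lambdaSq b η) + √(lambdaSq b ξ) ∧
      √(lambdaSq b ξ) ≤ √(lambdaSq b η) + √(lambdaSq b ζ) := by
  let e := Matrix.toEuclideanCLM (𝕜 := ℂ) (n := Fin η.dim × Fin ξ.dim)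
  obtain ⟨c, hc⟩ : ∃ c, W.col c ≠ 0 := by
    by_contra h
    push Not at h
    exact h0 (Matrix.ext fun p c => congrFun (h c) p)
  let w : EuclideanSpace ℂ (Fin η.dim × Fin ξ.dim) := WithLp.toLp 2 (W.col c)
  have hw : w ≠ 0 := fun h => hc ((WithLp.toLp_eq_zero 2).1 h)
  let A := fun k => η.diff (b k) ⊗ₖ (1 : Matrix (Fin ξ.dim) (Fin ξ.dim) ℂ)
  let B := fun k => (1 : Matrix (Fin η.dim) (Fin η.dim) ℂ) ⊗ₖ ξ.diff (b k)
  have hA : ∀ k, star (A k) = -A k := fun k => by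
    rw [Matrix.star_eq_conjTranspose, Matrix.conjTranspose_kronecker, UIrrep.diff_conjTranspose,
      Matrix.conjTranspose_one]
    ext p q
    simp [A]
  have hB : ∀ k, star (B k) = -B k := fun k => by
    rw [Matrix.star_eq_conjTranspose, Matrix.conjTranspose_kronecker, UIrrep.diff_conjTranspose,
      Matrix.conjTranspose_one]
    ext p q
    simp [B]
  have hAA : ∑ k, A k * A k = (-(lambdaSq b η : ℂ)) • 1 := by
    simp only [A, ← Matrix.mul_kronecker_mul, Matrix.mul_one]
    ext ⟨p, p'⟩ ⟨q, q'⟩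
    have := congrFun (congrFun (casimir_eq hb η).2 p) q
    rw [Matrix.sum_apply] at this
    simp only [Matrix.sum_apply, Matrix.kroneckerMap_apply, ← Finset.sum_mul, this,
      ← Matrix.one_kronecker_one, Matrix.smul_apply, smul_eq_mul, mul_assoc]
  have hBB : ∑ k, B k * B k = (-(lambdaSq b ξ : ℂ)) • 1 := by
    simp only [B, ← Matrix.mul_kronecker_mul, Matrix.mul_one]
    ext ⟨p, p'⟩ ⟨q, q'⟩
    have := congrFun (congrFun (casimir_eq hb ξ).2 p') q'
    rw [Matrix.sum_apply] at this
    simp only [Matrix.sum_apply, Matrix.kroneckerMap_apply, ← Finset.mul_sum, this,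
      ← Matrix.one_kronecker_one, Matrix.smul_apply, smul_eq_mul]
    ring
  have hCC : ∑ k, (A k + B k) * ((A k + B k) * W) = (-(lambdaSq b ζ : ℂ)) • W := by
    have h1 : ∀ k, (A k + B k) * ((A k + B k) * W) = W * (ζ.diff (b k) * ζ.diff (b k)) := by
      intro k
      rw [diff_tensor_intertwines η ξ ζ hW, ← Matrix.mul_assoc, diff_tensor_intertwines η ξ ζ hW,
        Matrix.mul_assoc]
    rw [Finset.sum_congr rfl fun k _ => h1 k, ← Matrix.mul_sum, (casimir_eq hb ζ).2,
      Matrix.mul_smul, Matrix.mul_one]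
  have sA : ∑ k, ‖e (A k) w‖ ^ 2 = lambdaSq b η * ‖w‖ ^ 2 := by
    refine sum_norm_sq_of_skew (A := fun k => e (A k)) (fun k => by rw [← map_star, hA, map_neg]) ?_
    have h := congrArg (fun M => e M w) hAA
    simp only [map_sum, map_mul, map_smul, map_one, _root_.sum_apply] at h
    exact h
  have sB : ∑ k, ‖e (B k) w‖ ^ 2 = lambdaSq b ξ * ‖w‖ ^ 2 := by
    refine sum_norm_sq_of_skew (A := fun k => e (B k)) (fun k => by rw [← map_star, hB, map_neg]) ?_
    have h := congrArg (fun M => e M w) hBB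
    simp only [map_sum, map_mul, map_smul, map_one, _root_.sum_apply] at h
    exact h
  have sC : ∑ k, ‖e (A k + B k) w‖ ^ 2 = lambdaSq b ζ * ‖w‖ ^ 2 := by
    refine sum_norm_sq_of_skew (A := fun k => e (A k + B k))
      (fun k => by rw [← map_star, star_add, hA, hB, ← neg_add, map_neg]) ?_
    have h := congrArg (fun M : Matrix _ _ ℂ => WithLp.toLp 2 (M.col c)) hCC
    have h1 : ∀ k, e (A k + B k) (e (A k + B k) w) =
        WithLp.toLp 2 (((A k + B k) * ((A k + B k) * W)).col c) := by
      intro k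
      rfl
    rw [Finset.sum_congr rfl fun k _ => h1 k]
    refine Eq.trans ?_ h
    rw [← WithLp.toLp_sum]
    congr 1
    ext p
    simp [Matrix.sum_apply]
  have sB' : ∑ k, ‖-e (B k) w‖ ^ 2 = lambdaSq b ξ * ‖w‖ ^ 2 := by simpa using sB
  refine ⟨sqrt_le_add_of_skew hw (fun k => ?_) sA sB sC, ?_⟩
  · rw [map_add]; rfl
  · rw [add_comm]
    refine sqrt_le_add_of_skew (x := fun k => e (A k + B k) w) (y := fun k => -e (A k) w)
      (z := fun k => e (B k) w) hw (fun k => ?_) sC (by simpa using sA) sB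
    rw [map_add]
    change _ = e (A k) w + e (B k) w + -e (A k) w
    abel

theorem japanese_le_of_sqrt_le {η ξ ζ : UIrrep G} (hη : 0 ≤ lambdaSq b η) (hξ : 0 ≤ lambdaSq b ξ)
    (hζ : 0 ≤ lambdaSq b ζ) (h : √(lambdaSq b ζ) ≤ √(lambdaSq b η) + √(lambdaSq b ξ)) :
    japanese b ζ ≤ 2 * japanese b η * japanese b ξ := by
  rw [japanese, Real.sqrt_le_iff]
  refine ⟨by rw [japanese, japanese]; positivity, ?_⟩
  rw [mul_pow, mul_pow, japanese, japanese, Real.sq_sqrt (by positivity),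
    Real.sq_sqrt (by positivity)]
  have h1 : lambdaSq b ζ ≤ (√(lambdaSq b η) + √(lambdaSq b ξ)) ^ 2 := by
    rw [← Real.sq_sqrt hζ]
    exact pow_le_pow_left₀ (Real.sqrt_nonneg _) h 2
  -- The factor 2 comes from $1+(\alpha+\beta)^2\le1+2\alpha^2+2\beta^2\le4(1+\alpha^2)(1+\beta^2)$.
  nlinarith [sq_nonneg (√(lambdaSq b η) - √(lambdaSq b ξ)), Real.sq_sqrt hη, Real.sq_sqrt hξ,
    mul_nonneg hη hξ]

/-- Peetre's inequality for the constituents of a tensor product. -/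
theorem japanese_rpow_le (hb : IsBiinvariantFrame b) (η ξ ζ : UIrrep G)
    {W : Matrix (Fin η.dim × Fin ξ.dim) (Fin ζ.dim) ℂ}
    (hW : ∀ x, (η.mat x ⊗ₖ ξ.mat x) * W = W * ζ.mat x) (h0 : W ≠ 0) (s : ℝ) :
    japanese b ζ ^ s ≤ (2 * japanese b η) ^ |s| * japanese b ξ ^ s := by
  have hη := japanese_pos hb η
  have hξ := japanese_pos hb ξ
  have hζ := japanese_pos hb ζ
  obtain ⟨h1, h2⟩ := sqrt_lambdaSq_triangle hb η ξ ζ hW h0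
  rcases le_total 0 s with hs | hs
  · rw [abs_of_nonneg hs, ← Real.mul_rpow (by positivity) hξ.le]
    exact Real.rpow_le_rpow hζ.le (japanese_le_of_sqrt_le (casimir_eq hb η).1 (casimir_eq hb ξ).1
      (casimir_eq hb ζ).1 h1) hs
  -- A negative exponent reverses inequalities, so here $\langle\xi\rangle$ is bounded by
  -- $2\langle\eta\rangle\langle\zeta\rangle$.
  · rw [abs_of_nonpos hs]
    have h3 := japanese_le_of_sqrt_le (casimir_eq hb η).1 (casimir_eq hb ζ).1
      (casimir_eq hb ξ).1 h2
    have h4 := Real.rpow_le_rpow hξ.le h3 (neg_nonneg.2 hs)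
    rw [Real.mul_rpow (by positivity) hζ.le, Real.rpow_neg hξ.le, Real.rpow_neg hζ.le] at h4
    have p1 : 0 < japanese b ξ ^ s := Real.rpow_pos_of_pos hξ s
    have p2 : 0 < japanese b ζ ^ s := Real.rpow_pos_of_pos hζ s
    have h5 := mul_le_mul_of_nonneg_right h4 (mul_pos p1 p2).le
    have e1 : (japanese b ξ ^ s)⁻¹ * (japanese b ξ ^ s * japanese b ζ ^ s) = japanese b ζ ^ s := by
      field_simp
    have e2 : (2 * japanese b η) ^ (-s) * (japanese b ζ ^ s)⁻¹ *
        (japanese b ξ ^ s * japanese b ζ ^ s) = (2 * japanese b η) ^ (-s) * japanese b ξ ^ s := by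
      field_simp
    rwa [e1, e2] at h5

end Casimir

end LieSymbol
end

noncomputable section

namespace LieSymbol

/-! ### Operator norms through matrix elements -/

section Norms

open Matrix

theorem norm_star_dotProduct_mulVec_le {d : ℕ} (M : Matrix (Fin d) (Fin d) ℂ) (w v : Fin d → ℂ) :
    ‖star w ⬝ᵥ M *ᵥ v‖ ≤
      opNorm M * ‖(WithLp.toLp 2 w : EuclideanSpace ℂ (Fin d))‖ *
        ‖(WithLp.toLp 2 v : EuclideanSpace ℂ (Fin d))‖ := by
  have h1 : star w ⬝ᵥ M *ᵥ v = inner ℂ (WithLp.toLp 2 w : EuclideanSpace ℂ (Fin d))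
      (Matrix.toEuclideanCLM (𝕜 := ℂ) M (WithLp.toLp 2 v)) := by
    rw [EuclideanSpace.inner_eq_star_dotProduct, dotProduct_comm]
    rfl
  rw [h1]
  refine (norm_inner_le_norm _ _).trans ?_
  have := (Matrix.toEuclideanCLM (𝕜 := ℂ) M).le_opNorm (WithLp.toLp 2 v)
  calc _ ≤ ‖(WithLp.toLp 2 w : EuclideanSpace ℂ (Fin d))‖ * _ :=
        mul_le_mul_of_nonneg_left this (norm_nonneg _)
    _ = _ := by rw [opNorm]; ring

/-- Testing with $w=Mv$ suffices. The weak form is convenient for blocks of a larger matrix and for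
passing to limits. -/
theorem opNorm_le_of_forall {d : ℕ} {M : Matrix (Fin d) (Fin d) ℂ} {B : ℝ} (hB : 0 ≤ B)
    (h : ∀ w v : Fin d → ℂ, ‖star w ⬝ᵥ M *ᵥ v‖ ≤
      B * ‖(WithLp.toLp 2 w : EuclideanSpace ℂ (Fin d))‖ *
        ‖(WithLp.toLp 2 v : EuclideanSpace ℂ (Fin d))‖) : opNorm M ≤ B := by
  refine ContinuousLinearMap.opNorm_le_bound _ hB fun v => ?_
  have h2 := h (M *ᵥ v.ofLp) v.ofLp
  have h3 : star (M *ᵥ v.ofLp) ⬝ᵥ M *ᵥ v.ofLp =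
      ((‖Matrix.toEuclideanCLM (𝕜 := ℂ) M v‖ ^ 2 : ℝ) : ℂ) := by
    have := inner_self_eq_norm_sq_to_K (𝕜 := ℂ) (Matrix.toEuclideanCLM (𝕜 := ℂ) M v)
    rw [EuclideanSpace.inner_eq_star_dotProduct, dotProduct_comm] at this
    push_cast
    exact this
  rw [h3, Complex.norm_real, Real.norm_of_nonneg (by positivity)] at h2
  change ‖Matrix.toEuclideanCLM (𝕜 := ℂ) M v‖ ^ 2 ≤ B * ‖Matrix.toEuclideanCLM (𝕜 := ℂ) M v‖ *
    ‖v‖ at h2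
  rcases (norm_nonneg (Matrix.toEuclideanCLM (𝕜 := ℂ) M v)).eq_or_lt with h0 | h0
  · rw [← h0]; positivity
  · refine le_of_mul_le_mul_right ?_ h0
    nlinarith

theorem norm_apply_le_opNorm {d : ℕ} (M : Matrix (Fin d) (Fin d) ℂ) (i j : Fin d) :
    ‖M i j‖ ≤ opNorm M := by
  have h := norm_star_dotProduct_mulVec_le M (Pi.single i 1) (Pi.single j 1)
  have h1 : star (Pi.single i 1 : Fin d → ℂ) = Pi.single i 1 := by
    rw [← Pi.single_star, star_one]
  rw [h1] at h
  simpa using h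

/-- A resolution of the identity controls the norm of a block sum. -/
theorem norm_sum_conj_le {ι κ : Type*} [Fintype ι] [DecidableEq ι] [Fintype κ] {d : κ → ℕ}
    {V : ∀ k, Matrix ι (Fin (d k)) ℂ} (hV : ∑ k, V k * (V k)ᴴ = 1)
    {M : ∀ k, Matrix (Fin (d k)) (Fin (d k)) ℂ} {B : ℝ} (hM : ∀ k, V k ≠ 0 → opNorm (M k) ≤ B)
    (hB : 0 ≤ B) (w v : ι → ℂ) :
    ‖star w ⬝ᵥ (∑ k, V k * M k * (V k)ᴴ) *ᵥ v‖ ≤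
      B * ‖(WithLp.toLp 2 w : EuclideanSpace ℂ ι)‖ * ‖(WithLp.toLp 2 v : EuclideanSpace ℂ ι)‖ := by
  -- Parseval's identity for the resolution of the identity.
  have hsum : ∀ u : ι → ℂ, ∑ k, ‖(WithLp.toLp 2 ((V k)ᴴ *ᵥ u) : EuclideanSpace ℂ (Fin (d k)))‖ ^ 2 =
      ‖(WithLp.toLp 2 u : EuclideanSpace ℂ ι)‖ ^ 2 := by
    intro u
    have h1 : ∀ {κ : Type _} [Fintype κ] (z : κ → ℂ),
        ((‖(WithLp.toLp 2 z : EuclideanSpace ℂ κ)‖ ^ 2 : ℝ) : ℂ) = star z ⬝ᵥ z := by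
      intro κ _ z
      have := inner_self_eq_norm_sq_to_K (𝕜 := ℂ) (WithLp.toLp 2 z : EuclideanSpace ℂ κ)
      rw [EuclideanSpace.inner_eq_star_dotProduct, dotProduct_comm] at this
      push_cast
      exact this.symm
    have h1' : ((‖(WithLp.toLp 2 u : EuclideanSpace ℂ ι)‖ ^ 2 : ℝ) : ℂ) = star u ⬝ᵥ u := by
      have := inner_self_eq_norm_sq_to_K (𝕜 := ℂ) (WithLp.toLp 2 u : EuclideanSpace ℂ ι)
      rw [EuclideanSpace.inner_eq_star_dotProduct, dotProduct_comm] at this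
      push_cast
      exact this.symm
    have h2 : ((∑ k, ‖(WithLp.toLp 2 ((V k)ᴴ *ᵥ u) : EuclideanSpace ℂ (Fin (d k)))‖ ^ 2 : ℝ) : ℂ) =
        ((‖(WithLp.toLp 2 u : EuclideanSpace ℂ ι)‖ ^ 2 : ℝ) : ℂ) := by
      rw [Complex.ofReal_sum, h1']
      calc _ = ∑ k, star u ⬝ᵥ (V k * (V k)ᴴ) *ᵥ u := by
            refine Finset.sum_congr rfl fun k _ => ?_
            rw [h1, Matrix.star_mulVec, Matrix.conjTranspose_conjTranspose,
              ← Matrix.dotProduct_mulVec, Matrix.mulVec_mulVec]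
        _ = star u ⬝ᵥ (∑ k, V k * (V k)ᴴ) *ᵥ u := by
            rw [Matrix.sum_mulVec, dotProduct_sum]
        _ = _ := by rw [hV, Matrix.one_mulVec]
    exact_mod_cast h2
  have e1 : star w ⬝ᵥ (∑ k, V k * M k * (V k)ᴴ) *ᵥ v =
      ∑ k, star ((V k)ᴴ *ᵥ w) ⬝ᵥ M k *ᵥ ((V k)ᴴ *ᵥ v) := by
    rw [Matrix.sum_mulVec, dotProduct_sum]
    refine Finset.sum_congr rfl fun k _ => ?_
    rw [Matrix.star_mulVec, Matrix.conjTranspose_conjTranspose, ← Matrix.dotProduct_mulVec,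
      Matrix.mulVec_mulVec, Matrix.mulVec_mulVec, Matrix.mul_assoc]
  rw [e1]
  refine (norm_sum_le _ _).trans ?_
  have e2 : ∀ k, ‖star ((V k)ᴴ *ᵥ w) ⬝ᵥ M k *ᵥ ((V k)ᴴ *ᵥ v)‖ ≤
      B * (‖(WithLp.toLp 2 ((V k)ᴴ *ᵥ w) : EuclideanSpace ℂ (Fin (d k)))‖ *
        ‖(WithLp.toLp 2 ((V k)ᴴ *ᵥ v) : EuclideanSpace ℂ (Fin (d k)))‖) := by
    intro k
    -- Zero blocks contribute nothing. A bound is available for the others only, since Peetre's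
    -- inequality needs a nonzero intertwiner.
    by_cases h0 : V k = 0
    · simp [h0]
    · refine (norm_star_dotProduct_mulVec_le _ _ _).trans ?_
      rw [mul_assoc]
      exact mul_le_mul_of_nonneg_right (hM k h0) (by positivity)
  refine (Finset.sum_le_sum fun k _ => e2 k).trans ?_
  rw [← Finset.mul_sum, mul_assoc]
  refine mul_le_mul_of_nonneg_left ?_ hB
  refine le_of_sq_le_sq ?_ (by positivity)
  rw [mul_pow, ← hsum, ← hsum]
  exact Finset.sum_mul_sq_le_sq_mul_sq _ _ _

end Norms

/-! ### Multiplication by one matrix coefficient -/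

section Multiplication

open Matrix Kronecker

variable {E G : Type*} [NormedAddCommGroup E] [NormedSpace ℝ E] [FiniteDimensional ℝ E]
  [TopologicalSpace G] [ChartedSpace E G] [Group G] [LieGroup 𝓘(ℝ, E) ∞ G] [CompactSpace G]
  [T2Space G]

variable {b : Module.Basis (Fin (Module.finrank ℝ E)) ℝ (GroupLieAlgebra 𝓘(ℝ, E) G)}

/-- Multiplication by a conjugate matrix coefficient preserves bounds on the Fourier transform. -/
theorem opNorm_fourier_mul_coeff_le (hb : IsBiinvariantFrame b) {T : Distrib E G} {C s : ℝ}
    (hC : 0 ≤ C) (hT : ∀ ζ, opNorm (fourier T ζ) ≤ C * japanese b ζ ^ s) (η : UIrrep G)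
    (p q : Fin η.dim) (ξ : UIrrep G) :
    opNorm (fourier (mulDistrib (conjFn (η.coeff E p q)) T) ξ) ≤
      C * (2 * japanese b η) ^ |s| * japanese b ξ ^ s := by
  obtain ⟨κ, _, ζ, V, hV, hsum⟩ := exists_decomposition _ (tensorRep η ξ)
    (continuous_tensorRep η ξ) rfl
  have hη := japanese_pos hb η
  have hξ := japanese_pos hb ξ
  -- The Fourier transform of `T` at the reducible representation $\eta\otimes\xi$.
  let N : Matrix (Fin η.dim × Fin ξ.dim) (Fin η.dim × Fin ξ.dim) ℂ :=
    ∑ k, V k * fourier T (ζ k) * (V k)ᴴ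
  -- A product of coefficients of $\eta$ and $\xi$ is a coefficient of $\eta\otimes\xi$, hence a
  -- combination of coefficients of the constituents.
  have hcoeff : ∀ (p q : Fin η.dim) (i j : Fin ξ.dim),
      conjFn (η.coeff E p q) * conjFn (ξ.coeff E j i) =
        ∑ k, ∑ c, ∑ e, (V k (q, i) e * star (V k (p, j) c)) • conjFn ((ζ k).coeff E c e) := by
    intro p q i j
    ext x
    have h1 : η.mat x ⊗ₖ ξ.mat x = ∑ k, V k * (ζ k).mat x * (V k)ᴴ := by
      have h2 : (η.mat x ⊗ₖ ξ.mat x) * (∑ k, V k * (V k)ᴴ) = ∑ k, V k * (ζ k).mat x * (V k)ᴴ := by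
        rw [Matrix.mul_sum]
        refine Finset.sum_congr rfl fun k _ => ?_
        rw [← Matrix.mul_assoc, ← hV k x]
        rfl
      rwa [hsum, Matrix.mul_one] at h2
    have h3 := congrArg star (congrFun (congrFun h1 (p, j)) (q, i))
    rw [Matrix.kroneckerMap_apply, star_mul', Matrix.sum_apply, star_sum] at h3
    simp only [smoothFn_sum_apply, smul_apply, conjFn_apply, UIrrep.coeff_apply]
    refine Eq.trans h3 (Finset.sum_congr rfl fun k _ => ?_)
    simp only [Matrix.mul_apply, Matrix.conjTranspose_apply, star_sum, star_mul', star_star,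
      Finset.sum_mul]
    rw [Finset.sum_comm]
    refine Finset.sum_congr rfl fun c _ => Finset.sum_congr rfl fun e _ => ?_
    ring
  have hN : ∀ i j, fourier (mulDistrib (conjFn (η.coeff E p q)) T) ξ i j = N (q, i) (p, j) := by
    intro i j
    rw [fourier_apply, mulDistrib_apply, hcoeff]
    simp only [N, map_sum, map_smul, Matrix.sum_apply, Matrix.mul_apply, smul_eq_mul,
      Matrix.conjTranspose_apply, fourier_apply, Finset.sum_mul]
    refine Finset.sum_congr rfl fun k _ => Finset.sum_congr rfl fun c _ =>
      Finset.sum_congr rfl fun e _ => ?_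
    ring
  have hB : 0 ≤ C * (2 * japanese b η) ^ |s| * japanese b ξ ^ s := by positivity
  refine opNorm_le_of_forall hB fun w v => ?_
  -- The isometric embeddings of $\mathbb C^{d_\xi}$ as slices of the tensor product. They exhibit
  -- the wanted matrix as a block of `N`, so its norm is no larger.
  let ext : Fin η.dim → (Fin ξ.dim → ℂ) → (Fin η.dim × Fin ξ.dim → ℂ) :=
    fun a u r => if r.1 = a then u r.2 else 0
  have hext : ∀ a u, ‖(WithLp.toLp 2 (ext a u) : EuclideanSpace ℂ _)‖ =
      ‖(WithLp.toLp 2 u : EuclideanSpace ℂ (Fin ξ.dim))‖ := by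
    intro a u
    rw [EuclideanSpace.norm_eq, EuclideanSpace.norm_eq, Fintype.sum_prod_type, Finset.sum_eq_single a]
    · simp [ext]
    · intro c _ hc
      simp [ext, hc]
    · simp
  have h1 : star w ⬝ᵥ fourier (mulDistrib (conjFn (η.coeff E p q)) T) ξ *ᵥ v =
      star (ext q w) ⬝ᵥ N *ᵥ (ext p v) := by
    simp only [dotProduct, Matrix.mulVec, hN, Pi.star_apply]
    rw [Fintype.sum_prod_type, Finset.sum_eq_single q]
    · refine Finset.sum_congr rfl fun i _ => ?_
      rw [Fintype.sum_prod_type, Finset.sum_eq_single p]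
      · simp [ext]
      · intro c _ hc
        simp [ext, hc]
      · simp
    · intro c _ hc
      simp [ext, hc]
    · simp
  rw [h1, ← hext q w, ← hext p v]
  refine norm_sum_conj_le hsum (fun k hk => (hT (ζ k)).trans ?_) hB _ _
  rw [mul_assoc]
  exact mul_le_mul_of_nonneg_left (japanese_rpow_le hb η ξ (ζ k) (fun x => hV k x) hk s) hC

end Multiplication

end LieSymbol
end

noncomputable section

namespace LieSymbol

/-! ### Schur orthogonality and a bound for sums of squared dimensions -/

section Orthogonality

open Matrix

variable {G : Type*} [TopologicalSpace G] [Group G] [IsTopologicalGroup G] [CompactSpace G]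
  [MeasurableSpace G] [BorelSpace G]

/-- A right translate of the measure is again a Haar probability measure, and there is only one. -/
theorem isMulRightInvariant_of_isProbabilityMeasure (μ : Measure G) [μ.IsHaarMeasure]
    [IsProbabilityMeasure μ] : μ.IsMulRightInvariant := by
  refine ⟨fun g => ?_⟩
  have : IsProbabilityMeasure (Measure.map (fun x => x * g) μ) :=
    Measure.isProbabilityMeasure_map (by fun_prop)
  exact Measure.isHaarMeasure_eq_of_isProbabilityMeasure _ _

variable (μ : Measure G) [μ.IsHaarMeasure] [IsProbabilityMeasure μ]

theorem continuous_integrable {F : G → ℂ} (hF : Continuous F) : Integrable F μ :=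
  hF.integrable_of_hasCompactSupport (HasCompactSupport.of_compactSpace _)

theorem UIrrep.continuous_mat_apply (ξ : UIrrep G) (i j : Fin ξ.dim) :
    Continuous fun x => ξ.mat x i j :=
  (continuous_subtype_val.comp ξ.continuous_toHom).matrix_elem i j

/-- These are the averages $\int\eta(x)E_{jl}\zeta(x)^*dx$ of matrix units over the group, so
Schur's lemma applies to them. -/
theorem intertwines_integral (η ζ : UIrrep G) (j : Fin η.dim) (l : Fin ζ.dim) :
    Intertwines ζ η (Matrix.of fun i k => ∫ x, η.mat x i j * star (ζ.mat x k l) ∂μ) := by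
  intro y
  have hmul : ∀ (ξ : UIrrep G) (x y : G), ξ.mat (x * y) = ξ.mat x * ξ.mat y := fun ξ x y => by
    simp [UIrrep.mat]
  have hinv : ∀ (ξ : UIrrep G) (x : G), ξ.mat x⁻¹ = (ξ.mat x)ᴴ := fun ξ x => by
    rw [UIrrep.mat, map_inv]; rfl
  have hint : ∀ a c, Integrable (fun x => η.mat x a j * star (ζ.mat x c l)) μ := fun a c =>
    continuous_integrable μ ((η.continuous_mat_apply a j).mul (ζ.continuous_mat_apply c l).star)
  ext i k
  simp only [Matrix.mul_apply, Matrix.of_apply]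
  calc ∑ a, η.mat y i a * ∫ x, η.mat x a j * star (ζ.mat x k l) ∂μ
      = ∫ x, η.mat (y * x) i j * star (ζ.mat x k l) ∂μ := by
        simp only [← integral_const_mul]
        rw [← integral_finsetSum _ fun a _ => (hint a k).const_mul _]
        refine integral_congr_ae (Filter.Eventually.of_forall fun x => ?_)
        simp only [hmul, Matrix.mul_apply, Finset.sum_mul, mul_assoc]
    _ = ∫ x, η.mat x i j * star (ζ.mat (y⁻¹ * x) k l) ∂μ := by
        rw [← integral_mul_left_eq_self (fun x => η.mat x i j * star (ζ.mat (y⁻¹ * x) k l)) y]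
        simp only [inv_mul_cancel_left]
    _ = ∑ a, (∫ x, η.mat x i j * star (ζ.mat x a l) ∂μ) * ζ.mat y a k := by
        simp only [← integral_mul_const]
        rw [← integral_finsetSum _ fun a _ => (hint i a).mul_const _]
        refine integral_congr_ae (Filter.Eventually.of_forall fun x => ?_)
        simp only [hmul, hinv, Matrix.mul_apply, Matrix.conjTranspose_apply, star_sum, star_mul',
          star_star, Finset.mul_sum]
        exact Finset.sum_congr rfl fun a _ => by ring

/-- Schur orthogonality for inequivalent representations. -/
theorem integral_coeff_mul_conj_of_not_equiv {η ζ : UIrrep G}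
    (h : ¬ (uirrepSetoid G).r ζ η) (i j : Fin η.dim) (k l : Fin ζ.dim) :
    ∫ x, η.mat x i j * star (ζ.mat x k l) ∂μ = 0 := by
  by_contra h0
  refine h ⟨_, intertwines_integral μ η ζ j l, fun h1 => h0 ?_⟩
  exact congrFun (congrFun h1 i) k

/-- Schur orthogonality for the matrix coefficients of one representation. -/
theorem integral_coeff_mul_conj_self (η : UIrrep G) (i j k l : Fin η.dim) :
    ∫ x, η.mat x i j * star (η.mat x k l) ∂μ =
      if i = k ∧ j = l then (η.dim : ℂ)⁻¹ else 0 := by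
  obtain ⟨z, hz⟩ := η.exists_eq_smul_one _ (fun x => intertwines_integral μ η η j l x)
  have hd : (η.dim : ℂ) ≠ 0 := by exact_mod_cast η.dim_pos.ne'
  -- The scalar is found from the trace of the average, where unitarity of $\eta(x)$ makes the
  -- integrand constant.
  have htr : (η.dim : ℂ) * z = if j = l then 1 else 0 := by
    have h1 := congrArg Matrix.trace hz
    simp only [Matrix.trace_smul, Matrix.trace_one, Fintype.card_fin, smul_eq_mul] at h1
    rw [mul_comm, ← h1]
    simp only [Matrix.trace, Matrix.diag_apply, Matrix.of_apply]
    have hi : ∀ a, Integrable (fun x => η.mat x a j * star (η.mat x a l)) μ := fun a =>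
      continuous_integrable μ ((η.continuous_mat_apply a j).mul (η.continuous_mat_apply a l).star)
    rw [← integral_finsetSum _ fun a _ => hi a]
    have h2 : ∀ x, ∑ a, η.mat x a j * star (η.mat x a l) = if j = l then 1 else 0 := by
      intro x
      have h3 : (η.mat x)ᴴ * η.mat x = 1 := Matrix.UnitaryGroup.star_mul_self (η.toHom x)
      have h4 := congrFun (congrFun h3 l) j
      rw [Matrix.mul_apply, Matrix.one_apply] at h4
      simp only [eq_comm (a := j), ← h4, Matrix.conjTranspose_apply]
      exact Finset.sum_congr rfl fun a _ => mul_comm _ _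
    simp only [h2]
    simp
  have h5 := congrFun (congrFun hz i) k
  rw [Matrix.of_apply, Matrix.smul_apply, Matrix.one_apply, smul_eq_mul] at h5
  rw [h5]
  by_cases hik : i = k
  · by_cases hjl : j = l
    · rw [if_pos hjl] at htr
      rw [if_pos hik, if_pos ⟨hik, hjl⟩, mul_one]
      exact eq_inv_of_mul_eq_one_right htr
    · rw [if_neg hjl] at htr
      simp [(mul_eq_zero.1 htr).resolve_left hd, hjl]
  · simp [hik]

/-- If the pairwise inequivalent representations in `F` are close to the identity on `S`, then
the sum of the squares of their dimensions is controlled by the measure of `S`. -/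
theorem sum_dim_sq_mul_measure_le {F : Finset (UIrrep G)}
    (hF : ∀ η ∈ F, ∀ ζ ∈ F, η ≠ ζ → ¬ (uirrepSetoid G).r ζ η) {S : Set G} (hS : MeasurableSet S)
    (h : ∀ η ∈ F, ∀ x ∈ S, opNorm (η.mat x - 1) ≤ 1 / 2) :
    (∑ η ∈ F, (η.dim : ℝ) ^ 2) * μ.real S ≤ 4 := by
  classical
  -- The kernel $\sum d_\eta\chi_\eta$. By orthogonality its squared $L^2$ norm is $N=\sum
  -- d_\eta^2$, which is also its value at the identity.
  let k : G → ℂ := fun x => ∑ η ∈ F, (η.dim : ℂ) * (η.mat x).trace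
  let N : ℝ := ∑ η ∈ F, (η.dim : ℝ) ^ 2
  have hN : 0 ≤ N := Finset.sum_nonneg fun _ _ => by positivity
  have hcont : ∀ η : UIrrep G, Continuous fun x => (η.mat x).trace := fun η =>
    continuous_finsetSum _ fun i _ => η.continuous_mat_apply i i
  have hk : Continuous k := continuous_finsetSum _ fun η _ => continuous_const.mul (hcont η)
  have htr : ∀ η ∈ F, ∀ ζ ∈ F, ∫ x, (η.mat x).trace * star (ζ.mat x).trace ∂μ =
      if η = ζ then 1 else 0 := by
    intro η hη ζ hζ
    simp only [Matrix.trace, Matrix.diag_apply, star_sum, Finset.sum_mul_sum]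
    have hi : ∀ i j, Integrable (fun x => η.mat x i i * star (ζ.mat x j j)) μ := fun i j =>
      continuous_integrable μ ((η.continuous_mat_apply i i).mul (ζ.continuous_mat_apply j j).star)
    rw [integral_finsetSum _ fun i _ => integrable_finsetSum _ fun j _ => hi i j]
    have h1 : ∀ i, ∫ x, ∑ j, η.mat x i i * star (ζ.mat x j j) ∂μ =
        ∑ j, ∫ x, η.mat x i i * star (ζ.mat x j j) ∂μ := fun i =>
      integral_finsetSum _ fun j _ => hi i j
    simp only [h1]
    split_ifs with he
    · subst he
      simp only [integral_coeff_mul_conj_self, and_self]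
      have hd : (η.dim : ℂ) ≠ 0 := by exact_mod_cast η.dim_pos.ne'
      simp [hd]
    · simp only [integral_coeff_mul_conj_of_not_equiv μ (hF η hη ζ hζ he)]
      simp
  have hint : ∫ x, ‖k x‖ ^ 2 ∂μ = N := by
    have h1 : ((∫ x, ‖k x‖ ^ 2 ∂μ : ℝ) : ℂ) = (N : ℂ) := by
      refine integral_ofReal.symm.trans ?_
      have h2 : ∀ x, ((‖k x‖ ^ 2 : ℝ) : ℂ) = ∑ η ∈ F, ∑ ζ ∈ F,
          ((η.dim : ℂ) * ζ.dim) * ((η.mat x).trace * star (ζ.mat x).trace) := by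
        intro x
        rw [← Complex.normSq_eq_norm_sq, Complex.normSq_eq_conj_mul_self, mul_comm]
        change k x * star (k x) = _
        simp only [k, star_sum, Finset.sum_mul_sum, star_mul', star_natCast]
        exact Finset.sum_congr rfl fun _ _ => Finset.sum_congr rfl fun _ _ => by ring
      refine (integral_congr_ae (Filter.Eventually.of_forall h2)).trans ?_
      have hi : ∀ η ζ : UIrrep G, Integrable (fun x => ((η.dim : ℂ) * ζ.dim) *
          ((η.mat x).trace * star (ζ.mat x).trace)) μ := fun η ζ =>
        continuous_integrable μ (continuous_const.mul ((hcont η).mul (hcont ζ).star))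
      rw [integral_finsetSum _ fun η _ => integrable_finsetSum _ fun ζ _ => hi η ζ]
      simp only [N, Complex.ofReal_sum]
      refine Finset.sum_congr rfl fun η hη => ?_
      rw [integral_finsetSum _ fun ζ _ => hi η ζ, Finset.sum_eq_single η]
      · rw [integral_const_mul, htr η hη η hη, if_pos rfl]
        push_cast
        ring
      · intro ζ hζ hne
        rw [integral_const_mul, htr η hη ζ hζ, if_neg (Ne.symm hne), mul_zero]
      · exact fun h => absurd hη h
    exact_mod_cast h1
  -- On `S` each trace is within $d_\eta/2$ of $d_\eta$, so $|k|\ge N/2$ there. Comparison with the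
  -- $L^2$ norm gives $\tfrac14N^2\mu(S)\le N$, hence the constant 4.
  have hlow : ∀ x ∈ S, N / 2 ≤ ‖k x‖ := by
    intro x hx
    have h1 : ‖(N : ℂ) - k x‖ ≤ N / 2 := by
      have h2 : (N : ℂ) - k x = ∑ η ∈ F, -((η.dim : ℂ) * (η.mat x - 1).trace) := by
        simp only [N, k, Complex.ofReal_sum, ← Finset.sum_sub_distrib]
        refine Finset.sum_congr rfl fun η _ => ?_
        rw [Matrix.trace_sub, Matrix.trace_one, Fintype.card_fin]
        push_cast
        ring
      rw [h2, Finset.sum_div]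
      refine (norm_sum_le _ _).trans (Finset.sum_le_sum fun η hη => ?_)
      rw [norm_neg, norm_mul, Complex.norm_natCast]
      have h3 : ‖(η.mat x - 1).trace‖ ≤ η.dim * (1 / 2) := by
        refine (norm_sum_le _ _).trans ?_
        refine (Finset.sum_le_sum fun i _ => (norm_apply_le_opNorm _ i i).trans (h η hη x hx)).trans ?_
        simp
      calc _ ≤ (η.dim : ℝ) * (η.dim * (1 / 2)) := mul_le_mul_of_nonneg_left h3 (by positivity)
        _ = _ := by ring
    have h2 := norm_sub_norm_le (N : ℂ) (N - k x)
    rw [sub_sub_cancel, Complex.norm_real, Real.norm_of_nonneg hN] at h2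
    linarith
  have hfin : N ^ 2 / 4 * μ.real S ≤ N := by
    have hki : Integrable (fun x => ‖k x‖ ^ 2) μ :=
      (hk.norm.pow 2).integrable_of_hasCompactSupport (HasCompactSupport.of_compactSpace _)
    calc N ^ 2 / 4 * μ.real S = ∫ _ in S, N ^ 2 / 4 ∂μ := by
          rw [setIntegral_const, smul_eq_mul, mul_comm]
      _ ≤ ∫ x in S, ‖k x‖ ^ 2 ∂μ := by
          refine setIntegral_mono_on (integrable_const _).integrableOn hki.integrableOn hS
            fun x hx => ?_
          have := pow_le_pow_left₀ (by positivity) (hlow x hx) 2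
          linarith [this, div_pow N 2 2]
      _ ≤ ∫ x, ‖k x‖ ^ 2 ∂μ :=
          setIntegral_le_integral hki (Filter.Eventually.of_forall fun x => by positivity)
      _ = N := hint
  change N * μ.real S ≤ 4
  rcases hN.eq_or_lt with h0 | h0
  · rw [← h0]; norm_num
  · refine le_of_mul_le_mul_left ?_ h0
    linarith

end Orthogonality

/-! ### Chart balls at the identity and their Haar measure -/

section Chart

open Matrix

variable {E G : Type*} [NormedAddCommGroup E] [NormedSpace ℝ E]
  [TopologicalSpace G] [ChartedSpace E G] [Group G] [LieGroup 𝓘(ℝ, E) ∞ G]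

/-- Left translates are Lipschitz in the chart at the identity. -/
theorem exists_chart_lipschitz :
    ∃ R > 0, ∃ L > 0, Metric.ball (chartAt E (1 : G) 1) R ⊆ (chartAt E (1 : G)).target ∧
      ∀ a ∈ Metric.ball (chartAt E (1 : G) 1) R, ∀ c ∈ Metric.ball (chartAt E (1 : G) 1) R,
        ∃ e, ‖e - chartAt E (1 : G) 1‖ ≤ L * ‖c - a‖ ∧
          (chartAt E (1 : G)).symm c = (chartAt E (1 : G)).symm a * (chartAt E (1 : G)).symm e := by
  let φ := chartAt E (1 : G)
  let o : E := φ 1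
  let ψ : E → G := φ.symm
  have ho : o ∈ φ.target := φ.map_source (mem_chart_source E 1)
  have hψo : ψ o = 1 := φ.left_inv (mem_chart_source E 1)
  have hψ : ContMDiffAt 𝓘(ℝ, E) 𝓘(ℝ, E) ∞ ψ o :=
    (contMDiffOn_chart_symm (I := 𝓘(ℝ, E)) (n := ∞) (x := (1 : G))).contMDiffAt
      (φ.open_target.mem_nhds ho)
  let pr : E × E → G := fun p => (ψ p.1)⁻¹ * ψ p.2
  have hpr : ContMDiffAt (𝓘(ℝ, E).prod 𝓘(ℝ, E)) 𝓘(ℝ, E) ∞ pr (o, o) :=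
    (ContMDiffAt.comp (o, o) (g := ψ) hψ contMDiffAt_fst).inv.mul
      (ContMDiffAt.comp (o, o) (g := ψ) hψ contMDiffAt_snd)
  have hpro : pr (o, o) = 1 := by simp [pr]
  -- The chart expression of $(x,y)\mapsto x^{-1}y$. It is constant on the diagonal, so a Lipschitz
  -- bound compared with the point `(a, a)` is linear in $c-a$.
  let m : E × E → E := fun p => φ (pr p)
  have hm : ContDiffAt ℝ ∞ m (o, o) := by
    have h : ContMDiffAt 𝓘(ℝ, E) 𝓘(ℝ, E) ∞ φ (pr (o, o)) := by
      rw [hpro]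
      exact (contMDiffOn_chart (I := 𝓘(ℝ, E)) (n := ∞) (x := (1 : G))).contMDiffAt
        (chart_source_mem_nhds E 1)
    have h1 : ContMDiffAt (𝓘(ℝ, E).prod 𝓘(ℝ, E)) 𝓘(ℝ, E) ∞ m (o, o) := h.comp (o, o) hpr
    rw [← modelWithCornersSelf_prod, chartedSpaceSelf_prod] at h1
    exact h1.contDiffAt
  have hmem : ∀ᶠ p in nhds (o, o), pr p ∈ φ.source := by
    refine hpr.continuousAt.eventually (φ.open_source.mem_nhds ?_)
    rw [hpro]; exact mem_chart_source E 1
  obtain ⟨K, t, ht, hK⟩ := (hm.of_le (m := 1) (by norm_cast)).exists_lipschitzOnWith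
  have hT : {p : E × E | p ∈ t ∧ pr p ∈ φ.source ∧ p.1 ∈ φ.target} ∈ nhds (o, o) := by
    filter_upwards [ht, hmem, continuousAt_fst.eventually (φ.open_target.mem_nhds ho)] with p h1 h2 h3
    exact ⟨h1, h2, h3⟩
  obtain ⟨R, hR, hball⟩ := Metric.mem_nhds_iff.1 hT
  have hprod : ∀ a ∈ Metric.ball o R, ∀ c ∈ Metric.ball o R, (a, c) ∈ Metric.ball (o, o) R := by
    intro a ha c hc
    rw [← ball_prod_same]
    exact ⟨ha, hc⟩
  refine ⟨R, hR, K + 1, by positivity, fun a ha => (hball (hprod a ha a ha)).2.2, ?_⟩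
  intro a ha c hc
  refine ⟨m (a, c), ?_, ?_⟩
  · have h1 := hK.dist_le_mul _ (hball (hprod a ha c hc)).1 _ (hball (hprod a ha a ha)).1
    have h2 : m (a, a) = o := by simp only [m, pr, inv_mul_cancel]; rfl
    rw [h2, dist_eq_norm, dist_eq_norm, Prod.mk_sub_mk, sub_self] at h1
    refine h1.trans ?_
    rw [Prod.norm_mk, norm_zero, max_eq_right (norm_nonneg _)]
    exact mul_le_mul_of_nonneg_right (by linarith) (norm_nonneg _)
  · have h1 : φ.symm (m (a, c)) = pr (a, c) := φ.left_inv (hball (hprod a ha c hc)).2.1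
    change ψ c = ψ a * φ.symm (m (a, c))
    rw [h1]
    simp [pr]

/-- The Haar measure of chart balls decays at most polynomially with the radius. -/
theorem exists_measure_chart_ball_ge [FiniteDimensional ℝ E] [CompactSpace G]
    [MeasurableSpace G] [BorelSpace G] (μ : Measure G) [μ.IsHaarMeasure] [IsProbabilityMeasure μ] :
    ∃ R > 0, ∃ c > 0, ∃ N : ℕ, 0 < N ∧
      Metric.ball (chartAt E (1 : G) 1) R ⊆ (chartAt E (1 : G)).target ∧
      ∀ n : ℕ, c ≤ (N : ℝ) ^ n *
        μ.real ((chartAt E (1 : G)).symm '' Metric.ball (chartAt E (1 : G) 1) (R / 2 ^ n)) := by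
  have := topologicalGroup_of_lieGroup 𝓘(ℝ, E) ∞ (G := G)
  obtain ⟨R, hR, L, hL, hsub, hlip⟩ := exists_chart_lipschitz (E := E) (G := G)
  let φ := chartAt E (1 : G)
  let o : E := φ 1
  let S : ℝ → Set G := fun r => φ.symm '' Metric.ball o r
  have hproper : ProperSpace E := FiniteDimensional.proper ℝ E
  -- Rescaled by $r$, a finite cover of the ball of radius 2 by balls of radius $1/L$ covers a chart
  -- ball of radius $2r$ by a number of pieces independent of $r$.
  obtain ⟨t, hts, htf, htc⟩ := (isCompact_closedBall (0 : E) 2).finite_cover_balls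
    (show 0 < 1 / L by positivity)
  -- Doubling: each piece lies in a left translate of the chart ball of radius $r$, and all
  -- translates have the same measure.
  have hdouble : ∀ r, 0 < r → 2 * r < R → μ.real (S (2 * r)) ≤ htf.toFinset.card * μ.real (S r) := by
    intro r hr hrR
    have hcover : S (2 * r) ⊆ ⋃ z ∈ htf.toFinset, (fun x => (φ.symm (o + r • z))⁻¹ * x) ⁻¹' S r := by
      rintro _ ⟨c, hc, rfl⟩
      rw [mem_ball_iff_norm] at hc
      have h1 : r⁻¹ • (c - o) ∈ Metric.closedBall (0 : E) 2 := by
        rw [mem_closedBall_zero_iff, norm_smul, norm_inv, Real.norm_of_nonneg hr.le]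
        rw [inv_mul_le_iff₀ hr]
        linarith
      obtain ⟨z, hz, hcz⟩ := mem_iUnion₂.1 (htc h1)
      rw [mem_ball_iff_norm] at hcz
      have hz2 : ‖z‖ ≤ 2 := by simpa using hts hz
      have ha : o + r • z ∈ Metric.ball o R := by
        rw [mem_ball_iff_norm, add_sub_cancel_left, norm_smul, Real.norm_of_nonneg hr.le]
        nlinarith
      obtain ⟨e, he, hce⟩ := hlip _ ha c (by rw [mem_ball_iff_norm]; exact hc.trans hrR)
      refine mem_iUnion₂.2 ⟨z, htf.mem_toFinset.2 hz, ⟨e, ?_, ?_⟩⟩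
      · rw [mem_ball_iff_norm]
        refine he.trans_lt ?_
        have h2 : c - (o + r • z) = r • (r⁻¹ • (c - o) - z) := by
          rw [smul_sub, smul_inv_smul₀ hr.ne']
          abel
        rw [h2, norm_smul, Real.norm_of_nonneg hr.le]
        calc L * (r * ‖r⁻¹ • (c - o) - z‖) < L * (r * (1 / L)) := by gcongr
          _ = r := by field_simp
      · exact (inv_mul_eq_of_eq_mul hce).symm
    refine (measureReal_mono hcover (measure_ne_top _ _)).trans ((measureReal_biUnion_finset_le _ _).trans ?_)
    refine (Finset.sum_le_card_nsmul _ _ (μ.real (S r)) fun z _ => ?_).trans (by simp)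
    exact (congrArg ENNReal.toReal (measure_preimage_mul μ _ _)).le
  have hopen : ∀ r ≤ R, IsOpen (S r) := fun r hr =>
    φ.isOpen_image_symm_of_subset_target Metric.isOpen_ball
      ((Metric.ball_subset_ball hr).trans hsub)
  have hpos : 0 < μ.real (S (R / 2)) := by
    refine ENNReal.toReal_pos ?_ (measure_ne_top _ _)
    refine ((hopen _ (by linarith)).measure_pos μ ?_).ne'
    exact ⟨_, o, Metric.mem_ball_self (by positivity), rfl⟩
  refine ⟨R / 2, by positivity, μ.real (S (R / 2)), hpos, htf.toFinset.card + 1, by positivity,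
    (Metric.ball_subset_ball (by linarith)).trans hsub, fun n => ?_⟩
  induction n with
  | zero => simp [S, φ, o]
  | succ n ih =>
    refine ih.trans ?_
    rw [pow_succ, mul_assoc]
    refine mul_le_mul_of_nonneg_left ?_ (by positivity)
    have h1 : R / 2 / 2 ^ n = 2 * (R / 2 / 2 ^ (n + 1)) := by
      rw [pow_succ]; field_simp
    rw [h1]
    refine (hdouble _ (by positivity) ?_).trans ?_
    · rw [← h1]
      have : R / 2 / 2 ^ n ≤ R / 2 := div_le_self (by positivity) (one_le_pow₀ (by norm_num))
      linarith
    · refine mul_le_mul_of_nonneg_right ?_ measureReal_nonneg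
      push_cast
      linarith

end Chart

end LieSymbol
end

noncomputable section

namespace LieSymbol

/-! ### Representations near the identity and a crude Weyl law -/

section NearIdentity

open Matrix

variable {E G : Type*} [NormedAddCommGroup E] [NormedSpace ℝ E] [FiniteDimensional ℝ E]
  [TopologicalSpace G] [ChartedSpace E G] [Group G] [LieGroup 𝓘(ℝ, E) ∞ G] [CompactSpace G]
  [T2Space G]

theorem UIrrep.norm_mat_apply (η : UIrrep G) (x : G) (v : EuclideanSpace ℂ (Fin η.dim)) :
    ‖Matrix.toEuclideanCLM (𝕜 := ℂ) (η.mat x) v‖ = ‖v‖ := by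
  have key : inner ℂ (Matrix.toEuclideanCLM (𝕜 := ℂ) (η.mat x) v)
      (Matrix.toEuclideanCLM (𝕜 := ℂ) (η.mat x) v) = inner ℂ v v := by
    rw [← ContinuousLinearMap.adjoint_inner_right, ← ContinuousLinearMap.star_eq_adjoint, ← map_star,
      Matrix.star_eq_conjTranspose, ← UIrrep.mat_inv, ← mul_apply_eq_comp, ← map_mul,
      ← UIrrep.mat_mul, inv_mul_cancel, UIrrep.mat_one, map_one, one_apply_eq_self]
  have h := congrArg RCLike.re key
  rw [inner_self_eq_norm_sq, inner_self_eq_norm_sq] at h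
  exact (sq_eq_sq₀ (norm_nonneg _) (norm_nonneg _)).1 h

variable (E) in
/-- The matrix coefficient `x ↦ ⟨w, η(x) v⟩`. -/
def UIrrep.vecCoeff (η : UIrrep G) (w v : Fin η.dim → ℂ) : SmoothFn E G :=
  ∑ i, ∑ j, (star (w i) * v j) • η.coeff E i j

theorem UIrrep.vecCoeff_apply (η : UIrrep G) (w v : Fin η.dim → ℂ) (x : G) :
    η.vecCoeff E w v x = star w ⬝ᵥ η.mat x *ᵥ v := by
  simp only [UIrrep.vecCoeff, smoothFn_sum_apply, smul_apply, UIrrep.coeff_apply, dotProduct,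
    Matrix.mulVec, Pi.star_apply, Finset.mul_sum]
  exact Finset.sum_congr rfl fun i _ => Finset.sum_congr rfl fun j _ => by ring

theorem UIrrep.lieDeriv_vecCoeff_apply (η : UIrrep G) (w v : Fin η.dim → ℂ)
    (X : GroupLieAlgebra 𝓘(ℝ, E) G) (x : G) :
    lieDeriv X (η.vecCoeff E w v) x = star w ⬝ᵥ η.mat x *ᵥ (η.diff X *ᵥ v) := by
  simp only [UIrrep.vecCoeff, map_sum, map_smul, smoothFn_sum_apply, smul_apply, lieDeriv_coeff,
    dotProduct, Matrix.mulVec, Pi.star_apply, Finset.mul_sum, UIrrep.coeff_apply]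
  refine Finset.sum_congr rfl fun i _ => ?_
  rw [Finset.sum_comm]
  exact Finset.sum_congr rfl fun j _ => Finset.sum_congr rfl fun k _ => by ring

variable {b : Module.Basis (Fin (Module.finrank ℝ E)) ℝ (GroupLieAlgebra 𝓘(ℝ, E) G)}

theorem opNorm_sum_le {d : ℕ} {κ : Type*} (s : Finset κ) (M : κ → Matrix (Fin d) (Fin d) ℂ) :
    opNorm (∑ k ∈ s, M k) ≤ ∑ k ∈ s, opNorm (M k) := by
  unfold opNorm
  rw [map_sum]
  exact norm_sum_le _ _

theorem opNorm_diff_basis_le (hb : IsBiinvariantFrame b) (η : UIrrep G) (k) :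
    opNorm (η.diff (b k)) ≤ japanese b η := by
  refine ContinuousLinearMap.opNorm_le_bound _ (japanese_pos hb η).le fun v => ?_
  refine le_of_sq_le_sq ?_ (mul_nonneg (japanese_pos hb η).le (norm_nonneg _))
  have h1 := sum_norm_diff_sq hb η v
  have h2 := Finset.single_le_sum (f := fun k => ‖Matrix.toEuclideanCLM (𝕜 := ℂ) (η.diff (b k)) v‖ ^ 2)
    (fun _ _ => by positivity) (Finset.mem_univ k)
  have h3 : japanese b η ^ 2 = 1 + lambdaSq b η :=
    Real.sq_sqrt (by linarith [(casimir_eq hb η).1])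
  rw [mul_pow, h3]
  nlinarith [sq_nonneg ‖v‖]

/-- The coordinates of the Lie algebra, as continuous functionals on the model space. -/
def coordCLM (b : Module.Basis (Fin (Module.finrank ℝ E)) ℝ (GroupLieAlgebra 𝓘(ℝ, E) G))
    (k : Fin (Module.finrank ℝ E)) : E →L[ℝ] ℝ :=
  LinearMap.toContinuousLinearMap
    { toFun := fun X => b.repr (toLie G X) k
      map_add' := fun X Y => by
        change b.repr (toLie G X + toLie G Y) k = _
        simp
      map_smul' := fun c X => by
        change b.repr (c • toLie G X) k = _
        simp }

theorem toLie_eq_sum (b : Module.Basis (Fin (Module.finrank ℝ E)) ℝ (GroupLieAlgebra 𝓘(ℝ, E) G))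
    (X : E) : toLie G X = ∑ k, coordCLM b k X • b k :=
  (b.sum_repr (toLie G X)).symm

/-- The derived representation is bounded by `⟨η⟩`. -/
theorem exists_opNorm_diff_le (hb : IsBiinvariantFrame b) :
    ∃ C, 0 ≤ C ∧ ∀ (η : UIrrep G) (X : E), opNorm (η.diff (toLie G X)) ≤ C * japanese b η * ‖X‖ := by
  refine ⟨∑ k, ‖coordCLM b k‖, Finset.sum_nonneg fun _ _ => norm_nonneg _, fun η X => ?_⟩
  rw [toLie_eq_sum b, UIrrep.diff_sum]
  refine (opNorm_sum_le _ _).trans ?_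
  rw [Finset.sum_mul, Finset.sum_mul]
  refine Finset.sum_le_sum fun k _ => ?_
  rw [opNorm_smul, Complex.norm_real]
  calc ‖coordCLM b k X‖ * opNorm (η.diff (b k)) ≤ (‖coordCLM b k‖ * ‖X‖) * japanese b η :=
        mul_le_mul ((coordCLM b k).le_opNorm X) (opNorm_diff_basis_le hb η k)
          (opNorm_nonneg _) (by positivity)
    _ = _ := by ring

/-- A bound for the left-invariant derivatives gives a Lipschitz bound in the chart. -/
theorem exists_norm_sub_le_of_lieDeriv_le : ∃ R > 0, ∃ L > 0,
    Metric.ball (chartAt E (1 : G) 1) R ⊆ (chartAt E (1 : G)).target ∧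
    ∀ (f : SmoothFn E G) (M : ℝ), 0 ≤ M → (∀ x X, ‖lieDeriv (toLie G X) f x‖ ≤ M * ‖X‖) →
      ∀ x, ∀ a ∈ Metric.ball (chartAt E (1 : G) 1) R,
        ‖f (x * (chartAt E (1 : G)).symm a) - f x‖ ≤ M * L * ‖a - chartAt E (1 : G) 1‖ := by
  obtain ⟨R, hR, L, hL, hsub, hlip⟩ := exists_chart_lipschitz (E := E) (G := G)
  let φ := chartAt E (1 : G)
  let o : E := φ 1
  have hψo : φ.symm o = 1 := φ.left_inv (mem_chart_source E 1)
  refine ⟨R, hR, L, hL, hsub, fun f M hM hf x a ha => ?_⟩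
  -- The linear approximation at a centre `y` holds on a neighbourhood depending on `y` and only up
  -- to `ε`. It is used to bound the derivative everywhere on the ball, and then `ε` tends to 0.
  have key : ∀ ε > 0, ‖f (x * φ.symm a) - f x‖ ≤ (M + ε) * L * ‖a - o‖ := by
    intro ε hε
    have hcentre : ∀ y, ∀ᶠ e in nhds o, ‖f (y * φ.symm e) - f y‖ ≤ (M + ε) * ‖e - o‖ := by
      intro y
      have hd : HasFDerivAt (fun e => leftTransl y f (φ.symm e)) _ o :=
        ((contDiffAt_comp_chart_symm (leftTransl y f)
          (φ.map_source (mem_chart_source E 1))).differentiableAt (by simp)).hasFDerivAt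
      have hn : ‖fderiv ℝ (fun e => leftTransl y f (φ.symm e)) o‖ ≤ M := by
        refine ContinuousLinearMap.opNorm_le_bound _ hM fun X => ?_
        rw [← lieDeriv_one_eq_fderiv X, ← lieDeriv_apply_eq_one]
        exact hf y X
      filter_upwards [hd.isLittleO.def hε] with e he
      have h1 := norm_le_norm_sub_add (leftTransl y f (φ.symm e) - leftTransl y f (φ.symm o))
        (fderiv ℝ (fun e => leftTransl y f (φ.symm e)) o (e - o))
      have h2 := (ContinuousLinearMap.le_opNorm
        (fderiv ℝ (fun e => leftTransl y f (φ.symm e)) o) (e - o)).trans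
          (mul_le_mul_of_nonneg_right hn (norm_nonneg _))
      have h3 : leftTransl y f (φ.symm o) = f y := by rw [hψo, leftTransl_apply, mul_one]
      rw [h3] at h1 he
      exact h1.trans ((add_le_add he h2).trans_eq (by ring))
    -- Near $c$ the point is written as a left translate by $\psi(c)$ of a point near the identity,
    -- at a distance at most $L$ times as large; this reduces to the estimate at a centre.
    have hbound : ∀ c ∈ Metric.ball o R,
        ‖fderiv ℝ (fun e => leftTransl x f (φ.symm e)) c‖ ≤ (M + ε) * L := by
      intro c hc
      have hd : HasFDerivAt (fun e => leftTransl x f (φ.symm e)) _ c :=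
        ((contDiffAt_comp_chart_symm (leftTransl x f) (hsub hc)).differentiableAt
          (by simp)).hasFDerivAt
      refine hd.le_of_lip' (by positivity) ?_
      obtain ⟨δ, hδ, hδ'⟩ := Metric.eventually_nhds_iff.1 (hcentre (x * φ.symm c))
      have hnear : ∀ᶠ c' in nhds c, L * ‖c' - c‖ < δ := by
        have : Filter.Tendsto (fun c' => L * ‖c' - c‖) (nhds c) (nhds (L * ‖c - c‖)) :=
          (by fun_prop : Continuous fun c' => L * ‖c' - c‖).tendsto c
        refine this.eventually (gt_mem_nhds ?_)
        simpa using hδ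
      filter_upwards [hnear, Metric.isOpen_ball.mem_nhds hc] with c' h1 h2
      obtain ⟨e, he, hce⟩ := hlip c hc c' h2
      have h5 : leftTransl x f (φ.symm c') = f (x * φ.symm c * φ.symm e) := by
        rw [leftTransl_apply, mul_assoc]
        exact congrArg (fun y => f (x * y)) hce
      rw [h5, leftTransl_apply]
      refine (hδ' (y := e) (by rw [dist_eq_norm]; exact he.trans_lt h1)).trans ?_
      rw [mul_assoc _ L]
      exact mul_le_mul_of_nonneg_left he (by positivity)
    have hfin := (convex_ball o R).norm_image_sub_le_of_norm_fderiv_le (𝕜 := ℝ) (fun c hc =>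
      (contDiffAt_comp_chart_symm (leftTransl x f) (hsub hc)).differentiableAt (by simp))
      hbound (Metric.mem_ball_self hR) ha
    have h3 : leftTransl x f (φ.symm o) = f x := by rw [hψo, leftTransl_apply, mul_one]
    rw [← h3]
    exact hfin
  have hlim : Filter.Tendsto (fun ε : ℝ => (M + ε) * L * ‖a - o‖) (nhdsWithin 0 (Ioi 0))
      (nhds ((M + 0) * L * ‖a - o‖)) :=
    ((by fun_prop : Continuous fun ε : ℝ => (M + ε) * L * ‖a - o‖).tendsto 0).mono_left
      nhdsWithin_le_nhds
  rw [add_zero] at hlim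
  exact ge_of_tendsto hlim (eventually_nhdsWithin_of_forall key)

theorem exists_lieDeriv_le (b : Module.Basis (Fin (Module.finrank ℝ E)) ℝ
    (GroupLieAlgebra 𝓘(ℝ, E) G)) (f : SmoothFn E G) :
    ∃ M, 0 ≤ M ∧ ∀ x X, ‖lieDeriv (toLie G X) f x‖ ≤ M * ‖X‖ := by
  choose m hm using fun k => isCompact_univ.exists_bound_of_continuousOn
    (lieDeriv (b k) f).contMDiff.continuous.continuousOn
  refine ⟨∑ k, ‖coordCLM b k‖ * m k, Finset.sum_nonneg fun k _ => mul_nonneg (norm_nonneg _)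
    ((norm_nonneg _).trans (hm k 1 trivial)), fun x X => ?_⟩
  rw [toLie_eq_sum b, lieDeriv_sum_left]
  simp only [LinearMap.sum_apply, LinearMap.smul_apply, smoothFn_sum_apply, smul_apply]
  rw [Finset.sum_mul]
  refine (norm_sum_le _ _).trans (Finset.sum_le_sum fun k _ => ?_)
  rw [norm_mul, Complex.norm_real]
  calc ‖coordCLM b k X‖ * ‖lieDeriv (b k) f x‖ ≤ (‖coordCLM b k‖ * ‖X‖) * m k :=
        mul_le_mul ((coordCLM b k).le_opNorm X) (hm k x trivial) (norm_nonneg _) (by positivity)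
    _ = _ := by ring

/-- Unitary representations are close to the identity on small balls in the chart. -/
theorem exists_opNorm_mat_sub_one_le (hb : IsBiinvariantFrame b) :
    ∃ R > 0, ∃ C, 0 ≤ C ∧ ∀ (η : UIrrep G), ∀ a ∈ Metric.ball (chartAt E (1 : G) 1) R,
      opNorm (η.mat ((chartAt E (1 : G)).symm a) - 1) ≤
        C * japanese b η * ‖a - chartAt E (1 : G) 1‖ := by
  obtain ⟨R, hR, L, hL, -, hlip⟩ := exists_norm_sub_le_of_lieDeriv_le (E := E) (G := G)
  obtain ⟨C, hC, hdiff⟩ := exists_opNorm_diff_le (G := G) hb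
  refine ⟨R, hR, C * L, by positivity, fun η a ha => ?_⟩
  have hj := japanese_pos hb η
  refine opNorm_le_of_forall (by positivity) fun w v => ?_
  have h1 := hlip (η.vecCoeff E w v) (C * japanese b η *
    (‖(WithLp.toLp 2 w : EuclideanSpace ℂ (Fin η.dim))‖ *
      ‖(WithLp.toLp 2 v : EuclideanSpace ℂ (Fin η.dim))‖)) (by positivity) (fun x X => ?_) 1 a ha
  · rw [one_mul, UIrrep.vecCoeff_apply, UIrrep.vecCoeff_apply, UIrrep.mat_one, ← dotProduct_sub,
      ← Matrix.sub_mulVec] at h1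
    exact h1.trans_eq (by ring)
  · rw [UIrrep.lieDeriv_vecCoeff_apply]
    refine (norm_star_dotProduct_mulVec_le _ _ _).trans ?_
    have h2 : ‖(WithLp.toLp 2 (η.diff (toLie G X) *ᵥ v) : EuclideanSpace ℂ (Fin η.dim))‖ ≤
        C * japanese b η * ‖X‖ * ‖(WithLp.toLp 2 v : EuclideanSpace ℂ (Fin η.dim))‖ :=
      (ContinuousLinearMap.le_opNorm (Matrix.toEuclideanCLM (𝕜 := ℂ) (η.diff (toLie G X)))
        (WithLp.toLp 2 v)).trans (mul_le_mul_of_nonneg_right (hdiff η X) (norm_nonneg _))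
    have h3 : opNorm (η.mat x) ≤ 1 := by
      refine ContinuousLinearMap.opNorm_le_bound _ zero_le_one fun v => ?_
      rw [UIrrep.norm_mat_apply, one_mul]
    calc _ ≤ 1 * ‖(WithLp.toLp 2 w : EuclideanSpace ℂ (Fin η.dim))‖ * (C * japanese b η * ‖X‖ *
            ‖(WithLp.toLp 2 v : EuclideanSpace ℂ (Fin η.dim))‖) := by gcongr
      _ = _ := by ring

/-- A crude Weyl law. -/
theorem exists_sum_dim_sq_le_pow
    [MeasurableSpace G] [BorelSpace G] (μ : Measure G) [μ.IsHaarMeasure] [IsProbabilityMeasure μ]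
    (hb : IsBiinvariantFrame b) :
    ∃ A : ℝ, ∃ N : ℕ, 0 ≤ A ∧ ∀ (n : ℕ) (F : Finset (UIrrep G)),
      (∀ η ∈ F, ∀ ζ ∈ F, η ≠ ζ → ¬ (uirrepSetoid G).r ζ η) → (∀ η ∈ F, japanese b η ≤ 2 ^ n) →
      ∑ η ∈ F, (η.dim : ℝ) ^ 2 ≤ A * N ^ n := by
  have := topologicalGroup_of_lieGroup 𝓘(ℝ, E) ∞ (G := G)
  obtain ⟨R, hR, c, hc, N, hN, hsub, hmeas⟩ := exists_measure_chart_ball_ge (E := E) μ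
  obtain ⟨R', hR', C, hC, hop⟩ := exists_opNorm_mat_sub_one_le (G := G) hb
  -- The shift `p` makes the ball of radius $R/2^{n+p}$ lie in the ball of radius $R'$ and makes
  -- $C\langle\eta\rangle R/2^{n+p}\le\tfrac12$ whenever $\langle\eta\rangle\le2^n$.
  obtain ⟨p, hp⟩ := pow_unbounded_of_one_lt (max (2 * C * R) (R / R')) (one_lt_two (α := ℝ))
  have hp1 := (le_max_left _ _).trans_lt hp
  have hp2 := (le_max_right _ _).trans_lt hp
  refine ⟨4 * N ^ p / c, N, by positivity, fun n F hF hFn => ?_⟩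
  have hsub' : Metric.ball (chartAt E (1 : G) 1) (R / 2 ^ (n + p)) ⊆ (chartAt E (1 : G)).target :=
    (Metric.ball_subset_ball (div_le_self hR.le (one_le_pow₀ (by norm_num)))).trans hsub
  have h1 := sum_dim_sq_mul_measure_le μ hF
    (S := (chartAt E (1 : G)).symm '' Metric.ball (chartAt E (1 : G) 1) (R / 2 ^ (n + p)))
    ((chartAt E (1 : G)).isOpen_image_symm_of_subset_target Metric.isOpen_ball hsub').measurableSet ?_
  · have h2 := mul_le_mul_of_nonneg_left (hmeas (n + p))
      (Finset.sum_nonneg fun η _ => by positivity : 0 ≤ ∑ η ∈ F, (η.dim : ℝ) ^ 2)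
    have h3 := mul_le_mul_of_nonneg_left h1 (by positivity : (0 : ℝ) ≤ (N : ℝ) ^ (n + p))
    rw [div_mul_eq_mul_div, le_div_iff₀ hc]
    calc _ ≤ _ := h2
      _ = _ := by ring
      _ ≤ _ := h3
      _ = _ := by ring
  · rintro η hη _ ⟨a, ha, rfl⟩
    have hpn : (2 : ℝ) ^ p ≤ 2 ^ (n + p) := pow_le_pow_right₀ (by norm_num) (by omega)
    have ha' : a ∈ Metric.ball (chartAt E (1 : G) 1) R' := by
      refine Metric.ball_subset_ball ?_ ha
      rw [div_le_iff₀ (by positivity)]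
      rw [div_lt_iff₀ hR'] at hp2
      nlinarith
    refine (hop η a ha').trans ?_
    rw [mem_ball_iff_norm] at ha
    calc C * japanese b η * ‖a - chartAt E (1 : G) 1‖ ≤ C * 2 ^ n * (R / 2 ^ (n + p)) := by
          have := hFn η hη
          gcongr
      _ = C * R / 2 ^ p := by rw [pow_add]; field_simp
      _ ≤ 1 / 2 := by
          rw [div_le_iff₀ (by positivity)]
          linarith

/-- The sums of `d_η² ⟨η⟩^{-K}` over pairwise inequivalent representations are bounded. -/
theorem exists_sum_dim_sq_mul_japanese_le
    [MeasurableSpace G] [BorelSpace G] (μ : Measure G) [μ.IsHaarMeasure] [IsProbabilityMeasure μ]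
    (hb : IsBiinvariantFrame b) :
    ∃ (K : ℕ) (B : ℝ), 0 ≤ B ∧ ∀ F : Finset (UIrrep G),
      (∀ η ∈ F, ∀ ζ ∈ F, η ≠ ζ → ¬ (uirrepSetoid G).r ζ η) →
      ∑ η ∈ F, (η.dim : ℝ) ^ 2 * (japanese b η ^ K)⁻¹ ≤ B := by
  classical
  obtain ⟨A, N, hA, h⟩ := exists_sum_dim_sq_le_pow μ hb
  -- With $2^K>2N$ the weight beats the growth $N^n$ on the dyadic shell of level $n$ by the factor
  -- $2^{-n}$.
  obtain ⟨K, hK⟩ := pow_unbounded_of_one_lt (2 * N : ℝ) (one_lt_two (α := ℝ))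
  refine ⟨K, A * 2 ^ K * 2, by positivity, fun F hF => ?_⟩
  have hex : ∀ η : UIrrep G, ∃ n : ℕ, japanese b η ≤ 2 ^ n := fun η =>
    (pow_unbounded_of_one_lt _ one_lt_two).imp fun _ h => h.le
  let g : UIrrep G → ℕ := fun η => Nat.find (hex η)
  have hg1 : ∀ η, japanese b η ≤ 2 ^ g η := fun η => Nat.find_spec (hex η)
  have hg2 : ∀ η, 2 ^ g η ≤ 2 * japanese b η := by
    intro η
    have hj := one_le_japanese hb η
    rcases Nat.eq_zero_or_pos (g η) with h0 | h0
    · rw [h0, pow_zero]; linarith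
    · have h1 := Nat.find_min (hex η) (m := g η - 1) (Nat.sub_lt h0 one_pos)
      push Not at h1
      have h2 : (2 : ℝ) ^ g η = 2 * 2 ^ (g η - 1) := by
        rw [← pow_succ', Nat.sub_add_cancel h0]
      rw [h2]; linarith
  have hterm : ∀ η, (japanese b η ^ K)⁻¹ ≤ 2 ^ K * ((2 : ℝ) ^ K)⁻¹ ^ g η := by
    intro η
    have hj := japanese_pos hb η
    have h1 : ((2 : ℝ) ^ g η) ^ K ≤ (2 * japanese b η) ^ K :=
      pow_le_pow_left₀ (by positivity) (hg2 η) K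
    have h2 : 2 ^ K * ((2 : ℝ) ^ K)⁻¹ ^ g η = 2 ^ K / ((2 : ℝ) ^ g η) ^ K := by
      rw [inv_pow, ← pow_mul, ← pow_mul, mul_comm K, div_eq_mul_inv]
    rw [h2, le_div_iff₀ (by positivity), inv_mul_le_iff₀ (by positivity), ← mul_pow, mul_comm _ (2:ℝ)]
    exact h1
  have hKN : ((2 : ℝ) ^ K)⁻¹ * N ≤ 1 / 2 := by
    rw [inv_mul_le_iff₀ (by positivity)]; linarith
  calc ∑ η ∈ F, (η.dim : ℝ) ^ 2 * (japanese b η ^ K)⁻¹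
      ≤ ∑ η ∈ F, (η.dim : ℝ) ^ 2 * (2 ^ K * ((2 : ℝ) ^ K)⁻¹ ^ g η) :=
        Finset.sum_le_sum fun η _ => mul_le_mul_of_nonneg_left (hterm η) (by positivity)
    _ = ∑ n ∈ F.image g, ∑ η ∈ F with g η = n, (η.dim : ℝ) ^ 2 * (2 ^ K * ((2 : ℝ) ^ K)⁻¹ ^ g η) :=
        (Finset.sum_fiberwise_of_maps_to (fun η hη => Finset.mem_image_of_mem g hη) _).symm
    _ ≤ ∑ n ∈ F.image g, A * 2 ^ K * (1 / 2) ^ n := by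
        refine Finset.sum_le_sum fun n _ => ?_
        have h1 := h n (F.filter fun η => g η = n)
          (fun η hη ζ hζ => hF η (Finset.mem_filter.1 hη).1 ζ (Finset.mem_filter.1 hζ).1)
          (fun η hη => (hg1 η).trans_eq (by rw [(Finset.mem_filter.1 hη).2]))
        calc ∑ η ∈ F with g η = n, (η.dim : ℝ) ^ 2 * (2 ^ K * ((2 : ℝ) ^ K)⁻¹ ^ g η)
            = (∑ η ∈ F with g η = n, (η.dim : ℝ) ^ 2) * (2 ^ K * ((2 : ℝ) ^ K)⁻¹ ^ n) := by
              rw [Finset.sum_mul]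
              exact Finset.sum_congr rfl fun η hη => by rw [(Finset.mem_filter.1 hη).2]
          _ ≤ A * N ^ n * (2 ^ K * ((2 : ℝ) ^ K)⁻¹ ^ n) :=
              mul_le_mul_of_nonneg_right h1 (by positivity)
          _ = A * 2 ^ K * (((2 : ℝ) ^ K)⁻¹ * N) ^ n := by rw [mul_pow]; ring
          _ ≤ _ := by gcongr
    _ = A * 2 ^ K * ∑ n ∈ F.image g, (1 / 2 : ℝ) ^ n := by rw [Finset.mul_sum]
    _ ≤ A * 2 ^ K * 2 := by
        refine mul_le_mul_of_nonneg_left ?_ (by positivity)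
        exact (summable_geometric_two.sum_le_tsum _ fun _ _ => by positivity).trans_eq
          tsum_geometric_two

end NearIdentity

end LieSymbol
end

noncomputable section

namespace LieSymbol

/-! ### The Peter-Weyl theorem -/

section PeterWeyl

open Matrix

variable {G : Type*} [TopologicalSpace G] [Group G]

/-- A finite dimensional invariant subspace of a unitary representation carries a unitary matrix
representation. -/
theorem exists_matrix_rep {H : Type*} [NormedAddCommGroup H] [InnerProductSpace ℂ H]
    (W : G → H →ₗᵢ[ℂ] H) (hone : ∀ v, W 1 v = v) (hmul : ∀ g h v, W (g * h) v = W g (W h v))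
    (hcont : ∀ v, Continuous fun g => W g v) (V : Submodule ℂ H) [FiniteDimensional ℂ V]
    (hV : ∀ g, ∀ v ∈ V, W g v ∈ V) :
    ∃ ρ : G →* Matrix.unitaryGroup (Fin (Module.finrank ℂ V)) ℂ, Continuous ρ ∧
      ∀ g j, W g (stdOrthonormalBasis ℂ V j) =
        ∑ i, (ρ g : Matrix _ _ ℂ) i j • (stdOrthonormalBasis ℂ V i : H) := by
  let e := stdOrthonormalBasis ℂ V
  let M : G → Matrix (Fin (Module.finrank ℂ V)) (Fin (Module.finrank ℂ V)) ℂ := fun g =>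
    Matrix.of fun i j => inner ℂ (e i : H) (W g (e j))
  have hexp : ∀ v ∈ V, ∑ i, inner ℂ (e i : H) v • (e i : H) = v := by
    intro v hv
    have h := congrArg (Subtype.val : V → H) (e.sum_repr' ⟨v, hv⟩)
    simpa using h
  have hM : ∀ g j, W g (e j) = ∑ i, M g i j • (e i : H) := fun g j =>
    (hexp _ (hV g _ (e j).2)).symm
  have hM1 : M 1 = 1 := by
    ext i j
    simp only [M, Matrix.of_apply, hone, Matrix.one_apply]
    exact orthonormal_iff_ite.1 e.orthonormal i j
  have hMm : ∀ g h, M (g * h) = M g * M h := by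
    intro g h
    ext i j
    simp only [M, Matrix.of_apply, hmul, Matrix.mul_apply]
    conv_lhs => rw [hM h j, map_sum, inner_sum]
    refine Finset.sum_congr rfl fun k _ => ?_
    rw [map_smul, inner_smul_right, mul_comm]
    rfl
  have hMs : ∀ g, star (M g) = M g⁻¹ := by
    intro g
    ext i j
    simp only [M, Matrix.of_apply, Matrix.star_apply]
    rw [← starRingEnd_apply, inner_conj_symm, ← (W g).inner_map_map (e i : H), ← hmul,
      mul_inv_cancel, hone]
  refine ⟨⟨⟨fun g => ⟨M g, Matrix.mem_unitaryGroup_iff.2 ?_⟩, Subtype.ext hM1⟩,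
    fun g h => Subtype.ext (hMm g h)⟩, ?_, hM⟩
  · rw [hMs, ← hMm, mul_inv_cancel, hM1]
  · refine Continuous.subtype_mk (continuous_matrix fun i j => ?_) _
    exact continuous_const.inner (hcont _)

variable [IsTopologicalGroup G] [CompactSpace G] [MeasurableSpace G] [BorelSpace G] (μ : Measure G)
  [μ.IsHaarMeasure] [IsProbabilityMeasure μ]

/-- By complete reducibility, coefficients of any finite dimensional unitary representation are
combinations of irreducible ones. The eigenspaces below are not known to be irreducible. -/
theorem integral_mul_star_rep_eq_zero {f : G → ℂ} (hf : Continuous f)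
    (h0 : ∀ (η : UIrrep G) i j, ∫ x, f x * star (η.mat x i j) ∂μ = 0) {n : ℕ}
    (ρ : G →* Matrix.unitaryGroup (Fin n) ℂ) (hρ : Continuous ρ) (i j : Fin n) :
    ∫ x, f x * star ((ρ x : Matrix (Fin n) (Fin n) ℂ) i j) ∂μ = 0 := by
  obtain ⟨κ, _, ξ, V, hV, hsum⟩ := exists_decomposition n ρ hρ (Fintype.card_fin n)
  have h1 : ∀ x, f x * star ((ρ x : Matrix (Fin n) (Fin n) ℂ) i j) =
      ∑ k, ∑ c, ∑ a, star (V k i a) * V k j c * (f x * star ((ξ k).mat x a c)) := by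
    intro x
    have h2 : (ρ x : Matrix (Fin n) (Fin n) ℂ) = ∑ k, V k * (ξ k).mat x * (V k)ᴴ := by
      rw [← mul_one (ρ x : Matrix (Fin n) (Fin n) ℂ), ← hsum, Matrix.mul_sum]
      exact Finset.sum_congr rfl fun k _ => by rw [← Matrix.mul_assoc, hV]
    rw [h2]
    simp only [Matrix.sum_apply, Matrix.mul_apply, star_sum, star_mul', Finset.mul_sum,
      Finset.sum_mul, Matrix.conjTranspose_apply, star_star]
    exact Finset.sum_congr rfl fun k _ => Finset.sum_congr rfl fun c _ =>
      Finset.sum_congr rfl fun a _ => by ring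
  have hi : ∀ k a c, Integrable (fun x => star (V k i a) * V k j c *
      (f x * star ((ξ k).mat x a c))) μ := fun k a c => continuous_integrable μ
    (continuous_const.mul (hf.mul ((ξ k).continuous_mat_apply a c).star))
  simp only [h1]
  rw [integral_finsetSum _ fun k _ => integrable_finsetSum _ fun c _ =>
    integrable_finsetSum _ fun a _ => hi k a c]
  refine Finset.sum_eq_zero fun k _ => ?_
  rw [integral_finsetSum _ fun c _ => integrable_finsetSum _ fun a _ => hi k a c]
  refine Finset.sum_eq_zero fun c _ => ?_
  rw [integral_finsetSum _ fun a _ => hi k a c]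
  refine Finset.sum_eq_zero fun a _ => ?_
  rw [integral_const_mul, h0, mul_zero]

/-- The left regular representation on `L²`. -/
def leftRegular (g : G) : Lp ℂ 2 μ →ₗᵢ[ℂ] Lp ℂ 2 μ where
  toFun v := DomMulAct.mk g⁻¹ • v
  map_add' := smul_add _
  map_smul' c v := smul_comm _ c v
  norm_map' v := DomMulAct.norm_smul_Lp _ v

theorem leftRegular_apply (g : G) (v : Lp ℂ 2 μ) : leftRegular μ g v = DomMulAct.mk g⁻¹ • v := rfl

theorem leftRegular_toLp (g : G) (f : C(G, ℂ)) :
    leftRegular μ g (ContinuousMap.toLp 2 μ ℂ f) =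
      ContinuousMap.toLp 2 μ ℂ (f.comp ⟨fun y => g⁻¹ * y, by fun_prop⟩) := by
  refine Lp.ext ?_
  refine (DomMulAct.smul_Lp_ae_eq (DomMulAct.mk g⁻¹) _).trans ?_
  have h1 := (measurePreserving_mul_left μ g⁻¹).quasiMeasurePreserving.ae_eq_comp
    (ContinuousMap.coeFn_toLp (p := 2) (𝕜 := ℂ) μ f)
  exact h1.trans (ContinuousMap.coeFn_toLp (p := 2) (𝕜 := ℂ) μ
    (f.comp ⟨fun y => g⁻¹ * y, by fun_prop⟩)).symm

theorem continuous_leftRegular (v : Lp ℂ 2 μ) : Continuous fun g => leftRegular μ g v := by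
  have : Fact ((2 : ENNReal) ≠ ⊤) := ⟨by simp⟩
  have h : Continuous fun g : G => DomMulAct.mk g⁻¹ :=
    DomMulAct.continuous_mk.comp continuous_inv
  exact h.smul continuous_const

/-- The Peter-Weyl theorem: a continuous function whose Fourier coefficients vanish is zero. -/
theorem eq_zero_of_fourier_coeff_eq_zero (f : C(G, ℂ))
    (h0 : ∀ (η : UIrrep G) i j, ∫ x, f x * star (η.mat x i j) ∂μ = 0) : f = 0 := by
  let W := leftRegular μ
  -- The orbit of $\bar f$ under the left regular representation. Averaging the rank one operators
  -- of its points gives a compact self-adjoint operator that commutes with the representation.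
  let κ : G → Lp ℂ 2 μ := fun x => W x (ContinuousMap.toLp 2 μ ℂ (star f))
  have hone : ∀ v, W 1 v = v := fun v => by
    rw [leftRegular_apply, inv_one, DomMulAct.mk_one, one_smul]
  have hmul : ∀ g h v, W (g * h) v = W g (W h v) := fun g h v => by
    rw [leftRegular_apply, leftRegular_apply, leftRegular_apply, _root_.mul_inv_rev, DomMulAct.mk_mul,
      mul_smul]
  have hκ : Continuous κ := continuous_leftRegular μ _
  have hWκ : ∀ g x, W g (κ x) = κ (g * x) := fun g x => (hmul g x _).symm
  let T : G → Lp ℂ 2 μ →L[ℂ] Lp ℂ 2 μ := fun x => InnerProductSpace.rankOne ℂ (κ x) (κ x)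
  have hT : Continuous T := by
    have h1 : Continuous fun x => ContinuousLinearMap.smulRightL ℂ (Lp ℂ 2 μ) (Lp ℂ 2 μ)
        (innerSL ℂ (κ x)) :=
      (ContinuousLinearMap.smulRightL ℂ _ _).continuous.comp ((innerSL ℂ).continuous.comp hκ)
    exact h1.clm_apply hκ
  have hTi : Integrable T μ :=
    hT.integrable_of_hasCompactSupport (HasCompactSupport.of_compactSpace _)
  let A : Lp ℂ 2 μ →L[ℂ] Lp ℂ 2 μ := ∫ x, T x ∂μ
  have hA : ∀ v, A v = ∫ x, inner ℂ (κ x) v • κ x ∂μ := fun v =>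
    ContinuousLinearMap.integral_apply hTi v
  have hAi : ∀ v, Integrable (fun x => inner ℂ (κ x) v • κ x) μ := fun v =>
    Continuous.integrable_of_hasCompactSupport (f := fun x => inner ℂ (κ x) v • κ x)
      (Continuous.smul (f := fun x => inner ℂ (κ x) v) (hκ.inner continuous_const) hκ)
      (HasCompactSupport.of_compactSpace _)
  have hinner : ∀ w v, inner ℂ w (A v) = ∫ x, inner ℂ (κ x) v * inner ℂ w (κ x) ∂μ := by
    intro w v
    rw [hA, ← integral_inner (hAi v)]
    simp only [inner_smul_right]
  have hcompact : IsCompactOperator A := by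
    refine Convex.integral_mem (s := {S : Lp ℂ 2 μ →L[ℂ] Lp ℂ 2 μ | IsCompactOperator S}) ?_
      isClosed_setOfPred_isCompactOperator (Filter.Eventually.of_forall fun x => ?_) hTi
    · intro S hS S' hS' a c _ _ _
      exact (IsCompactOperator.smul hS a).add (IsCompactOperator.smul hS' c)
    · exact (isCompactOperator_of_locallyCompactSpace_rng
        (ContinuousLinearMap.toSpanSingleton ℂ (κ x))).comp_clm (innerSL ℂ (κ x))
  have hsymm : A.IsSymmetric := by
    intro v w
    change inner ℂ (A v) w = inner ℂ v (A w)
    rw [← inner_conj_symm, hinner, hinner, ← integral_conj]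
    refine integral_congr_ae (Filter.Eventually.of_forall fun x => ?_)
    simp only [map_mul, inner_conj_symm]
    ring
  have hcomm : ∀ g v, A (W g v) = W g (A v) := by
    intro g v
    have h1 : W g (A v) = ∫ x, inner ℂ (κ x) v • κ (g * x) ∂μ := by
      rw [hA]
      refine ((W g).toContinuousLinearMap.integral_comp_comm (hAi v)).symm.trans ?_
      refine integral_congr_ae (Filter.Eventually.of_forall fun x => ?_)
      exact ((W g).map_smul _ _).trans (by rw [hWκ])
    rw [h1, hA, ← integral_mul_left_eq_self (fun x => inner ℂ (κ x) (W g v) • κ x) g]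
    refine integral_congr_ae (Filter.Eventually.of_forall fun x => ?_)
    simp only
    rw [← hWκ g x, (W g).inner_map_map]
  have hinvc : ∀ (e : Lp ℂ 2 μ) (x : G), inner ℂ (κ x) e = inner ℂ (κ 1) (W x⁻¹ e) := by
    intro e x
    rw [← (W x).inner_map_map (κ 1), hWκ, mul_one, ← hmul, mul_inv_cancel, hone]
  -- An eigenspace for $l\ne0$ is finite dimensional and invariant, so it carries a matrix
  -- representation $\rho$. Then $l\,c_j$ becomes a double integral, and the substitution $x\mapsto
  -- yx$ isolates an inner integral of $f$ against a conjugated coefficient of $\rho$, which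
  -- vanishes.
  have hzero : ∀ l : ℂ, Module.End.HasEigenvalue (A : Module.End ℂ (Lp ℂ 2 μ)) l → l = 0 := by
    intro l hl
    by_contra hl0
    let V := Module.End.eigenspace (A : Module.End ℂ (Lp ℂ 2 μ)) l
    have : FiniteDimensional ℂ V := ContinuousLinearMap.finite_dimensional_eigenspace hcompact l hl0
    have hmem : ∀ v, v ∈ V ↔ A v = l • v := fun v => Module.End.mem_eigenspace_iff
    obtain ⟨ρ, hρ, hWρ⟩ := exists_matrix_rep W hone hmul (continuous_leftRegular μ) V
      (fun g v hv => by
        rw [hmem] at hv ⊢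
        rw [hcomm, hv, map_smul])
    have hρc : ∀ i j, Continuous fun x => (ρ x : Matrix _ _ ℂ) i j := fun i j =>
      (continuous_subtype_val.comp hρ).matrix_elem i j
    let e := stdOrthonormalBasis ℂ V
    let c : Fin (Module.finrank ℂ V) → ℂ := fun i => inner ℂ (κ 1) (e i : Lp ℂ 2 μ)
    have hp : ∀ x j, inner ℂ (κ x) (e j : Lp ℂ 2 μ) = ∑ i, (ρ x⁻¹ : Matrix _ _ ℂ) i j * c i := by
      intro x j
      rw [hinvc, hWρ, inner_sum]
      simp only [inner_smul_right]
      rfl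
    have hκκ : ∀ x, inner ℂ (κ 1) (κ x) = ∫ y, star (f (x⁻¹ * y)) * f y ∂μ := by
      intro x
      have h1 : κ 1 = ContinuousMap.toLp 2 μ ℂ (star f) := hone _
      have h2 : κ x = ContinuousMap.toLp 2 μ ℂ ((star f).comp ⟨fun y => x⁻¹ * y, by fun_prop⟩) :=
        leftRegular_toLp μ x _
      rw [h1, h2, ContinuousMap.inner_toLp]
      refine integral_congr_ae (Filter.Eventually.of_forall fun y => ?_)
      simp
    have hc : ∀ j, c j = 0 := by
      intro j
      have h1 : l * c j = inner ℂ (κ 1) (A (e j : Lp ℂ 2 μ)) := by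
        rw [(hmem _).1 (e j).2, inner_smul_right]
      have h2 : inner ℂ (κ 1) (A (e j : Lp ℂ 2 μ)) = 0 := by
        rw [hinner]
        simp only [hκκ, hp, ← integral_const_mul]
        rw [integral_integral_swap_of_hasCompactSupport
          (f := fun x y => (∑ i, (ρ x⁻¹ : Matrix _ _ ℂ) i j * c i) * (star (f (x⁻¹ * y)) * f y))]
        · have h3 : ∀ y, ∫ x, (∑ i, (ρ x⁻¹ : Matrix _ _ ℂ) i j * c i) *
              (star (f (x⁻¹ * y)) * f y) ∂μ = ∫ x, ∑ i, ∑ k, c i * star (f x⁻¹) * (ρ x⁻¹ : Matrix _ _ ℂ) i k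
                * (f y * star ((ρ y).1 j k)) ∂μ := by
            intro y
            rw [← integral_mul_left_eq_self _ y]
            refine integral_congr_ae (Filter.Eventually.of_forall fun x => ?_)
            have h4 : (ρ y⁻¹).1 = star (ρ y).1 := by
              rw [map_inv]; rfl
            simp only [_root_.mul_inv_rev, map_mul, Submonoid.coe_mul, h4, Matrix.mul_apply,
              inv_mul_cancel_right, Matrix.star_apply, Finset.sum_mul]
            exact Finset.sum_congr rfl fun i _ => Finset.sum_congr rfl fun k _ => by ring
          simp only [h3]
          rw [integral_integral_swap_of_hasCompactSupport
            (f := fun y x => ∑ i, ∑ k, c i * star (f x⁻¹) * (ρ x⁻¹ : Matrix _ _ ℂ) i k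
                * (f y * star ((ρ y).1 j k)))]
          · refine integral_eq_zero_of_ae (Filter.Eventually.of_forall fun x => ?_)
            have hi : ∀ i k, Integrable (fun y => c i * star (f x⁻¹) * (ρ x⁻¹ : Matrix _ _ ℂ) i k
                * (f y * star ((ρ y).1 j k))) μ := fun i k =>
              continuous_integrable μ (continuous_const.mul (f.continuous.mul (hρc j k).star))
            simp only [Pi.zero_apply]
            rw [integral_finsetSum _ fun i _ => integrable_finsetSum _ fun k _ => hi i k]
            refine Finset.sum_eq_zero fun i _ => ?_
            rw [integral_finsetSum _ fun k _ => hi i k]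
            refine Finset.sum_eq_zero fun k _ => ?_
            rw [integral_const_mul, integral_mul_star_rep_eq_zero μ f.continuous h0 ρ hρ, mul_zero]
          · have h5 : ∀ i k, Continuous fun p : G × G => (ρ p.2⁻¹ : Matrix _ _ ℂ) i k := fun i k =>
              (hρc i k).comp continuous_snd.inv
            have h6 : ∀ k, Continuous fun p : G × G => (ρ p.1 : Matrix _ _ ℂ) j k := fun k =>
              (hρc j k).comp continuous_fst
            simp only [Function.uncurry_def]
            fun_prop
          · exact HasCompactSupport.of_compactSpace _
        · have h5 : ∀ i, Continuous fun p : G × G => (ρ p.1⁻¹ : Matrix _ _ ℂ) i j := fun i =>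
            (hρc i j).comp continuous_fst.inv
          simp only [Function.uncurry_def]
          fun_prop
        · exact HasCompactSupport.of_compactSpace _
      rw [h2] at h1
      exact (mul_eq_zero.1 h1).resolve_left hl0
    have he : ∀ j, (e j : Lp ℂ 2 μ) = 0 := by
      intro j
      have h1 := (hmem _).1 (e j).2
      rw [hA] at h1
      simp only [hp, hc, mul_zero, Finset.sum_const_zero, zero_smul, integral_zero] at h1
      exact (smul_eq_zero.1 h1.symm).resolve_left hl0
    obtain ⟨v, hv, hv0⟩ := hl.exists_hasEigenvector
    have h1 := congrArg (Subtype.val : V → Lp ℂ 2 μ) (e.sum_repr' ⟨v, hv⟩)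
    refine hv0 (h1.symm.trans ?_)
    simp [he]
  -- A compact self-adjoint operator without nonzero eigenvalues is zero. Then
  -- $\langle\kappa(1),A\kappa(1)\rangle=\int|\langle\kappa(x),\kappa(1)\rangle|^2dx=0$; by
  -- continuity the integrand vanishes at $x=1$, whence $f=0$.
  have hA0 : A = 0 := (ContinuousLinearMap.eq_zero_of_forall_hasEigenvalue_eq_zero hcompact hsymm).1 hzero
  have hκ1 : inner ℂ (κ 1) (κ 1) = 0 := by
    have h1 : ∫ x, ‖inner ℂ (κ x) (κ 1)‖ ^ 2 ∂μ = 0 := by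
      have h2 := hinner (κ 1) (κ 1)
      rw [hA0, _root_.zero_apply, inner_zero_right] at h2
      rw [← Complex.ofReal_inj, Complex.ofReal_zero, h2]
      refine integral_ofReal.symm.trans (integral_congr_ae (Filter.Eventually.of_forall fun x => ?_))
      simp only
      rw [← inner_conj_symm (κ 1) (κ x), Complex.mul_conj, Complex.normSq_eq_norm_sq]
      rfl
    have hc : Continuous fun x => ‖inner ℂ (κ x) (κ 1)‖ ^ 2 := (hκ.inner continuous_const).norm.pow 2
    have h3 := (integral_eq_zero_iff_of_nonneg (fun x => by positivity)
      (hc.integrable_of_hasCompactSupport (HasCompactSupport.of_compactSpace _))).1 h1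
    have h4 : ‖(inner ℂ (κ 1) (κ 1) : ℂ)‖ ^ 2 = 0 :=
      congrFun ((hc.ae_eq_iff_eq μ continuous_const).1 h3) 1
    exact norm_eq_zero.1 (pow_eq_zero_iff two_ne_zero |>.1 h4)
  have h1 : ContinuousMap.toLp 2 μ ℂ (star f) = 0 := (hone _).symm.trans (inner_self_eq_zero.1 hκ1)
  have h2 : star f = 0 := ContinuousMap.toLp_injective (p := 2) (𝕜 := ℂ) μ (h1.trans (map_zero _).symm)
  exact star_eq_zero.1 h2

end PeterWeyl

end LieSymbol
end

noncomputable section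

namespace LieSymbol

/-! ### Rapid decay of coefficients and convergence of Fourier series -/

section FourierSeries

open Matrix

variable {E G : Type*} [NormedAddCommGroup E] [NormedSpace ℝ E] [FiniteDimensional ℝ E]
  [TopologicalSpace G] [ChartedSpace E G] [Group G] [LieGroup 𝓘(ℝ, E) ∞ G] [CompactSpace G]
  [T2Space G] [MeasurableSpace G] [BorelSpace G] (μ : Measure G) [μ.IsHaarMeasure]
  [IsProbabilityMeasure μ]

theorem integrable_smoothFn (f : SmoothFn E G) : Integrable f μ :=
  f.contMDiff.continuous.integrable_of_hasCompactSupport (HasCompactSupport.of_compactSpace _)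

/-- The integral of a left-invariant derivative vanishes. -/
theorem integral_lieDeriv (X : GroupLieAlgebra 𝓘(ℝ, E) G) (f : SmoothFn E G) :
    ∫ x, lieDeriv X f x ∂μ = 0 := by
  have := topologicalGroup_of_lieGroup 𝓘(ℝ, E) ∞ (G := G)
  have := isMulRightInvariant_of_isProbabilityMeasure μ
  obtain ⟨X, rfl⟩ : ∃ X' : E, toLie G X' = X := ⟨X, rfl⟩
  obtain ⟨R, hR, L, hL, hsub, hlip⟩ := exists_norm_sub_le_of_lieDeriv_le (E := E) (G := G)
  obtain ⟨M, hM, hf⟩ := exists_lieDeriv_le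
    ((Module.finBasis ℝ E : Module.Basis _ ℝ E) :
      Module.Basis (Fin (Module.finrank ℝ E)) ℝ (GroupLieAlgebra 𝓘(ℝ, E) G)) f
  let φ := chartAt E (1 : G)
  let o : E := φ 1
  have hψo : φ.symm o = 1 := φ.left_inv (mem_chart_source E 1)
  -- Right translation along a curve with velocity `X` at the identity. Invariance makes the
  -- integral constant in `t`; its derivative at 0 is the integral of `lieDeriv X f`.
  let F : ℝ → G → ℂ := fun t x => f (x * φ.symm (o + t • X))
  have hF0 : ∀ x, F 0 x = f x := fun x => by simp only [F, zero_smul, add_zero, hψo, mul_one]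
  have hFc : ∀ t, Continuous (F t) := fun t =>
    f.contMDiff.continuous.comp (continuous_id.mul continuous_const)
  have hs : {t : ℝ | o + t • X ∈ Metric.ball o R} ∈ nhds (0 : ℝ) := by
    have hc : Continuous fun t : ℝ => o + t • X := by fun_prop
    refine hc.continuousAt.preimage_mem_nhds (Metric.isOpen_ball.mem_nhds ?_)
    simpa using hR
  have hmain := hasFDerivAt_integral_of_dominated_loc_of_lip' (𝕜 := ℝ) (μ := μ) (F := F)
    (F' := fun x => (1 : ℝ →L[ℝ] ℝ).smulRight (lieDeriv (toLie G X) f x))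
    (bound := fun _ => M * L * ‖X‖) hs (fun t _ => ?_) ?_ ?_
    (Filter.Eventually.of_forall fun x t ht => ?_) (integrable_const _)
    (Filter.Eventually.of_forall fun x => ?_)
  · have hconst : (fun t => ∫ x, F t x ∂μ) = fun _ => ∫ x, f x ∂μ := by
      funext t
      exact integral_mul_right_eq_self f _
    have h1 := hmain.2
    rw [hconst] at h1
    have h2 := congrArg (fun l : ℝ →L[ℝ] ℂ => l 1) (h1.unique (hasFDerivAt_const _ _))
    rw [ContinuousLinearMap.integral_apply hmain.1] at h2
    simpa using h2
  · exact (hFc t).stronglyMeasurable_of_hasCompactSupport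
      (HasCompactSupport.of_compactSpace _) |>.aestronglyMeasurable
  · exact continuous_integrable μ (hFc 0)
  · have hc : Continuous fun x => (1 : ℝ →L[ℝ] ℝ).smulRight (lieDeriv (toLie G X) f x) :=
      (ContinuousLinearMap.smulRightL ℝ ℝ ℂ 1).continuous.comp
        (lieDeriv (toLie G X) f).contMDiff.continuous
    exact hc.stronglyMeasurable_of_hasCompactSupport
      (HasCompactSupport.of_compactSpace _) |>.aestronglyMeasurable
  · rw [hF0, sub_zero]
    refine (hlip f M hM hf x _ ht).trans (le_of_eq ?_)
    rw [show o + t • X - chartAt E (1 : G) 1 = t • X from add_sub_cancel_left _ _, norm_smul]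
    ring
  · have hd : HasFDerivAt (fun e => leftTransl x f (φ.symm e))
        (fderiv ℝ (fun e => leftTransl x f (φ.symm e)) o) (o + (0 : ℝ) • X) := by
      rw [zero_smul, add_zero]
      exact ((contDiffAt_comp_chart_symm (leftTransl x f)
        (φ.map_source (mem_chart_source E 1))).differentiableAt (by simp)).hasFDerivAt
    have hl : HasDerivAt (fun t : ℝ => o + t • X) X 0 := by
      simpa using ((hasDerivAt_id (0 : ℝ)).smul_const X).const_add o
    have h1 := (hd.comp_hasDerivAt (0 : ℝ) hl).hasFDerivAt
    have h2 : fderiv ℝ (fun e => leftTransl x f (φ.symm e)) o X = lieDeriv (toLie G X) f x := by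
      rw [← lieDeriv_one_eq_fderiv X, ← lieDeriv_apply_eq_one]
    rw [← h2]
    exact h1

/-- The integrals of a smooth function against the matrix coefficients of `η`. -/
def coeffIntegral (c : SmoothFn E G) (η : UIrrep G) : Matrix (Fin η.dim) (Fin η.dim) ℂ :=
  Matrix.of fun i j => ∫ x, c x * η.mat x i j ∂μ

theorem integrable_mul_coeff (c : SmoothFn E G) (η : UIrrep G) (i j : Fin η.dim) :
    Integrable (fun x => c x * η.mat x i j) μ :=
  integrable_smoothFn μ (c * η.coeff E i j)

theorem coeffIntegral_sub (c c' : SmoothFn E G) (η : UIrrep G) :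
    coeffIntegral μ (c - c') η = coeffIntegral μ c η - coeffIntegral μ c' η := by
  ext i j
  simp only [coeffIntegral, Matrix.of_apply, Matrix.sub_apply]
  rw [← integral_sub (integrable_mul_coeff μ c η i j) (integrable_mul_coeff μ c' η i j)]
  exact integral_congr_ae (Filter.Eventually.of_forall fun x => sub_mul _ _ _)

theorem coeffIntegral_sum {κ : Type*} (s : Finset κ) (c : κ → SmoothFn E G) (η : UIrrep G) :
    coeffIntegral μ (∑ k ∈ s, c k) η = ∑ k ∈ s, coeffIntegral μ (c k) η := by
  ext i j
  simp only [coeffIntegral, Matrix.of_apply, Matrix.sum_apply]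
  rw [← integral_finsetSum _ fun k _ => integrable_mul_coeff μ (c k) η i j]
  refine integral_congr_ae (Filter.Eventually.of_forall fun x => ?_)
  simp only [smoothFn_sum_apply, Finset.sum_mul]

/-- Integration by parts. -/
theorem coeffIntegral_lieDeriv (X : GroupLieAlgebra 𝓘(ℝ, E) G) (c : SmoothFn E G) (η : UIrrep G) :
    coeffIntegral μ (lieDeriv X c) η = -(coeffIntegral μ c η * η.diff X) := by
  ext i j
  simp only [coeffIntegral, Matrix.of_apply, Matrix.neg_apply, Matrix.mul_apply,
    ← integral_mul_const]
  rw [← integral_finsetSum _ fun k _ => (integrable_mul_coeff μ c η i k).mul_const _]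
  have h := integral_lieDeriv μ X (c * η.coeff E i j)
  have h1 : ∀ x, lieDeriv X (c * η.coeff E i j) x =
      lieDeriv X c x * η.mat x i j + ∑ k, c x * η.mat x i k * η.diff X k j := by
    intro x
    rw [lieDeriv_mul, lieDeriv_coeff]
    change lieDeriv X c x * η.mat x i j + c x * (∑ k, η.diff X k j • η.coeff E i k) x = _
    rw [smoothFn_sum_apply, Finset.mul_sum]
    congr 1
    exact Finset.sum_congr rfl fun k _ => by
      rw [smul_apply, UIrrep.coeff_apply]; ring
  simp only [h1] at h
  rw [integral_add (integrable_mul_coeff μ _ η i j) (integrable_finsetSum _ fun k _ =>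
    (integrable_mul_coeff μ c η i k).mul_const _)] at h
  exact eq_neg_of_add_eq_zero_left h

variable {b : Module.Basis (Fin (Module.finrank ℝ E)) ℝ (GroupLieAlgebra 𝓘(ℝ, E) G)}

theorem coeffIntegral_laplacian (hb : IsBiinvariantFrame b) (c : SmoothFn E G) (η : UIrrep G) :
    coeffIntegral μ (laplacian b c) η = (-(lambdaSq b η : ℂ)) • coeffIntegral μ c η := by
  have h : laplacian b c = ∑ k, lieDeriv (b k) (lieDeriv (b k) c) := by
    simp only [laplacian, LinearMap.sum_apply, sq, Module.End.mul_apply]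
  rw [h, coeffIntegral_sum]
  simp only [coeffIntegral_lieDeriv, Matrix.neg_mul, neg_neg, Matrix.mul_assoc]
  rw [← Matrix.mul_sum, (casimir_eq hb η).2, Matrix.mul_smul, Matrix.mul_one]

theorem norm_mat_apply_le (η : UIrrep G) (x : G) (i j : Fin η.dim) : ‖η.mat x i j‖ ≤ 1 := by
  refine (norm_apply_le_opNorm _ i j).trans ?_
  refine ContinuousLinearMap.opNorm_le_bound _ zero_le_one fun v => ?_
  rw [UIrrep.norm_mat_apply, one_mul]

/-- The coefficients of a smooth function decay rapidly. -/
theorem exists_coeffIntegral_le (hb : IsBiinvariantFrame b) (N : ℕ) : ∀ c : SmoothFn E G,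
    ∃ C, 0 ≤ C ∧ ∀ (η : UIrrep G) i j, ‖coeffIntegral μ c η i j‖ * japanese b η ^ (2 * N) ≤ C := by
  induction N with
  | zero =>
    intro c
    obtain ⟨C, hC⟩ := isCompact_univ.exists_bound_of_continuousOn
      c.contMDiff.continuous.continuousOn
    have hC0 : 0 ≤ C := (norm_nonneg _).trans (hC 1 trivial)
    refine ⟨C, hC0, fun η i j => ?_⟩
    rw [mul_zero, pow_zero, mul_one]
    refine (norm_integral_le_of_norm_le_const (C := C)
      (Filter.Eventually.of_forall fun x => ?_)).trans (le_of_eq (by simp))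
    rw [norm_mul]
    exact (mul_le_mul (hC x trivial) (norm_mat_apply_le η x i j) (norm_nonneg _) hC0).trans_eq
      (mul_one C)
  | succ N ih =>
    intro c
    -- Applying $1-\mathcal L$ multiplies the coefficients by $\langle\eta\rangle^2$, which gains
    -- two powers at each step.
    obtain ⟨C, hC0, hC⟩ := ih (c - laplacian b c)
    refine ⟨C, hC0, fun η i j => ?_⟩
    have h1 := hC η i j
    have h2 : japanese b η ^ 2 = 1 + lambdaSq b η :=
      Real.sq_sqrt (by linarith [(casimir_eq hb η).1])
    have h3 : coeffIntegral μ (c - laplacian b c) η i j =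
        ((japanese b η ^ 2 : ℝ) : ℂ) * coeffIntegral μ c η i j := by
      rw [coeffIntegral_sub, coeffIntegral_laplacian μ hb, Matrix.sub_apply, Matrix.smul_apply, h2,
        smul_eq_mul]
      push_cast
      ring
    rw [h3, norm_mul, Complex.norm_real, Real.norm_of_nonneg (by positivity)] at h1
    refine le_trans (le_of_eq ?_) h1
    ring

/-- The component of a smooth function along the conjugated matrix coefficients of `η`. -/
def fourierPart (c : SmoothFn E G) (η : UIrrep G) : SmoothFn E G :=
  ∑ i, ∑ j, ((η.dim : ℂ) * coeffIntegral μ c η i j) • conjFn (η.coeff E i j)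

/-- The projection on a Fourier component commutes with left-invariant fields, because the derived
matrices are skew-Hermitian. Uniform convergence of the series for all derivatives thus comes from
the case without derivatives. -/
theorem lieDeriv_fourierPart (X : GroupLieAlgebra 𝓘(ℝ, E) G) (c : SmoothFn E G) (η : UIrrep G) :
    lieDeriv X (fourierPart μ c η) = fourierPart μ (lieDeriv X c) η := by
  have hskew : ∀ k j, star (η.diff X k j) = -η.diff X j k := fun k j => by
    rw [← Matrix.conjTranspose_apply, UIrrep.diff_conjTranspose, Matrix.neg_apply]
  ext x
  simp only [fourierPart, map_sum, map_smul, lieDeriv_conjFn, lieDeriv_coeff,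
    coeffIntegral_lieDeriv, smoothFn_sum_apply, smul_apply, conjFn_apply, UIrrep.coeff_apply,
    Matrix.neg_apply, Matrix.mul_apply, star_sum, star_mul', hskew, Finset.mul_sum, Finset.sum_mul,
    mul_neg, neg_mul, Finset.sum_neg_distrib]
  congr 1
  refine Finset.sum_congr rfl fun i _ => ?_
  rw [Finset.sum_comm]
  exact Finset.sum_congr rfl fun j _ => Finset.sum_congr rfl fun k _ => by ring

theorem lieWord_fourierPart (l : List (GroupLieAlgebra 𝓘(ℝ, E) G)) (c : SmoothFn E G)
    (η : UIrrep G) : lieWord l (fourierPart μ c η) = fourierPart μ (lieWord l c) η := by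
  induction l with
  | nil => rfl
  | cons X l ih =>
    rw [lieWord_cons]
    change lieDeriv X (lieWord l _) = fourierPart μ (lieDeriv X (lieWord l c)) η
    rw [ih, lieDeriv_fourierPart]

theorem out_not_equiv {κ κ' : Quotient (uirrepSetoid G)} (h : κ ≠ κ') :
    ¬ (uirrepSetoid G).r κ.out κ'.out := fun hr => by
  have h1 := Quotient.sound hr
  rw [Quotient.out_eq, Quotient.out_eq] at h1
  exact h h1

/-- The series of the coefficients of a smooth function, with polynomial weights, is absolutely
convergent. -/
theorem exists_sum_coeffIntegral_le (hb : IsBiinvariantFrame b) (M : ℕ) (c : SmoothFn E G) :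
    ∃ C, 0 ≤ C ∧ ∀ F : Finset (Quotient (uirrepSetoid G)),
      ∑ κ ∈ F, (∑ i, ∑ j, (κ.out.dim : ℝ) * ‖coeffIntegral μ c κ.out i j‖) *
        japanese b κ.out ^ M ≤ C := by
  classical
  obtain ⟨K, B, hB, hsum⟩ := exists_sum_dim_sq_mul_japanese_le μ hb
  -- Of the $2(K+M)$ powers of decay, $K+M$ absorb the weight and one of the three factors $d_\eta$;
  -- the rest leaves $d_\eta^2\langle\eta\rangle^{-K}$ at most.
  obtain ⟨C, hC, hdecay⟩ := exists_coeffIntegral_le μ hb (K + M) c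
  refine ⟨C * B * B, by positivity, fun F => ?_⟩
  have hterm : ∀ η : UIrrep G, (∑ i, ∑ j, (η.dim : ℝ) * ‖coeffIntegral μ c η i j‖) *
      japanese b η ^ M ≤ C * B * ((η.dim : ℝ) ^ 2 * (japanese b η ^ K)⁻¹) := by
    intro η
    have hj := one_le_japanese hb η
    have hjp := japanese_pos hb η
    -- The polynomial bound for the dimension is the summability bound for the one element family.
    have h1 : (η.dim : ℝ) ≤ B * japanese b η ^ K := by
      have h2 := hsum {η} (fun a ha c hc hne => by
        rw [Finset.mem_singleton] at ha hc
        exact absurd (ha.trans hc.symm) hne)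
      rw [Finset.sum_singleton, ← div_eq_mul_inv, div_le_iff₀ (by positivity)] at h2
      have h3 : (1 : ℝ) ≤ η.dim := by exact_mod_cast η.dim_pos
      nlinarith
    have h2 : ∀ i j, ‖coeffIntegral μ c η i j‖ ≤ C * (japanese b η ^ (2 * (K + M)))⁻¹ := fun i j => by
      rw [← div_eq_mul_inv, le_div_iff₀ (by positivity)]
      exact hdecay η i j
    calc (∑ i, ∑ j, (η.dim : ℝ) * ‖coeffIntegral μ c η i j‖) * japanese b η ^ M
        ≤ (∑ _i : Fin η.dim, ∑ _j : Fin η.dim,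
          (η.dim : ℝ) * (C * (japanese b η ^ (2 * (K + M)))⁻¹)) * japanese b η ^ M := by
          gcongr with i _ j _
          exact h2 i j
      _ = (η.dim : ℝ) * (C * (η.dim : ℝ) ^ 2 * ((japanese b η ^ (2 * (K + M)))⁻¹ *
            japanese b η ^ M)) := by
          simp only [Finset.sum_const, Finset.card_univ, Fintype.card_fin, nsmul_eq_mul]
          ring
      _ ≤ (B * japanese b η ^ K) * (C * (η.dim : ℝ) ^ 2 * ((japanese b η ^ (2 * (K + M)))⁻¹ *
            japanese b η ^ M)) := by gcongr
      _ = C * B * ((η.dim : ℝ) ^ 2 * (japanese b η ^ (K + M))⁻¹) := by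
          rw [mul_comm 2, pow_mul, sq]
          simp only [pow_add]
          field_simp
      _ ≤ _ := by
          gcongr
          exact Nat.le_add_right _ _
  have hinj : Function.Injective (Quotient.out : Quotient (uirrepSetoid G) → UIrrep G) :=
    Quotient.out_injective
  refine (Finset.sum_le_sum fun κ _ => hterm κ.out).trans ?_
  rw [← Finset.mul_sum]
  refine mul_le_mul_of_nonneg_left ?_ (by positivity)
  have h := hsum (F.image Quotient.out) (fun η hη ζ hζ hne => by
    obtain ⟨κ, -, rfl⟩ := Finset.mem_image.1 hη
    obtain ⟨κ', -, rfl⟩ := Finset.mem_image.1 hζ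
    exact out_not_equiv fun h => hne (congrArg _ h.symm))
  rwa [Finset.sum_image hinj.injOn] at h

theorem norm_fourierPart_apply_le (c : SmoothFn E G) (η : UIrrep G) (x : G) :
    ‖fourierPart μ c η x‖ ≤ ∑ i, ∑ j, (η.dim : ℝ) * ‖coeffIntegral μ c η i j‖ := by
  simp only [fourierPart, smoothFn_sum_apply]
  refine (norm_sum_le _ _).trans (Finset.sum_le_sum fun i _ => (norm_sum_le _ _).trans
    (Finset.sum_le_sum fun j _ => ?_))
  rw [smul_apply, norm_mul, norm_mul, Complex.norm_natCast, conjFn_apply, norm_star,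
    UIrrep.coeff_apply]
  exact mul_le_of_le_one_right (by positivity) (norm_mat_apply_le η x i j)

theorem integral_fourierPart_mul_coeff (c : SmoothFn E G) (η ζ : UIrrep G) (k l : Fin ζ.dim)
    (h : ¬ (uirrepSetoid G).r η ζ) : ∫ x, fourierPart μ c η x * ζ.mat x k l ∂μ = 0 := by
  have := topologicalGroup_of_lieGroup 𝓘(ℝ, E) ∞ (G := G)
  have hi : ∀ i j, Integrable (fun x => ((η.dim : ℂ) * coeffIntegral μ c η i j) *
      (ζ.mat x k l * star (η.mat x i j))) μ := fun i j => continuous_integrable μ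
    (continuous_const.mul ((ζ.continuous_mat_apply k l).mul (η.continuous_mat_apply i j).star))
  have h1 : ∀ x, fourierPart μ c η x * ζ.mat x k l = ∑ i, ∑ j,
      ((η.dim : ℂ) * coeffIntegral μ c η i j) * (ζ.mat x k l * star (η.mat x i j)) := by
    intro x
    simp only [fourierPart, smoothFn_sum_apply, smul_apply, conjFn_apply, UIrrep.coeff_apply,
      Finset.sum_mul]
    exact Finset.sum_congr rfl fun i _ => Finset.sum_congr rfl fun j _ => by ring
  simp only [h1]
  rw [integral_finsetSum _ fun i _ => integrable_finsetSum _ fun j _ => hi i j]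
  refine Finset.sum_eq_zero fun i _ => ?_
  rw [integral_finsetSum _ fun j _ => hi i j]
  refine Finset.sum_eq_zero fun j _ => ?_
  rw [integral_const_mul, integral_coeff_mul_conj_of_not_equiv μ h, mul_zero]

theorem integral_fourierPart_mul_coeff_self (c : SmoothFn E G) (η : UIrrep G) (k l : Fin η.dim) :
    ∫ x, fourierPart μ c η x * η.mat x k l ∂μ = coeffIntegral μ c η k l := by
  have := topologicalGroup_of_lieGroup 𝓘(ℝ, E) ∞ (G := G)
  have hi : ∀ i j, Integrable (fun x => ((η.dim : ℂ) * coeffIntegral μ c η i j) *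
      (η.mat x k l * star (η.mat x i j))) μ := fun i j => continuous_integrable μ
    (continuous_const.mul ((η.continuous_mat_apply k l).mul (η.continuous_mat_apply i j).star))
  have h1 : ∀ x, fourierPart μ c η x * η.mat x k l = ∑ i, ∑ j,
      ((η.dim : ℂ) * coeffIntegral μ c η i j) * (η.mat x k l * star (η.mat x i j)) := by
    intro x
    simp only [fourierPart, smoothFn_sum_apply, smul_apply, conjFn_apply, UIrrep.coeff_apply,
      Finset.sum_mul]
    exact Finset.sum_congr rfl fun i _ => Finset.sum_congr rfl fun j _ => by ring
  have hd : (η.dim : ℂ) ≠ 0 := by exact_mod_cast η.dim_pos.ne'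
  simp only [h1]
  rw [integral_finsetSum _ fun i _ => integrable_finsetSum _ fun j _ => hi i j]
  have h2 : ∀ i, ∫ x, ∑ j, ((η.dim : ℂ) * coeffIntegral μ c η i j) *
      (η.mat x k l * star (η.mat x i j)) ∂μ = if k = i then coeffIntegral μ c η i l else 0 := by
    intro i
    rw [integral_finsetSum _ fun j _ => hi i j]
    simp only [integral_const_mul, integral_coeff_mul_conj_self]
    rw [Finset.sum_eq_single l]
    · by_cases hk : k = i
      · simp only [hk, and_self, if_true]
        field_simp
      · simp [hk]
    · intro j _ hj
      simp [Ne.symm hj]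
    · simp
  rw [Finset.sum_congr rfl fun i _ => h2 i]
  simp

/-- Integration against a continuous function. -/
def integralCLM (w : C(G, ℂ)) : C(G, ℂ) →L[ℂ] ℂ :=
  LinearMap.mkContinuous
    { toFun := fun g => ∫ x, g x * w x ∂μ
      map_add' := fun g g' => by
        rw [← integral_add]
        · exact integral_congr_ae (Filter.Eventually.of_forall fun x => add_mul _ _ _)
        · exact (g * w).continuous.integrable_of_hasCompactSupport
            (HasCompactSupport.of_compactSpace _)
        · exact (g' * w).continuous.integrable_of_hasCompactSupport
            (HasCompactSupport.of_compactSpace _)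
      map_smul' := fun a g => by
        simp only [ContinuousMap.smul_apply, smul_eq_mul, RingHom.id_apply, mul_assoc]
        exact integral_const_mul _ _ } ‖w‖
    (fun g => by
      refine (norm_integral_le_of_norm_le_const (Filter.Eventually.of_forall fun x => ?_)).trans
        (le_of_eq (by simp; rfl))
      exact (norm_mul_le _ _).trans ((mul_comm _ _).trans_le (mul_le_mul (w.norm_coe_le_norm x)
        (g.norm_coe_le_norm x) (norm_nonneg _) (norm_nonneg _))))

theorem integralCLM_apply (w g : C(G, ℂ)) : integralCLM μ w g = ∫ x, g x * w x ∂μ := rfl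

/-- The series converges absolutely in the supremum norm. Its sum has the same Fourier coefficients
as `c`, so the two agree by Peter-Weyl. -/
theorem hasSum_toCont_fourierPart (hb : IsBiinvariantFrame b) (c : SmoothFn E G) :
    HasSum (fun κ : Quotient (uirrepSetoid G) => toCont (fourierPart μ c κ.out)) (toCont c) := by
  have := topologicalGroup_of_lieGroup 𝓘(ℝ, E) ∞ (G := G)
  obtain ⟨C, hC, hsum⟩ := exists_sum_coeffIntegral_le μ hb 0 c
  have hsummable : Summable fun κ : Quotient (uirrepSetoid G) =>
      toCont (fourierPart μ c κ.out) := by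
    refine Summable.of_norm_bounded (g := fun κ : Quotient (uirrepSetoid G) =>
      ∑ i, ∑ j, (κ.out.dim : ℝ) * ‖coeffIntegral μ c κ.out i j‖) ?_ fun κ => ?_
    · refine summable_of_sum_le (c := C) (fun κ => by positivity) fun F => ?_
      simpa using hsum F
    · exact (ContinuousMap.norm_le _ (by positivity)).2 fun x => norm_fourierPart_apply_le μ c _ x
  obtain ⟨s, hs⟩ := hsummable
  suffices h : star (s - toCont c) = 0 by
    rw [star_eq_zero, sub_eq_zero] at h
    rwa [← h]
  have hclass : ∀ (κ : Quotient (uirrepSetoid G)) k l,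
      ∫ x, star (s - toCont c) x * star (κ.out.mat x k l) ∂μ = 0 := by
    intro κ k l
    have h1 := (integralCLM μ (toCont (κ.out.coeff E k l))).hasSum hs
    have h2 := hasSum_single (f := fun κ' : Quotient (uirrepSetoid G) =>
      integralCLM μ (toCont (κ.out.coeff E k l)) (toCont (fourierPart μ c κ'.out))) κ
      (fun κ' hκ => integral_fourierPart_mul_coeff μ c κ'.out κ.out k l (out_not_equiv hκ))
    have h3 := h1.unique h2
    have h4 : integralCLM μ (toCont (κ.out.coeff E k l)) (s - toCont c) = 0 := by
      rw [map_sub, h3, sub_eq_zero]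
      exact integral_fourierPart_mul_coeff_self μ c κ.out k l
    have h5 := congrArg star h4
    rw [star_zero, integralCLM_apply] at h5
    rw [← h5]
    refine Eq.trans ?_ integral_conj
    refine integral_congr_ae (Filter.Eventually.of_forall fun x => ?_)
    exact (star_mul' _ _).symm
  refine eq_zero_of_fourier_coeff_eq_zero μ _ fun η i j => ?_
  -- The coefficients of an arbitrary irreducible representation are combinations of those of the
  -- chosen representative of its class.
  obtain ⟨κ, V, hV, hV0⟩ : ∃ κ : Quotient (uirrepSetoid G), (uirrepSetoid G).r κ.out η :=
    ⟨_, Quotient.mk_out η⟩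
  obtain ⟨z, hz, hz1⟩ := hV.conjTranspose.exists_smul_one (fun h => hV0
    (Matrix.conjTranspose_eq_zero.1 h))
  rw [Matrix.conjTranspose_conjTranspose] at hz1
  have hη : ∀ x, η.mat x = z⁻¹ • (V * κ.out.mat x * Vᴴ) := by
    intro x
    rw [← hV x, Matrix.mul_assoc, hz1, Matrix.mul_smul, Matrix.mul_one, smul_smul,
      inv_mul_cancel₀ hz, one_smul]
  have h1 : ∀ x, star (s - toCont c) x * star (η.mat x i j) = ∑ a, ∑ d,
      (star z⁻¹ * star (V i d) * star (Vᴴ a j)) *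
        (star (s - toCont c) x * star (κ.out.mat x d a)) := by
    intro x
    rw [hη x]
    simp only [Matrix.smul_apply, Matrix.mul_apply, smul_eq_mul, star_mul', star_sum,
      Finset.mul_sum, Finset.sum_mul]
    exact Finset.sum_congr rfl fun a _ => Finset.sum_congr rfl fun d _ => by ring
  have hi : ∀ a d, Integrable (fun x => (star z⁻¹ * star (V i d) * star (Vᴴ a j)) *
        (star (s - toCont c) x * star (κ.out.mat x d a))) μ := fun a d => continuous_integrable μ
    (continuous_const.mul ((star (s - toCont c)).continuous.mul
      (κ.out.continuous_mat_apply d a).star))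
  simp only [h1]
  rw [integral_finsetSum _ fun a _ => integrable_finsetSum _ fun d _ => hi a d]
  refine Finset.sum_eq_zero fun a _ => ?_
  rw [integral_finsetSum _ fun d _ => hi a d]
  refine Finset.sum_eq_zero fun d _ => ?_
  rw [integral_const_mul, hclass, mul_zero]

/-- The Fourier series of a smooth function converges in `C^∞(G)`. -/
theorem hasSum_fourierPart (hb : IsBiinvariantFrame b) (c : SmoothFn E G) :
    HasSum (fun κ : Quotient (uirrepSetoid G) => fourierPart μ c κ.out) c := by
  change Filter.Tendsto _ _ (nhds c)
  rw [nhds_iInf, Filter.tendsto_iInf]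
  intro l
  rw [nhds_induced, Filter.tendsto_comap_iff]
  have h := hasSum_toCont_fourierPart μ hb (lieWord l c)
  change Filter.Tendsto _ _ (nhds (toCont (lieWord l c)))
  refine Filter.Tendsto.congr (fun F => ?_) h
  simp only [Function.comp_apply, map_sum, LinearMap.comp_apply, lieWord_fourierPart]


end FourierSeries

end LieSymbol
end

noncomputable section

namespace LieSymbol

/-! ### Multiplication by smooth functions preserves Fourier bounds -/

section Multiplication

open Matrix

variable {E G : Type*} [NormedAddCommGroup E] [NormedSpace ℝ E] [FiniteDimensional ℝ E]
  [TopologicalSpace G] [ChartedSpace E G] [Group G] [LieGroup 𝓘(ℝ, E) ∞ G] [CompactSpace G]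
  [T2Space G]

theorem smul_mul_smoothFn (z : ℂ) (f g : SmoothFn E G) : (z • f) * g = z • (f * g) := by
  ext x
  exact mul_assoc _ _ _

/-- The Fourier coefficient of `q T` at `ξ`, as a function of `q`. -/
def mulFourier (T : Distrib E G) (ξ : UIrrep G) :
    SmoothFn E G →ₗ[ℂ] Matrix (Fin ξ.dim) (Fin ξ.dim) ℂ where
  toFun q := fourier (mulDistrib q T) ξ
  map_add' p q := by
    ext i j
    simp only [fourier_apply, mulDistrib_apply, Matrix.add_apply, add_mul, map_add]
  map_smul' z q := by
    ext i j
    simp only [fourier_apply, mulDistrib_apply, Matrix.smul_apply, smul_mul_smoothFn, map_smul,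
      RingHom.id_apply]

theorem mulFourier_apply (T : Distrib E G) (ξ : UIrrep G) (q : SmoothFn E G) :
    mulFourier T ξ q = fourier (mulDistrib q T) ξ := rfl

variable [MeasurableSpace G] [BorelSpace G]
    {b : Module.Basis (Fin (Module.finrank ℝ E)) ℝ (GroupLieAlgebra 𝓘(ℝ, E) G)}

/-- A distribution is determined by its Fourier transform. -/
theorem eq_of_fourier_eq
    (μ : Measure G) [μ.IsHaarMeasure] [IsProbabilityMeasure μ] (hb : IsBiinvariantFrame b)
    {T S : Distrib E G}
    (h : fourier T = fourier S) : T = S := by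
  ext c
  have h1 := T.hasSum (hasSum_fourierPart μ hb c)
  have h2 := S.hasSum (hasSum_fourierPart μ hb c)
  refine h1.unique (h2.congr_fun fun κ => ?_)
  simp only [fourierPart, map_sum, map_smul]
  refine Finset.sum_congr rfl fun i _ => Finset.sum_congr rfl fun j _ => ?_
  rw [← fourier_apply, ← fourier_apply, h]

theorem opNorm_mulFourier_fourierPart_le
    (μ : Measure G) [μ.IsHaarMeasure] [IsProbabilityMeasure μ] (hb : IsBiinvariantFrame b)
    {T : Distrib E G} {C s : ℝ}
    (hC : 0 ≤ C) (hT : ∀ ζ, opNorm (fourier T ζ) ≤ C * japanese b ζ ^ s) (c : SmoothFn E G)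
    (η ξ : UIrrep G) :
    opNorm (mulFourier T ξ (fourierPart μ c η)) ≤
      (∑ i, ∑ j, (η.dim : ℝ) * ‖coeffIntegral μ c η i j‖) *
        (C * (2 * japanese b η) ^ |s| * japanese b ξ ^ s) := by
  simp only [fourierPart, map_sum, map_smul]
  refine (opNorm_sum_le _ _).trans ?_
  rw [Finset.sum_mul]
  refine Finset.sum_le_sum fun i _ => (opNorm_sum_le _ _).trans ?_
  rw [Finset.sum_mul]
  refine Finset.sum_le_sum fun j _ => ?_
  rw [opNorm_smul, norm_mul, Complex.norm_natCast, mulFourier_apply]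
  exact mul_le_mul_of_nonneg_left (opNorm_fourier_mul_coeff_le hb hC hT η i j ξ) (by positivity)

/-- Multiplication by a smooth function preserves the order of the Fourier transform. -/
theorem exists_opNorm_fourier_mulDistrib_le
    (μ : Measure G) [μ.IsHaarMeasure] [IsProbabilityMeasure μ] (hb : IsBiinvariantFrame b) (s : ℝ)
    (p : SmoothFn E G) :
    ∃ D, 0 ≤ D ∧ ∀ (T : Distrib E G) (C : ℝ), 0 ≤ C →
      (∀ ζ, opNorm (fourier T ζ) ≤ C * japanese b ζ ^ s) →
      ∀ ξ, opNorm (fourier (mulDistrib p T) ξ) ≤ D * C * japanese b ξ ^ s := by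
  obtain ⟨M, hM⟩ := exists_nat_ge |s|
  obtain ⟨B, hB, hsum⟩ := exists_sum_coeffIntegral_le μ hb M p
  -- The factor depends on `p` and `s` only, not on `T`. Symbol estimates need this to remain
  -- uniform in $x$.
  refine ⟨B * 2 ^ M, by positivity, fun T C hC hT ξ => ?_⟩
  have hj := japanese_pos hb ξ
  have hF : ∀ F : Finset (Quotient (uirrepSetoid G)),
      opNorm (mulFourier T ξ (∑ κ ∈ F, fourierPart μ p κ.out)) ≤
        B * 2 ^ M * C * japanese b ξ ^ s := by
    intro F
    rw [map_sum]
    refine (opNorm_sum_le _ _).trans ?_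
    have hterm : ∀ κ : Quotient (uirrepSetoid G),
        opNorm (mulFourier T ξ (fourierPart μ p κ.out)) ≤
          ((∑ i, ∑ j, (κ.out.dim : ℝ) * ‖coeffIntegral μ p κ.out i j‖) * japanese b κ.out ^ M) *
            (2 ^ M * C * japanese b ξ ^ s) := by
      intro κ
      refine (opNorm_mulFourier_fourierPart_le μ hb hC hT p κ.out ξ).trans ?_
      have hκ := one_le_japanese hb κ.out
      have h1 : (2 * japanese b κ.out) ^ |s| ≤ 2 ^ M * japanese b κ.out ^ M := by
        rw [← mul_pow, ← Real.rpow_natCast]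
        exact Real.rpow_le_rpow_of_exponent_le (by linarith) hM
      calc _ ≤ (∑ i, ∑ j, (κ.out.dim : ℝ) * ‖coeffIntegral μ p κ.out i j‖) *
            (C * (2 ^ M * japanese b κ.out ^ M) * japanese b ξ ^ s) := by gcongr
        _ = _ := by ring
    refine (Finset.sum_le_sum fun κ _ => hterm κ).trans ?_
    rw [← Finset.sum_mul]
    refine (mul_le_mul_of_nonneg_right (hsum F) (by positivity)).trans (le_of_eq (by ring))
  refine opNorm_le_of_forall (by positivity) fun w v => ?_
  -- Each matrix element is continuous in the multiplier, so the bound for the partial sums of its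
  -- Fourier series passes to the limit.
  let Φ : SmoothFn E G → ℂ := fun q => star w ⬝ᵥ mulFourier T ξ q *ᵥ v
  have hΦ : Continuous Φ := by
    have h1 : Φ = fun q => ∑ i, star (w i) * ∑ j, T (conjFn (ξ.coeff E j i) * q) * v j := by
      funext q
      simp only [Φ, dotProduct, Matrix.mulVec, Pi.star_apply, mulFourier_apply, fourier_apply,
        mulDistrib_apply, mul_comm q]
    rw [h1]
    refine continuous_finsetSum _ fun i _ => continuous_const.mul (continuous_finsetSum _ fun j _ =>
      Continuous.mul ?_ continuous_const)
    exact T.continuous.comp (continuous_mulFn _)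
  have hlim : Filter.Tendsto (fun F : Finset (Quotient (uirrepSetoid G)) =>
      ‖Φ (∑ κ ∈ F, fourierPart μ p κ.out)‖) Filter.atTop (nhds ‖Φ p‖) :=
    ((hΦ.tendsto p).comp (hasSum_fourierPart μ hb p)).norm
  refine le_of_tendsto' hlim fun F => ?_
  refine (norm_star_dotProduct_mulVec_le _ w v).trans ?_
  gcongr
  exact hF F

variable {P : Module.End ℂ (SmoothFn E G)} {s : ℝ} {σ : Symb E G}

/-- The two estimates may come with different distributions. Injectivity of the Fourier transform
identifies them, after which the products with `p` and `q` can be added. -/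
theorem SymbolEstimate.add_left
    (μ : Measure G) [μ.IsHaarMeasure] [IsProbabilityMeasure μ] (hb : IsBiinvariantFrame b)
    {p q : SmoothFn E G}
    (hp : SymbolEstimate b p P s σ) (hq : SymbolEstimate b q P s σ) :
    SymbolEstimate b (p + q) P s σ := by
  obtain ⟨C, hC⟩ := hp
  obtain ⟨D, hD⟩ := hq
  refine ⟨C + D, fun x => ?_⟩
  obtain ⟨a, ⟨T, hT, rfl⟩, ha⟩ := hC x
  obtain ⟨c, ⟨S, hS, rfl⟩, hc⟩ := hD x
  obtain rfl : T = S := eq_of_fourier_eq μ hb (hT.trans hS.symm)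
  refine ⟨_, ⟨T, hT, rfl⟩, fun ξ => ?_⟩
  rw [← mulFourier_apply, map_add, add_mul]
  exact (opNorm_add_le _ _).trans (add_le_add (ha ξ) (hc ξ))

theorem SymbolEstimate.mul_left
    (μ : Measure G) [μ.IsHaarMeasure] [IsProbabilityMeasure μ] (hb : IsBiinvariantFrame b)
    (p : SmoothFn E G) {q : SmoothFn E G}
    (hq : SymbolEstimate b q P s σ) : SymbolEstimate b (p * q) P s σ := by
  obtain ⟨C, hC⟩ := hq
  obtain ⟨D, hD, hmul⟩ := exists_opNorm_fourier_mulDistrib_le μ hb s p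
  refine ⟨D * |C|, fun x => ?_⟩
  obtain ⟨a, ⟨T, hT, rfl⟩, ha⟩ := hC x
  refine ⟨_, ⟨T, hT, rfl⟩, ?_⟩
  have h1 : mulDistrib (p * q) T = mulDistrib p (mulDistrib q T) := by
    ext h
    rw [mulDistrib_apply, mulDistrib_apply, mulDistrib_apply]
    congr 1
    ring
  rw [h1]
  refine hmul _ _ (abs_nonneg C) fun ζ => (ha ζ).trans ?_
  exact mul_le_mul_of_nonneg_right (le_abs_self C) (Real.rpow_nonneg (japanese_pos hb ζ).le _)

/-- The functions of the difference operators with a given symbol estimate form an ideal. -/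
theorem SymbolEstimate.of_mem_ideal
    (μ : Measure G) [μ.IsHaarMeasure] [IsProbabilityMeasure μ] (hb : IsBiinvariantFrame b)
    {S : Set (SmoothFn E G)}
    (hS : S.Nonempty) (h : ∀ q ∈ S, SymbolEstimate b q P s σ) {p : SmoothFn E G}
    (hp : p ∈ Ideal.span S) : SymbolEstimate b p P s σ := by
  induction hp using Submodule.span_induction with
  | mem q hq => exact h q hq
  -- Even the zero multiplier requires the symbol to be the Fourier transform of a distribution,
  -- which an element of the nonempty set supplies.
  | zero =>
    obtain ⟨q, hq⟩ := hS
    simpa using (h q hq).mul_left μ hb 0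
  | add p q _ _ hp hq => exact hp.add_left μ hb hq
  | smul p q _ hq => exact hq.mul_left μ hb p

end Multiplication

/-! ### Monomials in the generators of an ideal -/

section Monomials

variable {R : Type*} [CommRing R]

/-- The powers of an ideal are generated by the monomials in the generators. -/
theorem span_range_pow_le {r : ℕ} (q : Fin r → R) (n : ℕ) :
    Ideal.span (range q) ^ n ≤
      Ideal.span {p | ∃ γ : Fin r → ℕ, ∑ j, γ j = n ∧ p = ∏ j, q j ^ γ j} := by
  induction n with
  | zero =>
    rw [pow_zero, Ideal.one_eq_top, top_le_iff, Ideal.eq_top_iff_one]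
    exact Ideal.subset_span ⟨0, by simp, by simp⟩
  | succ n ih =>
    rw [pow_succ']
    refine (Ideal.mul_mono_right ih).trans ?_
    rw [Ideal.span_mul_span', Ideal.span_le]
    rintro _ ⟨_, ⟨i, rfl⟩, _, ⟨γ, hγ, rfl⟩, rfl⟩
    refine Ideal.subset_span ⟨γ + Pi.single i 1, ?_, ?_⟩
    · simp [Finset.sum_add_distrib, hγ]
    · simp only [Pi.add_apply, pow_add, Finset.prod_mul_distrib]
      rw [mul_comm, Finset.prod_eq_single (f := fun j => q j ^ (Pi.single i 1 : Fin r → ℕ) j) i]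
      · simp
      · intro j _ hj
        simp [hj]
      · simp

/-- The product lies in the power $I^{|\alpha|}$ of the ideal. Keeping the total degree keeps the
exponent $m-|\alpha|$ in the estimates. -/
theorem prod_pow_mem_span {r : ℕ} {q p : Fin r → R} (h : ∀ j, p j ∈ Ideal.span (range q))
    (α : Fin r → ℕ) : ∏ j, p j ^ α j ∈
      Ideal.span {a | ∃ γ : Fin r → ℕ, ∑ j, γ j = ∑ j, α j ∧ a = ∏ j, q j ^ γ j} := by
  refine span_range_pow_le q _ ?_
  rw [← Finset.prod_pow_eq_pow_sum]
  exact Ideal.prod_mem_prod fun j _ => Ideal.pow_mem_pow (h j) _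

end Monomials

end LieSymbol
end

noncomputable section

namespace LieSymbol

/-! ### Hadamard's lemma -/

section Hadamard

variable {E : Type*} [NormedAddCommGroup E] [NormedSpace ℝ E] [FiniteDimensional ℝ E]

/-- Weighted means of a smooth function over the segments from the origin are smooth. -/
theorem contDiff_integral_segment (n : ℕ) : ∀ (f : E → ℂ) (h : ℝ → ℝ), ContDiff ℝ ∞ f →
    Continuous h → ContDiff ℝ n fun a => ∫ t in (0 : ℝ)..1, (h t : ℂ) * f (t • a) := by
  induction n with
  | zero =>
    intro f h hf hh
    refine contDiff_zero.2 ?_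
    have hc := hf.continuous
    exact intervalIntegral.continuous_parametric_intervalIntegral_of_continuous'
      (f := fun a t => (h t : ℂ) * f (t • a)) (by simp only [Function.uncurry_def]; fun_prop) 0 1
  | succ n ih =>
    intro f h hf hh
    have hc := hf.continuous
    have hfd : ContDiff ℝ ∞ (fderiv ℝ f) := hf.fderiv_right (by simp)
    have hfdc := hfd.continuous
    -- Differentiation replaces the weight $h(t)$ by $t\,h(t)$ and $f$ by its derivative, so the
    -- induction runs over all weights.
    have hder : ∀ a, HasFDerivAt (fun a => ∫ t in (0 : ℝ)..1, (h t : ℂ) * f (t • a))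
        (∫ t in (0 : ℝ)..1, ((h t * t : ℝ) : ℂ) • fderiv ℝ f (t • a)) a := by
      intro a
      have hcont : Continuous fun p : ℝ × E => ((h p.1 * p.1 : ℝ) : ℂ) • fderiv ℝ f (p.1 • p.2) := by
        fun_prop
      obtain ⟨C, hC⟩ := (isCompact_Icc.prod (isCompact_closedBall a 1)).exists_bound_of_continuousOn
        (s := Icc (0 : ℝ) 1 ×ˢ Metric.closedBall a 1) hcont.continuousOn
      refine intervalIntegral.hasFDerivAt_integral_of_dominated_of_fderiv_le (𝕜 := ℝ)
        (s := Metric.closedBall a 1)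
        (F' := fun a t => ((h t * t : ℝ) : ℂ) • fderiv ℝ f (t • a)) (bound := fun _ => C)
        (Metric.closedBall_mem_nhds a one_pos) ?_ ?_ ?_ ?_ ?_ ?_
      · exact Filter.Eventually.of_forall fun x =>
          (by fun_prop : Continuous fun t : ℝ => (h t : ℂ) * f (t • x)).aestronglyMeasurable
      · exact (by fun_prop : Continuous fun t : ℝ => (h t : ℂ) * f (t • a)).intervalIntegrable _ _
      · exact (by fun_prop : Continuous fun t : ℝ =>
          ((h t * t : ℝ) : ℂ) • fderiv ℝ f (t • a)).aestronglyMeasurable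
      · refine Filter.Eventually.of_forall fun t ht x hx => hC (t, x) ⟨?_, hx⟩
        rw [uIoc_of_le zero_le_one] at ht
        exact ⟨ht.1.le, ht.2⟩
      · exact intervalIntegrable_const
      · refine Filter.Eventually.of_forall fun t _ x _ => ?_
        have h1 : HasFDerivAt f (fderiv ℝ f (t • x)) (t • x) :=
          (hf.differentiable (by simp) _).hasFDerivAt
        have h2 := (h1.comp x ((hasFDerivAt_id x).const_smul t)).const_mul (h t : ℂ)
        refine h2.congr_fderiv ?_
        ext v
        simp [mul_assoc]
    push_cast
    rw [contDiff_succ_iff_fderiv]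
    refine ⟨fun a => (hder a).differentiableAt, by simp, ?_⟩
    rw [contDiff_clm_apply_iff]
    intro v
    have h1 := ih (fun a => fderiv ℝ f a v) (fun t => h t * t) (hfd.clm_apply contDiff_const)
      (by fun_prop)
    refine (congrArg (ContDiff ℝ n) (funext fun a => ?_)).mpr h1
    have hi : IntervalIntegrable (fun t : ℝ => ((h t * t : ℝ) : ℂ) • fderiv ℝ f (t • a)) volume 0 1 :=
      (by fun_prop : Continuous fun t : ℝ =>
        ((h t * t : ℝ) : ℂ) • fderiv ℝ f (t • a)).intervalIntegrable _ _
    rw [(hder a).fderiv, ContinuousLinearMap.intervalIntegral_apply hi]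
    rfl

/-- Hadamard's lemma. -/
theorem exists_eq_sum_coord_mul {F : E → ℂ} (hF : ContDiff ℝ ∞ F) (h0 : F 0 = 0) :
    ∃ g : Fin (Module.finrank ℝ E) → E → ℂ, (∀ k, ContDiff ℝ ∞ (g k)) ∧
      ∀ a, F a = ∑ k, g k a * ((Module.finBasis ℝ E).repr a k : ℂ) := by
  have hfd : ContDiff ℝ ∞ (fderiv ℝ F) := hF.fderiv_right (by simp)
  have hfdc := hfd.continuous
  refine ⟨fun k a => ∫ t in (0 : ℝ)..1, ((1 : ℝ) : ℂ) * fderiv ℝ F (t • a) (Module.finBasis ℝ E k),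
    fun k => contDiff_infty.2 fun n => contDiff_integral_segment n
      (fun a => fderiv ℝ F a (Module.finBasis ℝ E k)) (fun _ => 1)
      (hfd.clm_apply contDiff_const) continuous_const, fun a => ?_⟩
  have h1 : ∀ t ∈ uIcc (0 : ℝ) 1, HasDerivAt (fun t : ℝ => F (t • a)) (fderiv ℝ F (t • a) a) t := by
    intro t _
    have h2 : HasFDerivAt F (fderiv ℝ F (t • a)) (t • a) :=
      (hF.differentiable (by simp) _).hasFDerivAt
    have h3 : HasDerivAt (fun t : ℝ => t • a) a t := by
      simpa using (hasDerivAt_id t).smul_const a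
    exact h2.comp_hasDerivAt t h3
  have h2 := intervalIntegral.integral_eq_sub_of_hasDerivAt h1
    ((by fun_prop : Continuous fun t : ℝ => fderiv ℝ F (t • a) a).intervalIntegrable _ _)
  rw [one_smul, zero_smul, h0, sub_zero] at h2
  rw [← h2]
  simp only [← intervalIntegral.integral_mul_const]
  rw [← intervalIntegral.integral_finsetSum fun k _ => (by fun_prop : Continuous fun t : ℝ =>
    ((1 : ℝ) : ℂ) * fderiv ℝ F (t • a) (Module.finBasis ℝ E k) *
      ((Module.finBasis ℝ E).repr a k : ℂ)).intervalIntegrable _ _]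
  refine intervalIntegral.integral_congr fun t _ => ?_
  conv_lhs => rw [← (Module.finBasis ℝ E).sum_repr a]
  rw [map_sum]
  conv_lhs => rw [(Module.finBasis ℝ E).sum_repr a]
  refine Finset.sum_congr rfl fun k _ => ?_
  rw [map_smul, Complex.real_smul, Complex.ofReal_one, one_mul, mul_comm]

end Hadamard

/-! ### Coordinates at the identity as smooth functions on the group -/

section Chart

variable {E G : Type*} [NormedAddCommGroup E] [NormedSpace ℝ E] [FiniteDimensional ℝ E]
  [TopologicalSpace G] [ChartedSpace E G] [Group G] [LieGroup 𝓘(ℝ, E) ∞ G] [CompactSpace G]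
  [T2Space G]

variable (E G) in
/-- A bump function at the identity. -/
def oneBump : SmoothBumpFunction 𝓘(ℝ, E) (1 : G) := Classical.arbitrary _

/-- A smooth function on the group that is `g` in the centred chart near the identity. -/
def chartFn (g : E → ℂ) (hg : ContDiff ℝ ∞ g) : SmoothFn E G :=
  ⟨fun x => (oneBump E G) x •
      g (chartAt E (1 : G) x - chartAt E (1 : G) 1), by
    refine SmoothBumpFunction.contMDiff_smul _ ?_
    exact hg.contMDiff.comp_contMDiffOn ((contDiff_id.sub contDiff_const).contMDiff.comp_contMDiffOn
      (contMDiffOn_chart (I := 𝓘(ℝ, E)) (n := ∞) (x := (1 : G))))⟩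

theorem chartFn_eventually_eq (g : E → ℂ) (hg : ContDiff ℝ ∞ g) :
    ∀ᶠ x in nhds (1 : G), chartFn g hg x = g (chartAt E (1 : G) x - chartAt E (1 : G) 1) := by
  filter_upwards [(oneBump E G).eventuallyEq_one] with x hx
  change (oneBump E G) x • g (chartAt E (1 : G) x - chartAt E (1 : G) 1) = _
  rw [hx, Pi.one_apply, one_smul]

theorem chartFn_one (g : E → ℂ) (hg : ContDiff ℝ ∞ g) : chartFn (G := G) g hg 1 = g 0 := by
  rw [(chartFn_eventually_eq g hg).self_of_nhds, sub_self]

/-- The coordinates of the centred chart at the identity, cut off. -/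
def chartCoord (k : Fin (Module.finrank ℝ E)) : SmoothFn E G :=
  chartFn (fun a => ((Module.finBasis ℝ E).repr a k : ℂ))
    ((Complex.ofRealCLM.comp ((Module.finBasis ℝ E).coord k).toContinuousLinearMap).contDiff)

theorem chartCoord_one (k : Fin (Module.finrank ℝ E)) : chartCoord (G := G) k 1 = 0 := by
  refine (chartFn_one _ _).trans ?_
  simp

theorem lieDeriv_chartCoord (k l : Fin (Module.finrank ℝ E)) :
    lieDeriv (toLie G (Module.finBasis ℝ E l)) (chartCoord k) 1 = if l = k then 1 else 0 := by
  let φ := chartAt E (1 : G)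
  have ho : φ 1 ∈ φ.target := φ.map_source (mem_chart_source E 1)
  rw [lieDeriv_one_eq_fderiv]
  let L : E →L[ℝ] ℂ := Complex.ofRealCLM.comp ((Module.finBasis ℝ E).coord k).toContinuousLinearMap
  have h1 : (fun a => chartCoord (G := G) k (φ.symm a)) =ᶠ[nhds (φ 1)] fun a => L (a - φ 1) := by
    have h2 : Filter.Tendsto φ.symm (nhds (φ 1)) (nhds 1) := by
      have := φ.continuousAt_symm ho
      rwa [ContinuousAt, φ.left_inv (mem_chart_source E 1)] at this
    filter_upwards [h2.eventually (chartFn_eventually_eq (E := E) (G := G) _ _), φ.open_target.mem_nhds ho] with a h3 h4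
    refine h3.trans ?_
    rw [φ.right_inv h4]
    rfl
  have h2 : HasFDerivAt (fun a => L (a - φ 1)) L (φ 1) :=
    L.hasFDerivAt.comp (φ 1) ((hasFDerivAt_id (φ 1)).sub_const (φ 1))
  rw [h1.fderiv_eq, h2.fderiv]
  change ((((Module.finBasis ℝ E).repr (Module.finBasis ℝ E l)) k : ℝ) : ℂ) = _
  rw [Module.Basis.repr_self, Finsupp.single_apply]
  split_ifs <;> simp

theorem lieDeriv_one_congr (X : GroupLieAlgebra 𝓘(ℝ, E) G) {f g : SmoothFn E G}
    (h : (f : G → ℂ) =ᶠ[nhds (1 : G)] g) : lieDeriv X f 1 = lieDeriv X g 1 := by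
  refine (lieDeriv_apply_one X f).trans (Eq.trans ?_ (lieDeriv_apply_one X g).symm)
  have h1 := h.mfderiv_eq (I := 𝓘(ℝ, E)) (I' := 𝓘(ℝ, ℂ))
  exact congrArg (fun L => L X) h1

/-- Hadamard's lemma on the group. -/
theorem exists_eventually_eq_sum_chartCoord {p : SmoothFn E G} (hp : p 1 = 0) :
    ∃ g : Fin (Module.finrank ℝ E) → SmoothFn E G,
      ∀ᶠ x in nhds (1 : G), p x = ∑ k, g k x * chartCoord k x := by
  let φ := chartAt E (1 : G)
  have ho : φ 1 ∈ φ.target := φ.map_source (mem_chart_source E 1)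
  have hshift : Continuous fun a : E => a + φ 1 := by fun_prop
  obtain ⟨R, hR, hball⟩ := Metric.nhds_basis_closedBall.mem_iff.1
    (hshift.continuousAt.preimage_mem_nhds (x := 0) (by
      rw [zero_add]
      exact φ.open_target.mem_nhds ho))
  let β : ContDiffBump (0 : E) := ⟨R / 2, R, by positivity, by linarith⟩
  -- The cut-off makes `p` in the chart a smooth function on the whole model space without changing
  -- it near the origin.
  let F : E → ℂ := fun a => β a • p (φ.symm (a + φ 1))
  have hF : ContDiff ℝ ∞ F := by
    rw [contDiff_iff_contDiffAt]
    intro a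
    by_cases ha : a ∈ Metric.closedBall (0 : E) R
    · have h1 : ContDiffAt ℝ ∞ (fun a => p (φ.symm (a + φ 1))) a :=
        ContDiffAt.comp (g := fun a => p (φ.symm a)) (f := fun a => a + φ 1) a
          (contDiffAt_comp_chart_symm p (hball ha)) (by fun_prop)
      exact (β.contDiff.contDiffAt).smul h1
    · refine (contDiffAt_const (c := (0 : ℂ))).congr_of_eventuallyEq ?_
      filter_upwards [Metric.isClosed_closedBall.isOpen_compl.mem_nhds ha] with c hc
      have hc' : β c = 0 := β.zero_of_le_dist (by
        rw [mem_compl_iff, Metric.mem_closedBall, not_le] at hc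
        exact hc.le)
      simp only [F, hc', zero_smul]
  have hF0 : F 0 = 0 := by
    simp only [F, zero_add]
    rw [φ.left_inv (mem_chart_source E 1), hp, smul_zero]
  obtain ⟨g, hg, hsum⟩ := exists_eq_sum_coord_mul hF hF0
  refine ⟨fun k => chartFn (g k) (hg k), ?_⟩
  have hev : ∀ᶠ x in nhds (1 : G), ∀ k, chartFn (g k) (hg k) x = g k (φ x - φ 1) ∧
      chartCoord k x = ((Module.finBasis ℝ E).repr (φ x - φ 1) k : ℂ) :=
    Filter.eventually_all.2 fun k =>
      (chartFn_eventually_eq (g k) (hg k)).and (chartFn_eventually_eq _ _)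
  have hnear : ∀ᶠ x in nhds (1 : G), φ x - φ 1 ∈ Metric.closedBall (0 : E) (R / 2) := by
    have h1 : ContinuousAt (fun x => φ x - φ 1) 1 :=
      (φ.continuousAt (mem_chart_source E 1)).sub continuousAt_const
    refine h1.eventually (Metric.closedBall_mem_nhds_of_mem ?_)
    change φ 1 - φ 1 ∈ _
    rw [sub_self]
    exact Metric.mem_ball_self (by positivity)
  filter_upwards [hev, hnear, chart_source_mem_nhds E (1 : G)] with x h1 h2 h3
  have h4 : F (φ x - φ 1) = p x := by
    simp only [F, sub_add_cancel]
    rw [φ.left_inv h3, β.one_of_mem_closedBall h2, one_smul]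
  rw [← h4, hsum]
  exact Finset.sum_congr rfl fun k _ => by rw [(h1 k).1, (h1 k).2]

end Chart

/-! ### Strongly admissible families generate the maximal ideal at the identity -/

section Ideal

variable {E G : Type*} [NormedAddCommGroup E] [NormedSpace ℝ E] [FiniteDimensional ℝ E]
  [TopologicalSpace G] [ChartedSpace E G] [Group G] [LieGroup 𝓘(ℝ, E) ∞ G] [CompactSpace G]
  [T2Space G]

theorem isUnit_smoothFn {f : SmoothFn E G} (hf : ∀ x, f x ≠ 0) : IsUnit f := by
  let g : SmoothFn E G := ⟨fun x => (f x)⁻¹, fun x =>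
    ContMDiffAt.comp x (contDiffAt_inv ℝ (hf x)).contMDiffAt f.contMDiff.contMDiffAt⟩
  refine IsUnit.of_mul_eq_one g ?_
  ext x
  exact mul_inv_cancel₀ (hf x)

/-- Evaluation at the identity. -/
def evalOne : SmoothFn E G →+* ℂ where
  toFun f := f 1
  map_one' := rfl
  map_mul' _ _ := rfl
  map_zero' := rfl
  map_add' _ _ := rfl

variable {r : ℕ} {q : Fin r → SmoothFn E G}

/-- The ideal generated by functions whose only common zero is the identity is determined by the
germs at the identity. -/
theorem mem_span_of_mul_mem (hq : ⋂ j, {x : G | q j x = 0} = {1}) {d f : SmoothFn E G}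
    (hd : d 1 ≠ 0) (h : d * f ∈ Ideal.span (range q)) : f ∈ Ideal.span (range q) := by
  -- This function is $|d|^2+\sum|q_j|^2$: positive at the identity because of `d`, and elsewhere
  -- because some `q j` does not vanish. Hence it is a unit, while its product with `f` lies in the
  -- ideal.
  let w : SmoothFn E G := conjFn d * d + ∑ j, conjFn (q j) * q j
  have hw : ∀ x, w x = ((‖d x‖ ^ 2 + ∑ j, ‖q j x‖ ^ 2 : ℝ) : ℂ) := by
    intro x
    change star (d x) * d x + (∑ j, conjFn (q j) * q j) x = _
    rw [smoothFn_sum_apply]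
    push_cast
    congr 1
    · exact RCLike.conj_mul _
    · exact Finset.sum_congr rfl fun j _ => RCLike.conj_mul _
  have hw0 : ∀ x, w x ≠ 0 := by
    intro x
    rw [hw]
    refine Complex.ofReal_ne_zero.2 (ne_of_gt ?_)
    by_cases hx : x = 1
    · subst hx
      have : 0 < ‖d 1‖ := norm_pos_iff.2 hd
      exact add_pos_of_pos_of_nonneg (by positivity) (Finset.sum_nonneg fun _ _ => by positivity)
    · obtain ⟨j, hj⟩ : ∃ j, q j x ≠ 0 := by
        by_contra! hall
        have : x ∈ ⋂ j, {x : G | q j x = 0} := mem_iInter.2 hall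
        rw [hq] at this
        exact hx this
      refine add_pos_of_nonneg_of_pos (by positivity) (Finset.sum_pos' (fun _ _ => by positivity)
        ⟨j, Finset.mem_univ j, ?_⟩)
      have : 0 < ‖q j x‖ := norm_pos_iff.2 hj
      positivity
  obtain ⟨v, hv⟩ := isUnit_smoothFn hw0
  have h1 : w * f ∈ Ideal.span (range q) := by
    rw [add_mul, Finset.sum_mul, mul_assoc]
    refine Ideal.add_mem _ (Ideal.mul_mem_left _ _ h) (Ideal.sum_mem _ fun j _ => ?_)
    exact Ideal.mul_mem_right _ _ (Ideal.mul_mem_left _ _ (Ideal.subset_span ⟨j, rfl⟩))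
  rw [← hv] at h1
  exact (Ideal.unit_mul_mem_iff_mem _ v.isUnit).1 h1

/-- A bump function supported where `f` vanishes has product zero with `f` and is nonzero at the
identity. -/
theorem mem_span_of_eventually_zero (hq : ⋂ j, {x : G | q j x = 0} = {1}) {f : SmoothFn E G}
    (hf : ∀ᶠ x in nhds (1 : G), f x = 0) : f ∈ Ideal.span (range q) := by
  obtain ⟨β, -, hβ⟩ := ((SmoothBumpFunction.nhds_basis_support (I := 𝓘(ℝ, E))
    (c := (1 : G)) hf).mem_iff).1 hf
  let d : SmoothFn E G := ⟨fun x => β x • (1 : ℂ), β.contMDiff_smul contMDiffOn_const⟩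
  refine mem_span_of_mul_mem hq (d := d) ?_ ?_
  · change β 1 • (1 : ℂ) ≠ 0
    simp
  · have : d * f = 0 := by
      ext x
      change (β x • (1 : ℂ)) * f x = 0
      by_cases hx : x ∈ Function.support β
      · rw [hβ hx, mul_zero]
      · rw [Function.notMem_support.1 hx, zero_smul, zero_mul]
    rw [this]
    exact Ideal.zero_mem _

/-- By the rank condition the differentials of the `q j` span all complex covectors, so a
combination of them equals the differential of a given coordinate. -/
theorem exists_sub_sum_smul_lieDeriv_eq_zero (hq : Admissible q) (k : Fin (Module.finrank ℝ E)) :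
    ∃ c : Fin r → ℂ, ∀ X : E,
      lieDeriv (toLie G X) (chartCoord k - ∑ j, c j • q j) 1 = 0 := by
  let D : Fin (Module.finrank ℝ E) → E →L[ℝ] ℂ := fun k => diffAtOne (chartCoord (G := G) k)
  have hD : Submodule.span ℂ (range D) = ⊤ := by
    refine eq_top_iff.2 fun L _ => ?_
    have h1 : L = ∑ l, L (Module.finBasis ℝ E l) • D l := by
      refine ContinuousLinearMap.coe_injective ((Module.finBasis ℝ E).ext fun m => ?_)
      change L _ = (∑ l, L (Module.finBasis ℝ E l) • D l) (Module.finBasis ℝ E m)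
      rw [_root_.sum_apply]
      simp [D, diffAtOne_apply, lieDeriv_chartCoord]
    rw [h1]
    exact Submodule.sum_mem _ fun l _ => Submodule.smul_mem _ _ (Submodule.subset_span ⟨l, rfl⟩)
  have hfin : FiniteDimensional ℂ (E →L[ℝ] ℂ) := by
    refine Module.finite_def.2 ?_
    rw [← hD]
    exact Submodule.fg_span (finite_range D)
  have htop : Submodule.span ℂ (range fun j => diffAtOne (q j)) = ⊤ := by
    refine Submodule.eq_top_of_finrank_eq (le_antisymm (Submodule.finrank_le _) ?_)
    rw [hq.2.2]
    have := finrank_range_le_card (R := ℂ) D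
    rw [Set.finrank, hD, finrank_top, Fintype.card_fin] at this
    exact this
  obtain ⟨c, hc⟩ := (Submodule.mem_span_range_iff_exists_fun ℂ).1
    (htop.symm ▸ Submodule.mem_top : D k ∈ Submodule.span ℂ (range fun j => diffAtOne (q j)))
  refine ⟨c, fun X => ?_⟩
  have h1 := congrArg (fun L : E →L[ℝ] ℂ => L X) hc
  simp only [_root_.sum_apply, _root_.smul_apply, D, diffAtOne_apply, smul_eq_mul] at h1
  rw [map_sub, map_sum]
  simp only [map_smul]
  change lieDeriv (toLie G X) (chartCoord k) 1 - (∑ j, c j • lieDeriv (toLie G X) (q j)) 1 = 0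
  rw [smoothFn_sum_apply, sub_eq_zero, ← h1]
  rfl

theorem VanishesToOrder.apply_one {p : SmoothFn E G} (hp : VanishesToOrder 1 p) : p 1 = 0 :=
  hp 0 one_pos 1 (Submodule.subset_span ⟨[], le_rfl, rfl⟩)

/-- A Nakayama argument made explicit. Modulo the ideal, the coordinates satisfy $x=hx$ for a matrix
$h$ vanishing at the identity. The adjugate of $M=1-h$ puts $\det(M)\,x_k$ in the ideal, and $\det
M=1$ at the identity, so the determinant can be removed. -/
theorem chartCoord_mem_span (hq : StronglyAdmissible q) (k : Fin (Module.finrank ℝ E)) :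
    chartCoord k ∈ Ideal.span (range q) := by
  choose c hc using exists_sub_sum_smul_lieDeriv_eq_zero hq.1
  have hq1 : ∀ j, q j 1 = 0 := fun j => (hq.1.1 j).apply_one
  have hsum1 : ∀ k, (∑ j, c k j • q j) 1 = 0 := fun k => by
    rw [smoothFn_sum_apply]
    exact Finset.sum_eq_zero fun j _ => by rw [smul_apply, hq1, mul_zero]
  have hz : ∀ k, (chartCoord k - ∑ j, c k j • q j : SmoothFn E G) 1 = 0 := fun k => by
    change chartCoord k 1 - (∑ j, c k j • q j) 1 = 0
    rw [hsum1, chartCoord_one, sub_zero]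
  choose h hh using fun k => exists_eventually_eq_sum_chartCoord (hz k)
  -- The remainder has zero differential at the identity. Differentiating its Hadamard expansion
  -- there leaves exactly the coefficients `h k l 1`.
  have hh1 : ∀ k l, h k l 1 = 0 := by
    intro k l
    have h1 : (chartCoord k - ∑ j, c k j • q j : SmoothFn E G) =ᶠ[nhds (1 : G)]
        (∑ m, h k m * chartCoord m : SmoothFn E G) := by
      filter_upwards [hh k] with x hx
      rw [hx, smoothFn_sum_apply]
      rfl
    have h2 := lieDeriv_one_congr (toLie G (Module.finBasis ℝ E l)) h1
    rw [hc, map_sum, smoothFn_sum_apply] at h2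
    have h3 : ∀ m, lieDeriv (toLie G (Module.finBasis ℝ E l)) (h k m * chartCoord m) 1 =
        if l = m then h k m 1 else 0 := by
      intro m
      rw [lieDeriv_mul]
      change _ * chartCoord (G := G) m 1 + h k m 1 * _ = _
      rw [chartCoord_one, lieDeriv_chartCoord]
      split_ifs <;> simp
    simpa [h3] using h2.symm
  let M : Matrix (Fin (Module.finrank ℝ E)) (Fin (Module.finrank ℝ E)) (SmoothFn E G) :=
    1 - Matrix.of h
  have hM : ∀ k, (M.mulVec chartCoord) k ∈ Ideal.span (range q) := by
    intro k
    have h1 : (M.mulVec chartCoord) k = (∑ j, c k j • q j) +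
        ((chartCoord k - ∑ j, c k j • q j) - ∑ l, h k l * chartCoord l) := by
      simp only [M, Matrix.sub_mulVec, Matrix.one_mulVec, Pi.sub_apply]
      change chartCoord k - ∑ l, h k l * chartCoord l = _
      ring
    rw [h1]
    refine Ideal.add_mem _ (Ideal.sum_mem _ fun j _ => ?_) (mem_span_of_eventually_zero hq.2 ?_)
    · rw [← one_mul (q j), ← smul_mul_smoothFn]
      exact Ideal.mul_mem_left _ _ (Ideal.subset_span ⟨j, rfl⟩)
    · filter_upwards [hh k] with x hx
      change (chartCoord k - ∑ j, c k j • q j : SmoothFn E G) x - (∑ l, h k l * chartCoord l : SmoothFn E G) x = 0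
      rw [hx, smoothFn_sum_apply, sub_eq_zero]
      rfl
  refine mem_span_of_mul_mem hq.2 (d := M.det) ?_ ?_
  · have h1 : evalOne M.det = 1 := by
      rw [RingHom.map_det]
      have : evalOne.mapMatrix M = 1 := by
        ext k l
        simp only [M, RingHom.mapMatrix_apply, Matrix.map_apply, Matrix.sub_apply, Matrix.of_apply,
          map_sub]
        have h2 : evalOne (h k l) = 0 := hh1 k l
        rw [h2, sub_zero, Matrix.one_apply, Matrix.one_apply]
        split_ifs <;> simp
      rw [this, Matrix.det_one]
    change evalOne M.det ≠ 0
    rw [h1]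
    exact one_ne_zero
  · have h1 : (M.adjugate.mulVec (M.mulVec chartCoord)) k = M.det * chartCoord k := by
      rw [Matrix.mulVec_mulVec, Matrix.adjugate_mul, Matrix.smul_mulVec, Matrix.one_mulVec]
      rfl
    rw [← h1]
    change ∑ l, M.adjugate k l * M.mulVec chartCoord l ∈ _
    exact Ideal.sum_mem _ fun l _ => Ideal.mul_mem_left _ _ (hM l)

/-- A strongly admissible family generates the ideal of the functions that vanish at the
identity. -/
theorem StronglyAdmissible.mem_span (hq : StronglyAdmissible q) {p : SmoothFn E G} (hp : p 1 = 0) :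
    p ∈ Ideal.span (range q) := by
  obtain ⟨g, hg⟩ := exists_eventually_eq_sum_chartCoord hp
  have h1 : p = (p - ∑ k, g k * chartCoord k) + ∑ k, g k * chartCoord k := by ring
  rw [h1]
  refine Ideal.add_mem _ (mem_span_of_eventually_zero hq.2 ?_) (Ideal.sum_mem _ fun k _ =>
    Ideal.mul_mem_left _ _ (chartCoord_mem_span hq k))
  filter_upwards [hg] with x hx
  change p x - (∑ k, g k * chartCoord k : SmoothFn E G) x = 0
  rw [hx, smoothFn_sum_apply, sub_eq_zero]
  rfl

end Ideal

end LieSymbol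
end

noncomputable section

namespace LieSymbol

/-! ### The three conditions for the conjugated symbol -/

section Conjugation

variable {E G : Type*} [NormedAddCommGroup E] [NormedSpace ℝ E] [FiniteDimensional ℝ E]
  [TopologicalSpace G] [ChartedSpace E G] [Group G] [LieGroup 𝓘(ℝ, E) ∞ G] [CompactSpace G]
  [T2Space G]
  {b Y : Module.Basis (Fin (Module.finrank ℝ E)) ℝ (GroupLieAlgebra 𝓘(ℝ, E) G)}
  {m : ℝ} {σ : Symb E G}

theorem conjTransl_prod_pow (u : G) {r : ℕ} (q : Fin r → SmoothFn E G) (α : Fin r → ℕ) :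
    conjTransl u (∏ j, q j ^ α j) = ∏ j, conjTransl u (q j) ^ α j := by
  rw [conjTransl_prod]
  exact Finset.prod_congr rfl fun j _ => conjTransl_pow u (q j) (α j)

theorem CondB.conjSymb (h : CondB b m σ) (u : G) : CondB b m (conjSymb u σ) := by
  intro k P hP l q hq
  obtain ⟨Q, hQ, hPQ⟩ := exists_leftInvDiffOp_rightTransl u⁻¹ hP
  exact (h k Q hQ l _ (hq.conjTransl u)).conjSymb u hPQ

/-- The estimates for a conjugated family give the estimates for the conjugated symbol. -/
theorem FamilyEstimates.conjSymb {r : ℕ} {q : Fin r → SmoothFn E G} {u : G}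
    (h : FamilyEstimates b Y m (fun j => conjTransl u (q j)) σ) :
    FamilyEstimates b Y m q (conjSymb u σ) := by
  intro α β
  obtain ⟨k, hk⟩ := partialPow_mem_leftInvDiffOp Y β
  obtain ⟨Q, hQ, hPQ⟩ := exists_leftInvDiffOp_rightTransl u⁻¹ hk
  refine SymbolEstimate.conjSymb u hPQ ?_
  rw [conjTransl_prod_pow]
  -- The transported operator is not an ordered monomial, but it is a combination of ordered
  -- monomials.
  refine SymbolEstimate.of_mem_span ?_ (leftInvDiffOp_le_span_partialPow Y k hQ)
  rintro _ ⟨γ, rfl⟩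
  exact h α γ

/-- The estimates for a strongly admissible family imply those for all families of functions that
vanish at the identity. -/
theorem FamilyEstimates.of_stronglyAdmissible [MeasurableSpace G] [BorelSpace G] (μ : Measure G)
    [μ.IsHaarMeasure] [IsProbabilityMeasure μ] (hb : IsBiinvariantFrame b) {r : ℕ}
    {q p : Fin r → SmoothFn E G} (hq : StronglyAdmissible q) (hp : ∀ j, p j 1 = 0)
    (h : FamilyEstimates b Y m q σ) : FamilyEstimates b Y m p σ := by
  intro α β
  have hmem := prod_pow_mem_span (fun j => hq.mem_span (hp j)) α
  refine SymbolEstimate.of_mem_ideal μ hb ?_ ?_ hmem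
  · exact ⟨_, α, rfl, rfl⟩
  · rintro _ ⟨γ, hγ, rfl⟩
    rw [← hγ]
    exact h γ β

end Conjugation

end LieSymbol
end

open LieSymbol in
theorem corollary2p3
    {E G : Type*} [NormedAddCommGroup E] [NormedSpace ℝ E] [FiniteDimensional ℝ E]
    [TopologicalSpace G] [ChartedSpace E G] [Group G] [LieGroup 𝓘(ℝ, E) ∞ G]
    [CompactSpace G] [T2Space G] [MeasurableSpace G] [BorelSpace G]
    (μ : Measure G) [μ.IsHaarMeasure] [IsProbabilityMeasure μ]
    (b : Module.Basis (Fin (Module.finrank ℝ E)) ℝ (GroupLieAlgebra 𝓘(ℝ, E) G))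
    (hb : IsBiinvariantFrame b)
    (Y : Module.Basis (Fin (Module.finrank ℝ E)) ℝ (GroupLieAlgebra 𝓘(ℝ, E) G))
    (m : ℝ) (A : SmoothFn E G →L[ℂ] Distrib E G) (σ : Symb E G) (hσ : IsSymbolOf μ σ A) (u : G) :
    ∃ τ : Symb E G, IsSymbolOf μ τ (conjOp u A) ∧
      (∀ (x : G) (ξ : UIrrep G),
        τ.eval x ξ = (ξ.mat u).conjTranspose * σ.eval (x * u⁻¹) ξ * ξ.mat u) ∧
      (CondB b m σ → CondB b m τ) ∧
      (CondC μ b Y m σ → CondC μ b Y m τ) ∧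
      (∀ (r : ℕ) (q : Fin r → SmoothFn E G), CondD b Y m q σ → CondD b Y m q τ) := by
  have := topologicalGroup_of_lieGroup 𝓘(ℝ, E) ∞ (G := G)
  have := isMulRightInvariant_of_isProbabilityMeasure μ
  refine ⟨conjSymb u σ, isSymbolOf_conjSymb μ hσ u, conjSymb_eval u σ, fun h => h.conjSymb u,
    fun h => ⟨fun r q hq => ?_, h.2.conjSymb u⟩, fun r q h => ⟨h.1, ?_⟩⟩
  -- In (C) the conjugated family is admissible, so the hypothesis covers it directly.
  · exact (h.1 r _ (hq.conjTransl u)).conjSymb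
  -- In (D) the conjugated family is a different one. It vanishes at the identity, so the ideal
  -- argument supplies its estimates.
  · refine FamilyEstimates.conjSymb (h.2.of_stronglyAdmissible μ hb h.1 fun j => ?_)
    rw [conjTransl_apply, mul_one, inv_mul_cancel]
    exact (h.1.1.1 j).apply_one
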